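/- Let $\overline M$ be a smooth manifold with boundary, of dimension $n+1$, let $g$ be a Riemannian metric on its interior $M$, and let $\mathcal U$ be an open neighbourhood of $\partial M$ in $\overline M$. A boundary defining function on $\mathcal U$ is a function $x=e^{\psi}\rho$ there, where $\rho\ge 0$ is smooth on $\overline M$, vanishes exactly on $\partial M$ and has $d\rho\ne0$ on $\partial M$, and $\psi$ is $C^2$ up to the boundary. It is called special for $g$, associated with the metric $h_0$ on $\partial M$, if $\overline g=x^2g$ extends to a Riemannian metric on $\mathcal U$ that is $C^2$ up to the boundary, $|d\log x|_g^2\equiv1$ in $\mathcal U\cap M$, and $\overline g|_{T\partial M}=h_0$. For such $x$, put $\overline N=\nabla^{\overline g}x$ and $h=\overline g-dx^2$, write $\partial_x=\mathcal L_{\overline N}$ (Lie derivative), let $h_j=\frac1{j!}\,\partial_x^{\,j}h\,\big|_{T\partial M}$ be the coefficients in $h(x)=h_0+h_1x+h_2x^2+\dots$, and define on $\partial M$ $$\kappa_1=\tfrac12\,\mathrm{tr}^{h_0}h_1,\qquad \kappa_2=\mathrm{tr}^{h_0}h_2-\tfrac12\|h_1\|^2_{h_0}.$$ In the interior, $\mathrm{tr}^h\partial_xh$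 is the trace of $\partial_x h$ over the tangent spaces of the level sets of $x$, with respect to the metric induced there by $\overline g$. **Proposition.** Let $x$ be a special boundary defining function on $\mathcal U$ associated with $h_0$, and let $\phi$ be a function, $C^2$ on $\mathcal U$ up to the boundary, with $\phi|_{\partial M}=\phi_0$, such that $\widehat x=e^{\phi}x$ is a special boundary defining function on $\mathcal U$ associated with $\widehat h_0=e^{2\phi_0}h_0$ (so that $\widehat x^{\,2}g=e^{2\phi}\overline g$). Then, for every $\varepsilon>0$, the mean curvature with respect to $g$ of the hypersurface $\{\widehat x=\varepsilon\}$ in $\mathcal U\cap M$ is $$H(\phi_0,\varepsilon)=n-\varepsilon^2\left(e^{-2\phi}\Big(\tfrac12\,x^{-1}\,\mathrm{tr}^h\partial_xh+\Delta_{\overline g}\phi+\tfrac{n-1}2\,|\nabla^{\overline g}\phi|^2_{\overline g}\Big)\right)\Big|_{x e^{\phi}=\varepsilon}.$$ Moreover, if $\kappa_1,\kappa_2$ and $\tilde\kappa_1,\tilde\kappa_2$ are the functions on $\partial M$ corresponding to $h_0$ (that is, to $x$, $\overline g$) and to $\widehat h_0$ (that is, to $\widehat x$, $\widehat x^{\,2}g$),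 then $$\tilde\kappa_1=e^{-\phi_0}\kappa_1,\qquad \tilde\kappa_2=e^{-2\phi_0}\Big(\kappa_2+\Delta_{h_0}\phi_0+\tfrac{n-2}2\,|\nabla^{h_0}\phi_0|^2_{h_0}\Big).$$ Here the mean curvature $H$ is the trace, with respect to the metric induced by $g$, of the second fundamental form $-\frac12\mathcal L_\nu g$, where $\nu$ is the unit normal field of the level sets of $\widehat x$ pointing in the direction in which $\widehat x$ increases, and $\Delta$ is the trace of the covariant Hessian. -/

import Mathlib

open scoped Manifold ContDiff

noncomputable section

namespace ConfCompact

/-! ### Tensor calculus in coordinates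

`S` is the domain on which derivatives are taken (a half-space, or everything), a 2-tensor field
is the matrix-valued function of its components, a vector field is the function of its components. -/

/-- The partial derivative `∂ᵢ f` (one-sided at the boundary points of `S`). -/
def pd {d : ℕ} (S : Set (EuclideanSpace ℝ (Fin d))) (i : Fin d)
    (f : EuclideanSpace ℝ (Fin d) → ℝ) (y : EuclideanSpace ℝ (Fin d)) : ℝ :=
  fderivWithin ℝ f S y (EuclideanSpace.single i 1)

/-- The gradient `(∇ᵃ u)ⁱ = aⁱʲ ∂ⱼ u`. -/
def cGrad {d : ℕ} (S : Set (EuclideanSpace ℝ (Fin d)))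
    (a : EuclideanSpace ℝ (Fin d) → Matrix (Fin d) (Fin d) ℝ)
    (u : EuclideanSpace ℝ (Fin d) → ℝ) (y : EuclideanSpace ℝ (Fin d)) (i : Fin d) : ℝ :=
  ∑ j, (a y)⁻¹ i j * pd S j u y

/-- `|∇ᵃ u|²ₐ = |du|²ₐ = aⁱʲ ∂ᵢ u ∂ⱼ u`. -/
def cGradSq {d : ℕ} (S : Set (EuclideanSpace ℝ (Fin d)))
    (a : EuclideanSpace ℝ (Fin d) → Matrix (Fin d) (Fin d) ℝ)
    (u : EuclideanSpace ℝ (Fin d) → ℝ) (y : EuclideanSpace ℝ (Fin d)) : ℝ :=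
  ∑ i, ∑ j, (a y)⁻¹ i j * pd S i u y * pd S j u y

/-- The Christoffel symbols `Γᵏᵢⱼ` of the Levi-Civita connection of `a`. -/
def christoffel {d : ℕ} (S : Set (EuclideanSpace ℝ (Fin d)))
    (a : EuclideanSpace ℝ (Fin d) → Matrix (Fin d) (Fin d) ℝ)
    (y : EuclideanSpace ℝ (Fin d)) (k i j : Fin d) : ℝ :=
  (1 / 2) * ∑ l, (a y)⁻¹ k l *
    (pd S i (fun z => a z j l) y + pd S j (fun z => a z i l) y - pd S l (fun z => a z i j) y)

/-- The covariant Hessian `∂ᵢ∂ⱼ u - Γᵏᵢⱼ ∂ₖ u`. -/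
def cHess {d : ℕ} (S : Set (EuclideanSpace ℝ (Fin d)))
    (a : EuclideanSpace ℝ (Fin d) → Matrix (Fin d) (Fin d) ℝ)
    (u : EuclideanSpace ℝ (Fin d) → ℝ) (y : EuclideanSpace ℝ (Fin d)) :
    Matrix (Fin d) (Fin d) ℝ :=
  Matrix.of fun i j => pd S i (pd S j u) y - ∑ k, christoffel S a y k i j * pd S k u y

/-- The trace `aⁱʲ Tᵢⱼ` of a symmetric 2-tensor `T` with respect to the metric `a`. -/
def tr {d : ℕ} (a T : Matrix (Fin d) (Fin d) ℝ) : ℝ := (a⁻¹ * T).trace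

/-- The squared norm `aⁱᵏ aʲˡ Tᵢⱼ Tₖₗ` of a symmetric 2-tensor `T`. -/
def normSq {d : ℕ} (a T : Matrix (Fin d) (Fin d) ℝ) : ℝ := (a⁻¹ * T * (a⁻¹ * T)).trace

/-- The Laplace-Beltrami operator, with the sign for which it is the trace of the Hessian. -/
def cLaplacian {d : ℕ} (S : Set (EuclideanSpace ℝ (Fin d)))
    (a : EuclideanSpace ℝ (Fin d) → Matrix (Fin d) (Fin d) ℝ)
    (u : EuclideanSpace ℝ (Fin d) → ℝ) (y : EuclideanSpace ℝ (Fin d)) : ℝ :=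
  tr (a y) (cHess S a u y)

/-- The trace of `T` over the orthogonal complement of the `a`-unit vector `ν`, with respect to
the metric which `a` induces there. -/
def trPerp {d : ℕ} (a : Matrix (Fin d) (Fin d) ℝ) (ν : Fin d → ℝ)
    (T : Matrix (Fin d) (Fin d) ℝ) : ℝ :=
  tr a T - ∑ i, ∑ j, ν i * ν j * T i j

/-- The Lie derivative `(ℒ_X T)ᵢⱼ = Xᵏ ∂ₖ Tᵢⱼ + Tₖⱼ ∂ᵢ Xᵏ + Tᵢₖ ∂ⱼ Xᵏ`. -/
def lie {d : ℕ} (S : Set (EuclideanSpace ℝ (Fin d)))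
    (X : EuclideanSpace ℝ (Fin d) → Fin d → ℝ)
    (T : EuclideanSpace ℝ (Fin d) → Matrix (Fin d) (Fin d) ℝ)
    (y : EuclideanSpace ℝ (Fin d)) : Matrix (Fin d) (Fin d) ℝ :=
  Matrix.of fun i j => ∑ k, (X y k * pd S k (fun z => T z i j) y
    + T y k j * pd S i (fun z => X z k) y + T y i k * pd S j (fun z => X z k) y)

/-- The unit normal field `∇ᵃ f / |∇ᵃ f|` of the level sets of `f`. -/
def cUnitNormal {d : ℕ} (S : Set (EuclideanSpace ℝ (Fin d)))
    (a : EuclideanSpace ℝ (Fin d) → Matrix (Fin d) (Fin d) ℝ)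
    (f : EuclideanSpace ℝ (Fin d) → ℝ) (y : EuclideanSpace ℝ (Fin d)) (i : Fin d) : ℝ :=
  cGrad S a f y i / Real.sqrt (cGradSq S a f y)

/-- The mean curvature at `y` of the level set of `f` through `y`: the trace, with respect to the
metric induced on the level set, of the second fundamental form `II = -(1/2) ℒ_ν a`, where `ν` is
the unit normal pointing in the direction in which `f` increases. -/
def cMeanCurvature {d : ℕ} (S : Set (EuclideanSpace ℝ (Fin d)))
    (a : EuclideanSpace ℝ (Fin d) → Matrix (Fin d) (Fin d) ℝ)
    (f : EuclideanSpace ℝ (Fin d) → ℝ) (y : EuclideanSpace ℝ (Fin d)) : ℝ :=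
  trPerp (a y) (cUnitNormal S a f y) (-(1 / 2 : ℝ) • lie S (cUnitNormal S a f) a y)

/-- The tensor `h = a - dx²`. -/
def cH {d : ℕ} (S : Set (EuclideanSpace ℝ (Fin d)))
    (a : EuclideanSpace ℝ (Fin d) → Matrix (Fin d) (Fin d) ℝ)
    (x : EuclideanSpace ℝ (Fin d) → ℝ) (y : EuclideanSpace ℝ (Fin d)) :
    Matrix (Fin d) (Fin d) ℝ :=
  a y - Matrix.of fun i j => pd S i x y * pd S j x y

/-- The operator `∂ₓ = ℒ_N` on 2-tensors, where `N = ∇ᵃ x`. -/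
def cDx {d : ℕ} (S : Set (EuclideanSpace ℝ (Fin d)))
    (a : EuclideanSpace ℝ (Fin d) → Matrix (Fin d) (Fin d) ℝ)
    (x : EuclideanSpace ℝ (Fin d) → ℝ) :
    (EuclideanSpace ℝ (Fin d) → Matrix (Fin d) (Fin d) ℝ) →
      EuclideanSpace ℝ (Fin d) → Matrix (Fin d) (Fin d) ℝ :=
  lie S (cGrad S a x)

/-! ### Manifolds with boundary -/

/-- Fields of bilinear forms on the tangent spaces of a manifold with boundary. -/
abbrev TensorField (n : ℕ) (M : Type*) [TopologicalSpace M]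
    [ChartedSpace (EuclideanHalfSpace (n + 1)) M] : Type _ :=
  (p : M) → TangentSpace (𝓡∂ (n + 1)) p →L[ℝ] TangentSpace (𝓡∂ (n + 1)) p →L[ℝ] ℝ

section Coordinates

variable {n : ℕ} {M : Type*} [TopologicalSpace M] [ChartedSpace (EuclideanHalfSpace (n + 1)) M]

/-- The closed half-space `{y | 0 ≤ y 0}`. -/
def halfSpace (n : ℕ) : Set (EuclideanSpace ℝ (Fin (n + 1))) := Set.range (𝓡∂ (n + 1))

/-- A function, read in the chart around `p`. -/
def coordFun (p : M) (u : M → ℝ) (y : EuclideanSpace ℝ (Fin (n + 1))) : ℝ :=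
  u ((extChartAt (𝓡∂ (n + 1)) p).symm y)

/-- The coordinate vector `∂ᵢ` of the chart around `p`, at the point with coordinates `y`. -/
def coordVec (p : M) (y : EuclideanSpace ℝ (Fin (n + 1))) (i : Fin (n + 1)) :
    TangentSpace (𝓡∂ (n + 1)) ((extChartAt (𝓡∂ (n + 1)) p).symm y) :=
  mfderivWithin 𝓘(ℝ, EuclideanSpace ℝ (Fin (n + 1))) (𝓡∂ (n + 1))
    (extChartAt (𝓡∂ (n + 1)) p).symm (halfSpace n) y
    (EuclideanSpace.single i (1 : ℝ) : EuclideanSpace ℝ (Fin (n + 1)))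

/-- The components `k(∂ᵢ, ∂ⱼ)` of a tensor field in the chart around `p`. -/
def coordTensor (p : M) (k : TensorField n M) (y : EuclideanSpace ℝ (Fin (n + 1))) :
    Matrix (Fin (n + 1)) (Fin (n + 1)) ℝ :=
  Matrix.of fun i j =>
    k ((extChartAt (𝓡∂ (n + 1)) p).symm y) (coordVec p y i) (coordVec p y j)

/-- The coordinates of `p` in the chart around `p`. -/
def coordPt (p : M) : EuclideanSpace ℝ (Fin (n + 1)) := extChartAt (𝓡∂ (n + 1)) p p

/-- `|∇ᵏ u|²ₖ` at `p`. -/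
def gradSq (k : TensorField n M) (u : M → ℝ) (p : M) : ℝ :=
  cGradSq (halfSpace n) (coordTensor p k) (coordFun p u) (coordPt p)

/-- `Δₖ u` at `p`. -/
def laplacian (k : TensorField n M) (u : M → ℝ) (p : M) : ℝ :=
  cLaplacian (halfSpace n) (coordTensor p k) (coordFun p u) (coordPt p)

/-- The mean curvature with respect to `k`, at `p`, of the level set of `f` through `p`; the unit
normal points in the direction in which `f` increases. -/
def meanCurvature (k : TensorField n M) (f : M → ℝ) (p : M) : ℝ :=
  cMeanCurvature (halfSpace n) (coordTensor p k) (coordFun p f) (coordPt p)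

/-- `trʰ ∂ₓh` at `p`, where `k = dx² + h`, `∂ₓh = ℒ_N h` with `N = ∇ᵏ x` (a `k`-unit field), and
the trace is taken over the tangent space of the level set of `x`, on which `h` is the induced
metric. -/
def trDxH (k : TensorField n M) (x : M → ℝ) (p : M) : ℝ :=
  trPerp (coordTensor p k (coordPt p))
    (cGrad (halfSpace n) (coordTensor p k) (coordFun p x) (coordPt p))
    (cDx (halfSpace n) (coordTensor p k) (coordFun p x)
      (cH (halfSpace n) (coordTensor p k) (coordFun p x)) (coordPt p))

/-- The Taylor coefficient `hⱼ = (1/j!) ∂ₓʲ h |_{x = 0}` at the boundary point `p`, where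
`k = dx² + h` and `∂ₓ = ℒ_N`, `N = ∇ᵏ x`. It is a tensor on the tangent space of the boundary, which
is spanned by the coordinate vectors other than `∂₀`. -/
def hCoeff (k : TensorField n M) (x : M → ℝ) (j : ℕ) (p : M) : Matrix (Fin n) (Fin n) ℝ :=
  ((1 / (j.factorial : ℝ)) • (cDx (halfSpace n) (coordTensor p k) (coordFun p x))^[j]
    (cH (halfSpace n) (coordTensor p k) (coordFun p x)) (coordPt p)).submatrix Fin.succ Fin.succ

/-- `κ₁ = (1/2) tr^{h₀} h₁`. -/
def kappa₁ (k : TensorField n M) (x : M → ℝ) (p : M) : ℝ :=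
  (1 / 2) * tr (hCoeff k x 0 p) (hCoeff k x 1 p)

/-- `κ₂ = tr^{h₀} h₂ - (1/2) ‖h₁‖²_{h₀}`. -/
def kappa₂ (k : TensorField n M) (x : M → ℝ) (p : M) : ℝ :=
  tr (hCoeff k x 0 p) (hCoeff k x 2 p) - (1 / 2) * normSq (hCoeff k x 0 p) (hCoeff k x 1 p)

/-! ### The boundary

The charts of `∂M` are the restrictions of the charts of `M` to the face `{y 0 = 0}`. Functions and
metrics on `∂M` are represented by functions and fields on `M`, of which only the values at the
points of `∂M` and on the vectors tangent to `∂M` are used. -/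

/-- The inclusion `y ↦ (0, y)` of the face of the half-space. -/
def face (y : EuclideanSpace ℝ (Fin n)) : EuclideanSpace ℝ (Fin (n + 1)) :=
  WithLp.toLp 2 (Fin.cons 0 fun i => y i)

/-- The coordinates of the boundary point `p` in the boundary chart around `p`. -/
def bdryPt (p : M) : EuclideanSpace ℝ (Fin n) :=
  WithLp.toLp 2 fun i => coordPt (n := n) p i.succ

/-- A function on `∂M`, read in the boundary chart around `p`. -/
def bdryFun (p : M) (u : M → ℝ) (y : EuclideanSpace ℝ (Fin n)) : ℝ := coordFun p u (face y)

/-- The components of a tensor on `∂M` in the boundary chart around `p`. -/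
def bdryTensor (p : M) (k : TensorField n M) (y : EuclideanSpace ℝ (Fin n)) :
    Matrix (Fin n) (Fin n) ℝ :=
  (coordTensor p k (face y)).submatrix Fin.succ Fin.succ

/-- `|∇^{h₀} u|²_{h₀}` on `∂M`. -/
def bdryGradSq (h₀ : TensorField n M) (u : M → ℝ) (p : M) : ℝ :=
  cGradSq Set.univ (bdryTensor p h₀) (bdryFun (n := n) p u) (bdryPt p)

/-- `Δ_{h₀} u` on `∂M`. -/
def bdryLaplacian (h₀ : TensorField n M) (u : M → ℝ) (p : M) : ℝ :=
  cLaplacian Set.univ (bdryTensor p h₀) (bdryFun (n := n) p u) (bdryPt p)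

/-- The vector `v` at the boundary point `p` is tangent to `∂M`. -/
def IsTangentToBoundary (p : M) (v : TangentSpace (𝓡∂ (n + 1)) p) : Prop :=
  let w : EuclideanSpace ℝ (Fin (n + 1)) :=
    mfderiv (𝓡∂ (n + 1)) 𝓘(ℝ, EuclideanSpace ℝ (Fin (n + 1))) (extChartAt (𝓡∂ (n + 1)) p) p v
  w 0 = 0

/-- A smooth boundary defining function. -/
structure IsDefiningFunction (n : ℕ) {M : Type*} [TopologicalSpace M]
    [ChartedSpace (EuclideanHalfSpace (n + 1)) M] (ρ : M → ℝ) : Prop where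
  smooth : ContMDiff (𝓡∂ (n + 1)) 𝓘(ℝ, ℝ) ∞ ρ
  nonneg : ∀ p, 0 ≤ ρ p
  eq_zero_iff : ∀ p, ρ p = 0 ↔ p ∈ (𝓡∂ (n + 1)).boundary M
  deriv_ne_zero : ∀ p ∈ (𝓡∂ (n + 1)).boundary M, mfderiv (𝓡∂ (n + 1)) 𝓘(ℝ, ℝ) ρ p ≠ 0

end Coordinates

/-- `x` is the special boundary defining function, on the neighbourhood `U` of `∂M`, of the metric
`g` on the interior, associated with the metric `h₀` on `∂M`, and `gbar` is the extension of `x² g`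
up to the boundary. -/
structure IsSpecialBdf {n : ℕ} {M : Type*} [TopologicalSpace M]
    [ChartedSpace (EuclideanHalfSpace (n + 1)) M] [IsManifold (𝓡∂ (n + 1)) ∞ M]
    (g h₀ : TensorField n M) (U : Set M) (x : M → ℝ) (gbar : TensorField n M) : Prop where
  /-- `x` is a boundary defining function: a smooth one times `e^ψ`, where `ψ` is `C²` up to the
  boundary. -/
  defining : ∃ ρ ψ : M → ℝ, IsDefiningFunction n ρ ∧ ContMDiffOn (𝓡∂ (n + 1)) 𝓘(ℝ, ℝ) 2 ψ U ∧
    ∀ p ∈ U, x p = Real.exp (ψ p) * ρ p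
  /-- `gbar` is a Riemannian metric on `U` which is `C²` up to the boundary ... -/
  symm : ∀ p ∈ U, ∀ v w, gbar p v w = gbar p w v
  pos : ∀ p ∈ U, ∀ v, v ≠ 0 → 0 < gbar p v v
  contMDiffOn : ContMDiffOn (𝓡∂ (n + 1))
    ((𝓡∂ (n + 1)).prod 𝓘(ℝ, EuclideanSpace ℝ (Fin (n + 1)) →L[ℝ]
      EuclideanSpace ℝ (Fin (n + 1)) →L[ℝ] ℝ)) 2
    (fun p => Bundle.TotalSpace.mk' (EuclideanSpace ℝ (Fin (n + 1)) →L[ℝ]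
      EuclideanSpace ℝ (Fin (n + 1)) →L[ℝ] ℝ)
      (E := fun p : M => TangentSpace (𝓡∂ (n + 1)) p →L[ℝ] TangentSpace (𝓡∂ (n + 1)) p →L[ℝ] ℝ)
      p (gbar p)) U
  /-- ... and which equals `x² g` in the interior. -/
  eq_sq_smul : ∀ p ∈ U, p ∈ (𝓡∂ (n + 1)).interior M → gbar p = (x p) ^ 2 • g p
  /-- `|d log x|²_g = 1`. -/
  eikonal : ∀ p ∈ U, p ∈ (𝓡∂ (n + 1)).interior M → gradSq g (fun q => Real.log (x q)) p = 1
  /-- The restriction of `gbar` to the tangent bundle of the boundary is `h₀`. -/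
  boundary_metric : ∀ p ∈ (𝓡∂ (n + 1)).boundary M, ∀ v w,
    IsTangentToBoundary p v → IsTangentToBoundary p w → gbar p v w = h₀ p v w

end ConfCompact

end

/-!
Everything is read in a chart, where `x` becomes a function `u` on a half-space and `x² g` a metric
`a`; then the statement follows from a few identities between tensors.

Let `N = ∇ᵃ u`. The eikonal equation says `|du|ₐ = 1`; at the boundary it holds by continuity. Its
consequences are `ℒ_N (du ⊗ du) = 0`, hence `∂ₓ h = ℒ_N h = ℒ_N a = 2 Hess u`, and `Hess u (N, ·) = 0`.
Taking traces gives `trʰ ∂ₓ h = 2 Δu`, and at the boundary `κ₁ = Δu` and `κ₂ = N(Δu)`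
(`IsSpecialOn.trPerp_lie_cH`, `IsSpecialOn.half_tr_lie_cH`, `IsSpecialOn.tr_lie_lie_cH`). The mean
curvature of the level sets of `u` with respect to `u⁻² a`, where the metric is `n + 1` dimensional,
is `n - u Δu` (`IsSpecialOn.cMeanCurvature_eq`).

For two special functions `u` and `û = e^φ u`, the difference of the eikonal equations is
`2 Nφ + u |dφ|² = 0` (`IsSpecialPair.sum_grad_mul_pd`). With the behaviour of the Laplacian under a
conformal change of metric this yields
`Δ̂û = e^{-φ} (Δu + u (Δφ + (n - 1)/2 |dφ|²))` (`IsSpecialPair.cLaplacian_fun`).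
The formula for the mean curvature and that for `κ₁` are read off. Differentiating along `N̂`, which
at the boundary is `e^{-φ} N`, where moreover `Nφ = 0`, one gets
`κ̂₂ = e^{-2φ} (κ₂ + Δφ + (n - 1)/2 |dφ|²)` (`IsSpecialPair.sum_grad_mul_pd_cLaplacian`).
Finally `N(Nφ) = -|dφ|²/2` at the boundary, and the integral curves of `N` are geodesics, so that the
Laplacian of the boundary metric is `Δφ + |dφ|²/2` there (`cLaplacian_face`); this turns the
coefficient `n - 1` into `n - 2`.

The delicate point is regularity. As `x` is only `C²`, the Hessian of `u` is a priori only
continuous, while `κ₂` involves its derivative, and differentiating the sum in `Δ̂û` requires that of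
`Δu`. It exists at the boundary points: by the eikonal equation, the first derivatives `∂ᵢ u` satisfy
a transport equation along `N` whose right-hand side is `C¹` (`IsSpecialOn.transport`), and the
tangential ones vanish at the boundary. By a comparison principle for the difference quotients
(`le_mul_of_transport_lt`), their tangential derivatives are differentiable there
(`differentiableWithinAt_pd_of_transport`), and the equation gives the remaining second derivatives
(`IsSpecialBdfOn.differentiableWithinAt_pd_pd`).
-/

namespace ConfCompact

open Filter Topology Matrix

/-! ### Partial derivatives within a chart domain -/

section PartialDerivatives

variable {d : ℕ} {S V : Set (EuclideanSpace ℝ (Fin d))} {y : EuclideanSpace ℝ (Fin d)}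
  {f f' : EuclideanSpace ℝ (Fin d) → ℝ} {i j : Fin d}

lemma pd_congr (h : f =ᶠ[𝓝[S] y] f') (hy : y ∈ S) : pd S i f y = pd S i f' y := by
  rw [pd, pd, h.fderivWithin_eq_of_mem hy]

lemma pd_eq_of_hasFDerivWithinAt {L : EuclideanSpace ℝ (Fin d) →L[ℝ] ℝ}
    (hs : UniqueDiffWithinAt ℝ S y) (h : HasFDerivWithinAt f L S y) :
    pd S i f y = L (EuclideanSpace.single i 1) := by
  rw [pd, h.fderivWithin hs]

/-- A linear functional in terms of its values on the coordinate vectors. -/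
lemma clm_apply_eq_sum (L : EuclideanSpace ℝ (Fin d) →L[ℝ] ℝ) (v : EuclideanSpace ℝ (Fin d)) :
    L v = ∑ k, v k * L (EuclideanSpace.single k 1) := by
  conv_lhs => rw [← (EuclideanSpace.basisFun (Fin d) ℝ).sum_repr v]
  simp [map_sum]

lemma pd_const (c : ℝ) : pd S i (fun _ => c) y = 0 := by
  simp [pd]

lemma pd_add (hs : UniqueDiffWithinAt ℝ S y) (hf : DifferentiableWithinAt ℝ f S y)
    (hf' : DifferentiableWithinAt ℝ f' S y) :
    pd S i (fun z => f z + f' z) y = pd S i f y + pd S i f' y := by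
  rw [pd_eq_of_hasFDerivWithinAt hs (hf.hasFDerivWithinAt.fun_add hf'.hasFDerivWithinAt)]; rfl

lemma pd_sub (hs : UniqueDiffWithinAt ℝ S y) (hf : DifferentiableWithinAt ℝ f S y)
    (hf' : DifferentiableWithinAt ℝ f' S y) :
    pd S i (fun z => f z - f' z) y = pd S i f y - pd S i f' y := by
  rw [pd_eq_of_hasFDerivWithinAt hs (hf.hasFDerivWithinAt.fun_sub hf'.hasFDerivWithinAt)]; rfl

lemma pd_mul (hs : UniqueDiffWithinAt ℝ S y) (hf : DifferentiableWithinAt ℝ f S y)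
    (hf' : DifferentiableWithinAt ℝ f' S y) :
    pd S i (fun z => f z * f' z) y = pd S i f y * f' y + f y * pd S i f' y := by
  rw [pd_eq_of_hasFDerivWithinAt hs (hf.hasFDerivWithinAt.fun_mul hf'.hasFDerivWithinAt)]
  simp [pd]; ring

lemma pd_sum {ι : Type*} (s : Finset ι) {F : ι → EuclideanSpace ℝ (Fin d) → ℝ}
    (hs : UniqueDiffWithinAt ℝ S y) (hF : ∀ k ∈ s, DifferentiableWithinAt ℝ (F k) S y) :
    pd S i (fun z => ∑ k ∈ s, F k z) y = ∑ k ∈ s, pd S i (F k) y := by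
  rw [pd_eq_of_hasFDerivWithinAt hs
    (HasFDerivWithinAt.fun_sum fun k hk => (hF k hk).hasFDerivWithinAt)]
  simp [pd]

lemma pd_sum_mul {ι : Type*} [Fintype ι] {F G : ι → EuclideanSpace ℝ (Fin d) → ℝ}
    (hs : UniqueDiffWithinAt ℝ S y) (hF : ∀ k, DifferentiableWithinAt ℝ (F k) S y)
    (hG : ∀ k, DifferentiableWithinAt ℝ (G k) S y) :
    pd S i (fun z => ∑ k, F k z * G k z) y
      = ∑ k, (pd S i (F k) y * G k y + F k y * pd S i (G k) y) := by
  rw [pd_sum _ hs fun k _ => (hF k).fun_mul (hG k)]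
  exact Finset.sum_congr rfl fun k _ => pd_mul hs (hF k) (hG k)

/-- The chain rule for a function of one variable. -/
lemma pd_comp {F : ℝ → ℝ} {F' : ℝ} (hs : UniqueDiffWithinAt ℝ S y)
    (hF : HasDerivAt F F' (f y)) (hf : DifferentiableWithinAt ℝ f S y) :
    pd S i (fun z => F (f z)) y = F' * pd S i f y := by
  have : HasFDerivWithinAt (fun z => F (f z)) _ S y :=
    hF.comp_hasFDerivWithinAt y hf.hasFDerivWithinAt
  rw [pd_eq_of_hasFDerivWithinAt hs this]; rfl

lemma pd_exp (hs : UniqueDiffWithinAt ℝ S y) (hf : DifferentiableWithinAt ℝ f S y) :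
    pd S i (fun z => Real.exp (f z)) y = Real.exp (f y) * pd S i f y :=
  pd_comp hs (Real.hasDerivAt_exp _) hf

/-- The second derivatives commute at the points of `S` which are limits of interior points. -/
lemma pd_comm (hS : UniqueDiffOn ℝ S) (hy : y ∈ S) (hy' : y ∈ closure (interior S))
    (hf : ContDiffWithinAt ℝ 2 f S y) :
    pd S i (pd S j f) y = pd S j (pd S i f) y := by
  have h1 : DifferentiableWithinAt ℝ (fderivWithin ℝ f S) S y :=
    (hf.fderivWithin_right (m := 1) hS (by norm_num) hy).differentiableWithinAt (by norm_num)
  have key : ∀ i j, pd S i (pd S j f) y = fderivWithin ℝ (fderivWithin ℝ f S) S y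
      (EuclideanSpace.single i 1) (EuclideanSpace.single j 1) := by
    intro i j
    have h2 : HasFDerivWithinAt (fun z => fderivWithin ℝ f S z (EuclideanSpace.single j 1))
        ((fderivWithin ℝ (fderivWithin ℝ f S) S y).flip (EuclideanSpace.single j 1)) S y := by
      simpa using h1.hasFDerivWithinAt.clm_apply
        (hasFDerivWithinAt_const (EuclideanSpace.single j (1 : ℝ)) y S)
    exact (pd_eq_of_hasFDerivWithinAt (hS y hy) h2)
  rw [key, key]
  exact hf.isSymmSndFDerivWithinAt (by simp) hS hy' hy _ _

lemma contDiffWithinAt_pd (hS : UniqueDiffOn ℝ S) (hy : y ∈ S)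
    (hf : ContDiffWithinAt ℝ 2 f S y) : ContDiffWithinAt ℝ 1 (pd S i f) S y :=
  hf.fderivWithin_right_apply contDiffWithinAt_const hS (by norm_num) hy

end PartialDerivatives

/-! ### Local data -/

/-- `V` is relatively open in `S`, and `S` is a domain (typically a half-space, or everything) on
which one-sided derivatives are unique and second derivatives commute. -/
structure IsChartDomain {d : ℕ} (S V : Set (EuclideanSpace ℝ (Fin d))) : Prop where
  uniqueDiffOn : UniqueDiffOn ℝ S
  subset_closure : S ⊆ closure (interior S)
  subset : V ⊆ S
  mem_nhdsWithin : ∀ y ∈ V, V ∈ 𝓝[S] y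

/-- The matrix-valued function `a` represents a Riemannian metric on `V`, of class `C²` up to the
boundary of `S`. -/
structure IsMetricOn {d : ℕ} (S V : Set (EuclideanSpace ℝ (Fin d)))
    (a : EuclideanSpace ℝ (Fin d) → Matrix (Fin d) (Fin d) ℝ) : Prop where
  posDef : ∀ y ∈ V, (a y).PosDef
  contDiff : ∀ y ∈ V, ∀ i j, ContDiffWithinAt ℝ 2 (fun z => a z i j) S y

/-- `a` represents a metric on `V` and `u` is a `C²` function whose gradient is a unit field: the
local form of a special boundary defining function, without the condition at the boundary. -/
structure IsSpecialOn {d : ℕ} (S V : Set (EuclideanSpace ℝ (Fin d)))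
    (a : EuclideanSpace ℝ (Fin d) → Matrix (Fin d) (Fin d) ℝ)
    (u : EuclideanSpace ℝ (Fin d) → ℝ) : Prop extends IsMetricOn S V a where
  contDiff_fun : ∀ y ∈ V, ContDiffWithinAt ℝ 2 u S y
  eikonal : ∀ y ∈ V, cGradSq S a u y = 1

section LocalData

variable {d : ℕ} {S V : Set (EuclideanSpace ℝ (Fin d))}
  {a T : EuclideanSpace ℝ (Fin d) → Matrix (Fin d) (Fin d) ℝ}
  {u w : EuclideanSpace ℝ (Fin d) → ℝ} {y : EuclideanSpace ℝ (Fin d)}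

namespace IsChartDomain

lemma unique (hV : IsChartDomain S V) (hy : y ∈ V) : UniqueDiffWithinAt ℝ S y :=
  hV.uniqueDiffOn y (hV.subset hy)

lemma eventually (hV : IsChartDomain S V) (hy : y ∈ V) {P : EuclideanSpace ℝ (Fin d) → Prop}
    (h : ∀ z ∈ V, P z) : ∀ᶠ z in 𝓝[S] y, P z := by
  filter_upwards [hV.mem_nhdsWithin y hy] with z hz using h z hz

lemma pd_congr (hV : IsChartDomain S V) (hy : y ∈ V) {f f' : EuclideanSpace ℝ (Fin d) → ℝ}
    (h : ∀ z ∈ V, f z = f' z) (i : Fin d) : pd S i f y = pd S i f' y :=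
  ConfCompact.pd_congr (hV.eventually hy h) (hV.subset hy)

lemma pd_comm (hV : IsChartDomain S V) (hy : y ∈ V) (hu : ContDiffWithinAt ℝ 2 u S y)
    (i j : Fin d) : pd S i (pd S j u) y = pd S j (pd S i u) y :=
  ConfCompact.pd_comm hV.uniqueDiffOn (hV.subset hy) (hV.subset_closure (hV.subset hy)) hu

lemma contDiff_pd (hV : IsChartDomain S V) (hy : y ∈ V) (hu : ContDiffWithinAt ℝ 2 u S y)
    (i : Fin d) : ContDiffWithinAt ℝ 1 (pd S i u) S y :=
  contDiffWithinAt_pd hV.uniqueDiffOn (hV.subset hy) hu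

end IsChartDomain

lemma contDiffWithinAt_det {m : WithTop ℕ∞} {ι : Type*} [Fintype ι] [DecidableEq ι]
    {b : EuclideanSpace ℝ (Fin d) → Matrix ι ι ℝ}
    (h : ∀ i j, ContDiffWithinAt ℝ m (fun z => b z i j) S y) :
    ContDiffWithinAt ℝ m (fun z => (b z).det) S y := by
  simp only [Matrix.det_apply']
  exact ContDiffWithinAt.sum fun σ _ =>
    contDiffWithinAt_const.mul (contDiffWithinAt_prod fun i _ => h _ _)

lemma contDiffWithinAt_inv {m : WithTop ℕ∞}
    (h : ∀ i j, ContDiffWithinAt ℝ m (fun z => a z i j) S y) (h0 : (a y).det ≠ 0) (i j : Fin d) :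
    ContDiffWithinAt ℝ m (fun z => (a z)⁻¹ i j) S y := by
  simp only [Matrix.inv_def, Matrix.smul_apply, Matrix.adjugate_apply, smul_eq_mul,
    Ring.inverse_eq_inv']
  refine ((contDiffWithinAt_det h).inv h0).mul (contDiffWithinAt_det fun k l => ?_)
  by_cases hk : k = j
  · subst hk; simpa using contDiffWithinAt_const
  · simpa [Matrix.updateRow_ne hk] using h k l

namespace IsMetricOn

lemma isSymm (ha : IsMetricOn S V a) (hy : y ∈ V) : (a y)ᵀ = a y := by
  simpa using (ha.posDef y hy).isHermitian.eq

lemma symm (ha : IsMetricOn S V a) (hy : y ∈ V) (i j : Fin d) : a y i j = a y j i :=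
  (congr_fun₂ (ha.isSymm hy) i j).symm

lemma isUnit_det (ha : IsMetricOn S V a) (hy : y ∈ V) : IsUnit (a y).det :=
  (ha.posDef y hy).det_pos.ne'.isUnit

lemma inv_isSymm (ha : IsMetricOn S V a) (hy : y ∈ V) : ((a y)⁻¹)ᵀ = (a y)⁻¹ := by
  rw [Matrix.transpose_nonsing_inv, ha.isSymm hy]

lemma inv_symm (ha : IsMetricOn S V a) (hy : y ∈ V) (i j : Fin d) : (a y)⁻¹ i j = (a y)⁻¹ j i :=
  (congr_fun₂ (ha.inv_isSymm hy) i j).symm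

lemma contDiff_inv (ha : IsMetricOn S V a) (hy : y ∈ V) (i j : Fin d) :
    ContDiffWithinAt ℝ 2 (fun z => (a z)⁻¹ i j) S y :=
  contDiffWithinAt_inv (ha.contDiff y hy) (ha.isUnit_det hy).ne_zero i j

lemma diff (ha : IsMetricOn S V a) (hy : y ∈ V) (i j : Fin d) :
    DifferentiableWithinAt ℝ (fun z => a z i j) S y :=
  (ha.contDiff y hy i j).differentiableWithinAt (by norm_num)

/-- Lowering the index of the gradient gives back the differential. -/
lemma mulVec_cGrad (ha : IsMetricOn S V a) (hy : y ∈ V) :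
    a y *ᵥ cGrad S a w y = fun j => pd S j w y := by
  have : cGrad S a w y = (a y)⁻¹ *ᵥ fun j => pd S j w y := rfl
  rw [this, Matrix.mulVec_mulVec, Matrix.mul_nonsing_inv _ (ha.isUnit_det hy), Matrix.one_mulVec]

lemma sum_mul_cGrad (ha : IsMetricOn S V a) (hy : y ∈ V) (j : Fin d) :
    ∑ k, a y j k * cGrad S a w y k = pd S j w y :=
  congr_fun (ha.mulVec_cGrad hy) j

lemma contDiff_cGrad (hV : IsChartDomain S V) (ha : IsMetricOn S V a) (hy : y ∈ V)
    (hw : ContDiffWithinAt ℝ 2 w S y) (i : Fin d) :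
    ContDiffWithinAt ℝ 1 (fun z => cGrad S a w z i) S y :=
  ContDiffWithinAt.sum fun j _ =>
    ((ha.contDiff_inv hy i j).of_le (by norm_num)).mul (hV.contDiff_pd hy hw j)

end IsMetricOn

lemma cGradSq_eq_sum (y : EuclideanSpace ℝ (Fin d)) :
    cGradSq S a u y = ∑ i, cGrad S a u y i * pd S i u y := by
  simp only [cGradSq, cGrad, Finset.sum_mul]
  exact Finset.sum_congr rfl fun i _ => Finset.sum_congr rfl fun j _ => by ring

/-- The correction term of the Hessian, in terms of the gradient. -/
lemma IsMetricOn.sum_christoffel_mul (ha : IsMetricOn S V a) (hy : y ∈ V) (i j : Fin d) :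
    ∑ k, christoffel S a y k i j * pd S k w y
      = (1 / 2) * ∑ l, cGrad S a w y l *
        (pd S i (fun z => a z j l) y + pd S j (fun z => a z i l) y
          - pd S l (fun z => a z i j) y) := by
  simp only [christoffel, cGrad, Finset.mul_sum, Finset.sum_mul]
  rw [Finset.sum_comm]
  refine Finset.sum_congr rfl fun l _ => Finset.sum_congr rfl fun k _ => ?_
  rw [ha.inv_symm hy k l]; ring

lemma IsMetricOn.pd_symm (hV : IsChartDomain S V) (ha : IsMetricOn S V a) (hy : y ∈ V)
    (k i j : Fin d) :
    pd S k (fun z => a z i j) y = pd S k (fun z => a z j i) y :=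
  hV.pd_congr hy (fun _ hz => ha.symm hz i j) k

/-- The derivative of `aⱼₖ (∇w)ᵏ = ∂ⱼ w`. -/
lemma IsMetricOn.pd_lower (hV : IsChartDomain S V) (ha : IsMetricOn S V a) (hy : y ∈ V)
    (hw : ContDiffWithinAt ℝ 2 w S y) (i j : Fin d) :
    ∑ k, a y j k * pd S i (fun z => cGrad S a w z k) y
      = pd S i (pd S j w) y - ∑ k, pd S i (fun z => a z j k) y * cGrad S a w y k := by
  rw [← hV.pd_congr hy (fun z hz => ha.sum_mul_cGrad hz j) i,
    pd_sum_mul (hV.unique hy) (fun k => ha.diff hy j k)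
      (fun k => (ha.contDiff_cGrad hV hy hw k).differentiableWithinAt (by norm_num)),
    Finset.sum_add_distrib]
  ring

/-- The Lie derivative of the metric along a gradient is twice the Hessian. -/
lemma IsMetricOn.lie_cGrad (hV : IsChartDomain S V) (ha : IsMetricOn S V a) (hy : y ∈ V)
    (hw : ContDiffWithinAt ℝ 2 w S y) :
    lie S (cGrad S a w) a y = (2 : ℝ) • cHess S a w y := by
  ext i j
  simp only [lie, cHess, Matrix.of_apply, Matrix.smul_apply, smul_eq_mul,
    ha.sum_christoffel_mul hy, Finset.sum_add_distrib]
  have h1 := ha.pd_lower hV hy hw i j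
  have h2 := ha.pd_lower hV hy hw j i
  rw [hV.pd_comm hy hw j i] at h2
  have h3 : ∑ k, a y k j * pd S i (fun z => cGrad S a w z k) y
      = ∑ k, a y j k * pd S i (fun z => cGrad S a w z k) y :=
    Finset.sum_congr rfl fun k _ => by rw [ha.symm hy k j]
  rw [h3, h1, h2]
  simp only [mul_sub, mul_add, Finset.sum_sub_distrib, Finset.sum_add_distrib]
  simp only [mul_comm (pd S _ (fun z => a z _ _) y)]
  ring

end LocalData

/-! ### The eikonal equation and the Hessian -/

section Eikonal

variable {d : ℕ} {S V : Set (EuclideanSpace ℝ (Fin d))}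
  {a T : EuclideanSpace ℝ (Fin d) → Matrix (Fin d) (Fin d) ℝ}
  {X : EuclideanSpace ℝ (Fin d) → Fin d → ℝ}
  {u w : EuclideanSpace ℝ (Fin d) → ℝ} {y : EuclideanSpace ℝ (Fin d)}

namespace IsSpecialOn

lemma contDiff_grad (hV : IsChartDomain S V) (h : IsSpecialOn S V a u) (hy : y ∈ V) (i : Fin d) :
    ContDiffWithinAt ℝ 1 (fun z => cGrad S a u z i) S y :=
  h.contDiff_cGrad hV hy (h.contDiff_fun y hy) i

lemma diff_grad (hV : IsChartDomain S V) (h : IsSpecialOn S V a u) (hy : y ∈ V) (i : Fin d) :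
    DifferentiableWithinAt ℝ (fun z => cGrad S a u z i) S y :=
  (h.contDiff_grad hV hy i).differentiableWithinAt (by norm_num)

lemma diff_pd (hV : IsChartDomain S V) (h : IsSpecialOn S V a u) (hy : y ∈ V) (i : Fin d) :
    DifferentiableWithinAt ℝ (pd S i u) S y :=
  (hV.contDiff_pd hy (h.contDiff_fun y hy) i).differentiableWithinAt (by norm_num)

lemma sum_grad_mul_pd (h : IsSpecialOn S V a u) (hy : y ∈ V) :
    ∑ i, cGrad S a u y i * pd S i u y = 1 := by
  rw [← cGradSq_eq_sum, h.eikonal y hy]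

/-- The derivative of `Nᵏ ∂ₖ u = 1`, where `N = ∇u`. -/
lemma pd_eikonal (hV : IsChartDomain S V) (h : IsSpecialOn S V a u) (hy : y ∈ V) (i : Fin d) :
    ∑ k, (pd S i (fun z => cGrad S a u z k) y * pd S k u y
      + cGrad S a u y k * pd S i (pd S k u) y) = 0 := by
  rw [← pd_sum_mul (hV.unique hy) (fun k => h.diff_grad hV hy k) (fun k => h.diff_pd hV hy k),
    hV.pd_congr hy (f' := fun _ => 1) (fun z hz => h.sum_grad_mul_pd hz), pd_const]

/-- The transport equation of the differential of `u` along `N = ∇u`; the right-hand side involves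
no second derivatives of `u`. -/
lemma transport (hV : IsChartDomain S V) (h : IsSpecialOn S V a u) (hy : y ∈ V) (i : Fin d) :
    ∑ k, cGrad S a u y k * pd S k (pd S i u) y
      = (1 / 2) * ∑ k, ∑ l, pd S i (fun z => a z k l) y * cGrad S a u y k * cGrad S a u y l := by
  have h1 := h.pd_eikonal hV hy i
  have h2 : ∑ k, pd S i (fun z => cGrad S a u z k) y * pd S k u y
      = ∑ k, cGrad S a u y k * pd S i (pd S k u) y
        - ∑ k, ∑ l, pd S i (fun z => a z k l) y * cGrad S a u y k * cGrad S a u y l := by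
    calc ∑ k, pd S i (fun z => cGrad S a u z k) y * pd S k u y
        = ∑ k, ∑ l, pd S i (fun z => cGrad S a u z k) y * (a y k l * cGrad S a u y l) := by
          refine Finset.sum_congr rfl fun k _ => ?_
          rw [← Finset.mul_sum, h.sum_mul_cGrad hy]
      _ = ∑ l, cGrad S a u y l * ∑ k, a y l k * pd S i (fun z => cGrad S a u z k) y := by
          rw [Finset.sum_comm]
          refine Finset.sum_congr rfl fun l _ => ?_
          rw [Finset.mul_sum]
          exact Finset.sum_congr rfl fun k _ => by rw [h.symm hy k l]; ring
      _ = _ := by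
          simp only [h.pd_lower hV hy (h.contDiff_fun y hy), mul_sub, Finset.sum_sub_distrib,
            Finset.mul_sum]
          congr 1
          exact Finset.sum_congr rfl fun k _ => Finset.sum_congr rfl fun l _ => by ring
  rw [Finset.sum_add_distrib, h2] at h1
  simp only [hV.pd_comm hy (h.contDiff_fun y hy) _ i]
  linarith

/-- The Lie derivative of `du ⊗ du` along `∇u` vanishes. -/
lemma lie_cH (hV : IsChartDomain S V) (h : IsSpecialOn S V a u) (hy : y ∈ V) :
    lie S (cGrad S a u) (cH S a u) y = lie S (cGrad S a u) a y := by
  ext i j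
  simp only [lie, Matrix.of_apply]
  have h1 : ∀ k, pd S k (fun z => cH S a u z i j) y = pd S k (fun z => a z i j) y
      - (pd S k (pd S i u) y * pd S j u y + pd S i u y * pd S k (pd S j u) y) := by
    intro k
    rw [← pd_mul (hV.unique hy) (h.diff_pd hV hy i) (h.diff_pd hV hy j)]
    exact pd_sub (hV.unique hy) (h.diff hy i j)
      ((h.diff_pd hV hy i).mul (h.diff_pd hV hy j))
  have h2 := h.pd_eikonal hV hy i
  have h3 := h.pd_eikonal hV hy j
  have h4 : ∑ k, (cGrad S a u y k * pd S k (fun z => cH S a u z i j) y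
      + cH S a u y k j * pd S i (fun z => cGrad S a u z k) y
      + cH S a u y i k * pd S j (fun z => cGrad S a u z k) y)
      = ∑ k, (cGrad S a u y k * pd S k (fun z => a z i j) y
        + a y k j * pd S i (fun z => cGrad S a u z k) y
        + a y i k * pd S j (fun z => cGrad S a u z k) y)
      - pd S j u y * ∑ k, (pd S i (fun z => cGrad S a u z k) y * pd S k u y
        + cGrad S a u y k * pd S i (pd S k u) y)
      - pd S i u y * ∑ k, (pd S j (fun z => cGrad S a u z k) y * pd S k u y
        + cGrad S a u y k * pd S j (pd S k u) y) := by
    simp only [Finset.mul_sum, ← Finset.sum_sub_distrib]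
    refine Finset.sum_congr rfl fun k _ => ?_
    rw [h1, hV.pd_comm hy (h.contDiff_fun y hy) k i, hV.pd_comm hy (h.contDiff_fun y hy) k j]
    simp only [cH, Matrix.sub_apply, Matrix.of_apply]
    ring
  rw [h4, h2, h3]; ring

lemma lie_cH_eq_hess (hV : IsChartDomain S V) (h : IsSpecialOn S V a u) (hy : y ∈ V) :
    lie S (cGrad S a u) (cH S a u) y = (2 : ℝ) • cHess S a u y := by
  rw [h.lie_cH hV hy, h.lie_cGrad hV hy (h.contDiff_fun y hy)]

/-- The Hessian annihilates `N = ∇u`. -/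
lemma cHess_mulVec_grad (hV : IsChartDomain S V) (h : IsSpecialOn S V a u) (hy : y ∈ V) :
    cHess S a u y *ᵥ cGrad S a u y = 0 := by
  ext i
  simp only [Matrix.mulVec, dotProduct, cHess, Matrix.of_apply, h.sum_christoffel_mul hy,
    sub_mul, Finset.sum_sub_distrib, Pi.zero_apply]
  have h1 := h.transport hV hy i
  have h2 : ∑ k, pd S i (pd S k u) y * cGrad S a u y k
      = ∑ k, cGrad S a u y k * pd S k (pd S i u) y :=
    Finset.sum_congr rfl fun k _ => by rw [hV.pd_comm hy (h.contDiff_fun y hy) i k, mul_comm]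
  rw [h2, h1]
  simp only [mul_add, mul_sub, add_mul, sub_mul, Finset.sum_add_distrib, Finset.sum_sub_distrib,
    Finset.mul_sum, Finset.sum_mul]
  have h3 : ∑ j, ∑ l, 1 / 2 * (cGrad S a u y l * pd S j (fun z => a z i l) y) * cGrad S a u y j
      = ∑ j, ∑ l, 1 / 2 * (cGrad S a u y l * pd S l (fun z => a z i j) y) * cGrad S a u y j := by
    rw [Finset.sum_comm]
    exact Finset.sum_congr rfl fun k _ => Finset.sum_congr rfl fun l _ => by ring
  rw [h3, add_sub_cancel_right, sub_eq_zero]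
  exact Finset.sum_congr rfl fun k _ => Finset.sum_congr rfl fun l _ => by ring

end IsSpecialOn

/-! ### Lie derivatives in matrix form -/

/-- The derivative of a matrix-valued function in a coordinate direction. -/
noncomputable def pdMat (S : Set (EuclideanSpace ℝ (Fin d))) (k : Fin d)
    (T : EuclideanSpace ℝ (Fin d) → Matrix (Fin d) (Fin d) ℝ) (y : EuclideanSpace ℝ (Fin d)) :
    Matrix (Fin d) (Fin d) ℝ :=
  Matrix.of fun i j => pd S k (fun z => T z i j) y

/-- The derivative `Xᵏ ∂ₖ T` of a matrix-valued function along a vector field. -/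
noncomputable def dirMat (S : Set (EuclideanSpace ℝ (Fin d)))
    (X : EuclideanSpace ℝ (Fin d) → Fin d → ℝ)
    (T : EuclideanSpace ℝ (Fin d) → Matrix (Fin d) (Fin d) ℝ) (y : EuclideanSpace ℝ (Fin d)) :
    Matrix (Fin d) (Fin d) ℝ :=
  ∑ k, X y k • pdMat S k T y

/-- The matrix `∂ᵢ Xᵏ` of derivatives of a vector field. -/
noncomputable def jacMat (S : Set (EuclideanSpace ℝ (Fin d)))
    (X : EuclideanSpace ℝ (Fin d) → Fin d → ℝ) (y : EuclideanSpace ℝ (Fin d)) :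
    Matrix (Fin d) (Fin d) ℝ :=
  Matrix.of fun i k => pd S i (fun z => X z k) y

lemma lie_eq : lie S X T y = dirMat S X T y + jacMat S X y * T y + T y * (jacMat S X y)ᵀ := by
  ext i j
  simp only [lie, dirMat, pdMat, jacMat, Matrix.of_apply, Matrix.add_apply, Matrix.mul_apply,
    Matrix.sum_apply, Matrix.smul_apply, smul_eq_mul, Matrix.transpose_apply,
    Finset.sum_add_distrib]
  simp only [mul_comm (T y _ j)]

lemma pdMat_mul {T' : EuclideanSpace ℝ (Fin d) → Matrix (Fin d) (Fin d) ℝ}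
    (hs : UniqueDiffWithinAt ℝ S y) (hT : ∀ i j, DifferentiableWithinAt ℝ (fun z => T z i j) S y)
    (hT' : ∀ i j, DifferentiableWithinAt ℝ (fun z => T' z i j) S y) (k : Fin d) :
    pdMat S k (fun z => T z * T' z) y = pdMat S k T y * T' y + T y * pdMat S k T' y := by
  ext i j
  simp only [pdMat, Matrix.of_apply, Matrix.mul_apply, Matrix.add_apply,
    ← Finset.sum_add_distrib]
  exact pd_sum_mul hs (hT i) fun l => hT' l j

lemma dirMat_mul {T' : EuclideanSpace ℝ (Fin d) → Matrix (Fin d) (Fin d) ℝ}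
    (hs : UniqueDiffWithinAt ℝ S y) (hT : ∀ i j, DifferentiableWithinAt ℝ (fun z => T z i j) S y)
    (hT' : ∀ i j, DifferentiableWithinAt ℝ (fun z => T' z i j) S y) :
    dirMat S X (fun z => T z * T' z) y = dirMat S X T y * T' y + T y * dirMat S X T' y := by
  simp only [dirMat, pdMat_mul hs hT hT', smul_add, Finset.sum_add_distrib, Finset.sum_mul,
    Finset.mul_sum, Matrix.smul_mul, Matrix.mul_smul]

lemma trace_dirMat (hs : UniqueDiffWithinAt ℝ S y)
    (hT : ∀ i j, DifferentiableWithinAt ℝ (fun z => T z i j) S y) :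
    (dirMat S X T y).trace = ∑ k, X y k * pd S k (fun z => (T z).trace) y := by
  simp only [dirMat, Matrix.trace_sum, Matrix.trace_smul, smul_eq_mul]
  refine Finset.sum_congr rfl fun k _ => ?_
  congr 1
  exact (pd_sum Finset.univ hs fun i _ => hT i i).symm

lemma IsMetricOn.diff_inv (ha : IsMetricOn S V a) (hy : y ∈ V) (i j : Fin d) :
    DifferentiableWithinAt ℝ (fun z => (a z)⁻¹ i j) S y :=
  (ha.contDiff_inv hy i j).differentiableWithinAt (by norm_num)

lemma IsMetricOn.dirMat_inv (hV : IsChartDomain S V) (ha : IsMetricOn S V a) (hy : y ∈ V) :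
    dirMat S X (fun z => (a z)⁻¹) y = -((a y)⁻¹ * dirMat S X a y * (a y)⁻¹) := by
  have h1 := dirMat_mul (X := X) (hV.unique hy) (ha.diff_inv hy) (ha.diff hy)
  have h2 : dirMat S X (fun z => (a z)⁻¹ * a z) y = 0 := by
    ext i j
    simp only [dirMat, Matrix.sum_apply, Matrix.smul_apply, pdMat, Matrix.of_apply,
      Matrix.zero_apply]
    refine Finset.sum_eq_zero fun k _ => ?_
    rw [hV.pd_congr hy (f' := fun _ => (1 : Matrix (Fin d) (Fin d) ℝ) i j)
      (fun z hz => by rw [Matrix.nonsing_inv_mul _ (ha.isUnit_det hz)]), pd_const, smul_zero]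
  rw [h2] at h1
  have h3 := congr_arg (· * (a y)⁻¹) h1
  simp only [Matrix.zero_mul, Matrix.add_mul, Matrix.mul_assoc,
    Matrix.mul_nonsing_inv _ (ha.isUnit_det hy), Matrix.mul_one] at h3
  rw [eq_neg_iff_add_eq_zero, ← Matrix.mul_assoc] at *
  exact h3.symm

/-- How the trace of a symmetric tensor `T` varies along a vector field, in terms of Lie
derivatives. -/
lemma IsMetricOn.tr_lie (hV : IsChartDomain S V) (ha : IsMetricOn S V a) (hy : y ∈ V)
    (hT : ∀ i j, DifferentiableWithinAt ℝ (fun z => T z i j) S y) :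
    tr (a y) (lie S X T y) = ∑ k, X y k * pd S k (fun z => tr (a z) (T z)) y
      + ((a y)⁻¹ * lie S X a y * ((a y)⁻¹ * T y)).trace := by
  have hu := ha.isUnit_det hy
  have hd : ∀ i j, DifferentiableWithinAt ℝ (fun z => ((a z)⁻¹ * T z) i j) S y := by
    intro i j
    simp only [Matrix.mul_apply]
    exact DifferentiableWithinAt.fun_sum fun k _ => (ha.diff_inv hy i k).mul (hT k j)
  simp only [tr]
  rw [← trace_dirMat (hV.unique hy) hd, dirMat_mul (hV.unique hy) (ha.diff_inv hy) hT,
    ha.dirMat_inv hV hy, lie_eq, lie_eq]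
  simp only [Matrix.mul_add, Matrix.add_mul, Matrix.trace_add, Matrix.neg_mul, Matrix.trace_neg]
  have e1 : ((a y)⁻¹ * (jacMat S X y * a y) * ((a y)⁻¹ * T y)).trace
      = ((a y)⁻¹ * (jacMat S X y * T y)).trace := by
    rw [Matrix.mul_assoc, Matrix.mul_assoc, Matrix.mul_nonsing_inv_cancel_left _ _ hu]
  have e2 : ((a y)⁻¹ * (a y * (jacMat S X y)ᵀ) * ((a y)⁻¹ * T y)).trace
      = ((a y)⁻¹ * (T y * (jacMat S X y)ᵀ)).trace := by
    rw [Matrix.nonsing_inv_mul_cancel_left _ _ hu, Matrix.trace_mul_comm, Matrix.mul_assoc]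
  have e3 : ((a y)⁻¹ * dirMat S X a y * (a y)⁻¹ * T y).trace
      = ((a y)⁻¹ * dirMat S X a y * ((a y)⁻¹ * T y)).trace := by
    rw [Matrix.mul_assoc ((a y)⁻¹ * dirMat S X a y)]
  rw [e1, e2, e3]
  ring

/-- If `T(N, ·) = 0` near `y`, then `(ℒ_N T)(N, N) = 0`. -/
lemma sum_mul_lie_eq_zero (hV : IsChartDomain S V) (hy : y ∈ V)
    (hX : ∀ i, DifferentiableWithinAt ℝ (fun z => X z i) S y)
    (hT : ∀ i j, DifferentiableWithinAt ℝ (fun z => T z i j) S y)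
    (h0 : ∀ z ∈ V, T z *ᵥ X z = 0) (h0' : ∀ z ∈ V, X z ᵥ* T z = 0) :
    ∑ i, ∑ j, X y i * X y j * lie S X T y i j = 0 := by
  have key : ∀ k i, ∑ j, pd S k (fun z => T z i j) y * X y j
      = - ∑ j, T y i j * pd S k (fun z => X z j) y := by
    intro k i
    have h1 := pd_sum_mul (i := k) (hV.unique hy) (fun j => hT i j) hX
    have h2 : pd S k (fun z => ∑ j, T z i j * X z j) y = pd S k (fun _ => 0) y :=
      hV.pd_congr hy (fun z hz => congr_fun (h0 z hz) i) k
    rw [h2, pd_const, Finset.sum_add_distrib] at h1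
    linarith
  have hr : ∀ j, ∑ i, X y i * T y i j = 0 := fun j => congr_fun (h0' y hy) j
  have hc : ∀ i, ∑ j, T y i j * X y j = 0 := fun i => congr_fun (h0 y hy) i
  have e1 : ∑ i, ∑ j, X y i * X y j * ∑ k, X y k * pd S k (fun z => T z i j) y = 0 := by
    calc _ = ∑ k, X y k * ∑ i, X y i * ∑ j, pd S k (fun z => T z i j) y * X y j := by
          simp only [Finset.mul_sum]
          rw [Finset.sum_comm' (t' := Finset.univ) (s' := fun _ => Finset.univ) (by simp)]
          rw [Finset.sum_congr rfl fun j _ => Finset.sum_comm, Finset.sum_comm]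
          refine Finset.sum_congr rfl fun k _ => ?_
          rw [Finset.sum_comm]
          exact Finset.sum_congr rfl fun i _ => Finset.sum_congr rfl fun j _ => by ring
      _ = - ∑ k, X y k * ∑ j, (∑ i, X y i * T y i j) * pd S k (fun z => X z j) y := by
          rw [← Finset.sum_neg_distrib]
          refine Finset.sum_congr rfl fun k _ => ?_
          simp only [key, ← mul_neg, ← Finset.sum_neg_distrib, Finset.mul_sum, Finset.sum_mul]
          rw [Finset.sum_comm]
          exact Finset.sum_congr rfl fun i _ => Finset.sum_congr rfl fun j _ => by ring
      _ = 0 := by simp [hr]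
  have e2 : ∑ i, ∑ j, X y i * X y j * ∑ k, T y k j * pd S i (fun z => X z k) y = 0 := by
    refine Finset.sum_eq_zero fun i _ => ?_
    calc _ = X y i * ∑ k, pd S i (fun z => X z k) y * ∑ j, T y k j * X y j := by
          simp only [Finset.mul_sum]
          rw [Finset.sum_comm]
          exact Finset.sum_congr rfl fun i _ => Finset.sum_congr rfl fun j _ => by ring
      _ = 0 := by simp [hc]
  have e3 : ∑ i, ∑ j, X y i * X y j * ∑ k, T y i k * pd S j (fun z => X z k) y = 0 := by
    rw [Finset.sum_comm]
    refine Finset.sum_eq_zero fun j _ => ?_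
    calc _ = X y j * ∑ k, pd S j (fun z => X z k) y * ∑ i, X y i * T y i k := by
          simp only [Finset.mul_sum]
          rw [Finset.sum_comm]
          exact Finset.sum_congr rfl fun i _ => Finset.sum_congr rfl fun j _ => by ring
      _ = 0 := by simp [hr]
  simp only [lie, Matrix.of_apply, Finset.sum_add_distrib, mul_add]
  rw [e1, e2, e3]; ring

end Eikonal

/-! ### Restriction of tensors to a hyperplane -/

section Hyperplane

variable {n : ℕ} {A T : Matrix (Fin (n + 1)) (Fin (n + 1)) ℝ} {ν : Fin (n + 1) → ℝ}

lemma inv_sub_vecMulVec_apply_zero (hA : IsUnit A.det) (h0 : ∀ i : Fin n, (A *ᵥ ν) i.succ = 0)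
    (h1 : ∑ i, ν i * (A *ᵥ ν) i = 1) (i : Fin (n + 1)) :
    (A⁻¹ - vecMulVec ν ν) i 0 = 0 := by
  rw [Fin.sum_univ_succ] at h1
  simp only [h0, mul_zero, Finset.sum_const_zero, add_zero] at h1
  have h2 : ν = A⁻¹ *ᵥ (A *ᵥ ν) := by
    rw [Matrix.mulVec_mulVec, Matrix.nonsing_inv_mul _ hA, Matrix.one_mulVec]
  have h3 : ν i = A⁻¹ i 0 * (A *ᵥ ν) 0 := by
    conv_lhs => rw [h2]
    change ∑ j, A⁻¹ i j * (A *ᵥ ν) j = _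
    rw [Fin.sum_univ_succ]; simp [h0]
  simp only [Matrix.sub_apply, Matrix.vecMulVec_apply]
  rw [h3]; linear_combination (-A⁻¹ i 0) * h1

/-- The inverse of the metric induced on a hyperplane with unit normal `ν`. -/
lemma inv_submatrix_succ (hA : IsUnit A.det) (hs : Aᵀ = A)
    (h0 : ∀ i : Fin n, (A *ᵥ ν) i.succ = 0) (h1 : ∑ i, ν i * (A *ᵥ ν) i = 1) :
    (A.submatrix Fin.succ Fin.succ)⁻¹
      = (A⁻¹ - vecMulVec ν ν).submatrix Fin.succ Fin.succ := by
  have hsymm : (A⁻¹ - vecMulVec ν ν)ᵀ = A⁻¹ - vecMulVec ν ν := by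
    rw [Matrix.transpose_sub, Matrix.transpose_nonsing_inv, hs, Matrix.transpose_vecMulVec]
  have h2 : ∀ i, (A⁻¹ - vecMulVec ν ν) 0 i = 0 := fun i => by
    rw [← congr_fun₂ hsymm, Matrix.transpose_apply, inv_sub_vecMulVec_apply_zero hA h0 h1]
  have h3 : A * (A⁻¹ - vecMulVec ν ν) = 1 - vecMulVec (A *ᵥ ν) ν := by
    rw [Matrix.mul_sub, Matrix.mul_nonsing_inv _ hA, Matrix.mul_vecMulVec]
  refine Matrix.inv_eq_right_inv ?_
  ext i j
  have h4 := congr_fun₂ h3 i.succ j.succ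
  rw [Matrix.mul_apply, Fin.sum_univ_succ, h2, mul_zero, zero_add, Matrix.sub_apply,
    Matrix.vecMulVec_apply, h0, zero_mul, sub_zero] at h4
  rw [Matrix.mul_apply]
  simp only [Matrix.submatrix_apply]
  rw [h4]
  simp [Matrix.one_apply]

lemma sum_inv_submatrix_succ (hA : IsUnit A.det) (hs : Aᵀ = A)
    (h0 : ∀ i : Fin n, (A *ᵥ ν) i.succ = 0) (h1 : ∑ i, ν i * (A *ᵥ ν) i = 1)
    (f : Fin (n + 1) → Fin (n + 1) → ℝ) :
    ∑ i : Fin n, ∑ j : Fin n, (A.submatrix Fin.succ Fin.succ)⁻¹ i j * f i.succ j.succ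
      = ∑ i, ∑ j, (A⁻¹ i j - ν i * ν j) * f i j := by
  have hsymm : (A⁻¹ - vecMulVec ν ν)ᵀ = A⁻¹ - vecMulVec ν ν := by
    rw [Matrix.transpose_sub, Matrix.transpose_nonsing_inv, hs, Matrix.transpose_vecMulVec]
  have h3 : ∀ i, A⁻¹ i 0 - ν i * ν 0 = 0 := inv_sub_vecMulVec_apply_zero hA h0 h1
  have h2 : ∀ i, A⁻¹ 0 i - ν 0 * ν i = 0 := fun i => by
    have := congr_fun₂ hsymm 0 i
    rw [Matrix.transpose_apply, inv_sub_vecMulVec_apply_zero hA h0 h1] at this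
    exact this.symm
  rw [inv_submatrix_succ hA hs h0 h1, Fin.sum_univ_succ]
  simp only [h2, zero_mul, Finset.sum_const_zero, zero_add, Fin.sum_univ_succ (n := n), h3]
  rfl

lemma tr_eq_sum {d : ℕ} {A T : Matrix (Fin d) (Fin d) ℝ} (hs : Aᵀ = A) :
    tr A T = ∑ i, ∑ j, A⁻¹ i j * T i j := by
  have h : (A⁻¹)ᵀ = A⁻¹ := by rw [Matrix.transpose_nonsing_inv, hs]
  simp only [tr, Matrix.trace, Matrix.diag, Matrix.mul_apply]
  rw [Finset.sum_comm]
  refine Finset.sum_congr rfl fun i _ => Finset.sum_congr rfl fun j _ => ?_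
  rw [← congr_fun₂ h j i]; rfl

/-- The trace over a hyperplane, with respect to the induced metric. -/
lemma tr_submatrix_succ (hA : IsUnit A.det) (hs : Aᵀ = A)
    (h0 : ∀ i : Fin n, (A *ᵥ ν) i.succ = 0) (h1 : ∑ i, ν i * (A *ᵥ ν) i = 1) :
    tr (A.submatrix Fin.succ Fin.succ) (T.submatrix Fin.succ Fin.succ) = trPerp A ν T := by
  have hs' : (A.submatrix Fin.succ Fin.succ)ᵀ = A.submatrix Fin.succ Fin.succ := by
    rw [Matrix.transpose_submatrix, hs]
  rw [trPerp, tr_eq_sum hs', tr_eq_sum hs]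
  simp only [Matrix.submatrix_apply]
  rw [sum_inv_submatrix_succ hA hs h0 h1 T]
  simp only [sub_mul, Finset.sum_sub_distrib]

lemma normSq_submatrix_succ (hA : IsUnit A.det) (hs : Aᵀ = A)
    (h0 : ∀ i : Fin n, (A *ᵥ ν) i.succ = 0) (h1 : ∑ i, ν i * (A *ᵥ ν) i = 1)
    (hT : ν ᵥ* T = 0) :
    normSq (A.submatrix Fin.succ Fin.succ) (T.submatrix Fin.succ Fin.succ) = normSq A T := by
  have hsymm : (A⁻¹ - vecMulVec ν ν)ᵀ = A⁻¹ - vecMulVec ν ν := by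
    rw [Matrix.transpose_sub, Matrix.transpose_nonsing_inv, hs, Matrix.transpose_vecMulVec]
  have h2 : ∀ i, (A⁻¹ - vecMulVec ν ν) 0 i = 0 := fun i => by
    rw [← congr_fun₂ hsymm, Matrix.transpose_apply, inv_sub_vecMulVec_apply_zero hA h0 h1]
  have h3 : A⁻¹ * T = (A⁻¹ - vecMulVec ν ν) * T := by
    rw [Matrix.sub_mul, Matrix.vecMulVec_mul, hT]; simp
  have h4 : (A.submatrix Fin.succ Fin.succ)⁻¹ * T.submatrix Fin.succ Fin.succ
      = (A⁻¹ * T).submatrix Fin.succ Fin.succ := by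
    rw [inv_submatrix_succ hA hs h0 h1, h3]
    ext i j
    have := inv_sub_vecMulVec_apply_zero hA h0 h1 i.succ
    simp only [Matrix.submatrix_apply, Matrix.mul_apply, Fin.sum_univ_succ (n := n), this]
    simp
  have h5 : ∀ i, (A⁻¹ * T) 0 i = 0 := fun i => by
    rw [h3, Matrix.mul_apply]; simp only [h2]; simp
  simp only [normSq, h4, Matrix.trace, Matrix.diag, Matrix.mul_apply (M := (_ * T)),
    Matrix.mul_apply (M := Matrix.submatrix _ _ _), Matrix.submatrix_apply]
  simp [Fin.sum_univ_succ (n := n), h5]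

end Hyperplane

/-! ### The curvature coefficients at the boundary -/

section Trace

variable {d : ℕ} {A T T' : Matrix (Fin d) (Fin d) ℝ} {ν : Fin d → ℝ}

lemma tr_add : tr A (T + T') = tr A T + tr A T' := by
  simp [tr, Matrix.mul_add]

lemma tr_smul (c : ℝ) : tr A (c • T) = c * tr A T := by
  simp [tr]

lemma tr_self (hA : IsUnit A.det) : tr A A = d := by
  simp [tr, Matrix.nonsing_inv_mul _ hA]

lemma tr_vecMulVec (hs : Aᵀ = A) (v w : Fin d → ℝ) :
    tr A (vecMulVec v w) = ∑ i, ∑ j, A⁻¹ i j * v i * w j := by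
  rw [tr_eq_sum hs]
  simp [vecMulVec_apply, mul_assoc]

lemma sum_mul_mul_apply : ∑ i, ∑ j, ν i * ν j * T i j = ν ⬝ᵥ (T *ᵥ ν) := by
  simp only [dotProduct, mulVec, Finset.mul_sum]
  exact Finset.sum_congr rfl fun i _ => Finset.sum_congr rfl fun j _ => by ring

end Trace

section Hessian

variable {d : ℕ} {S V : Set (EuclideanSpace ℝ (Fin d))}
  {a : EuclideanSpace ℝ (Fin d) → Matrix (Fin d) (Fin d) ℝ}
  {u w : EuclideanSpace ℝ (Fin d) → ℝ} {y : EuclideanSpace ℝ (Fin d)}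

lemma lie_congr {X X' : EuclideanSpace ℝ (Fin d) → Fin d → ℝ}
    {T T' : EuclideanSpace ℝ (Fin d) → Matrix (Fin d) (Fin d) ℝ}
    (hV : IsChartDomain S V) (hy : y ∈ V) (hX : ∀ z ∈ V, X z = X' z) (hT : ∀ z ∈ V, T z = T' z) :
    lie S X T y = lie S X' T' y := by
  ext i j
  simp only [lie, Matrix.of_apply, hX y hy, hT y hy]
  refine Finset.sum_congr rfl fun k _ => ?_
  rw [hV.pd_congr hy (fun z hz => congr_fun₂ (hT z hz) i j) k,
    hV.pd_congr hy (fun z hz => congr_fun (hX z hz) k) i,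
    hV.pd_congr hy (fun z hz => congr_fun (hX z hz) k) j]

lemma IsMetricOn.christoffel_symm (hV : IsChartDomain S V) (ha : IsMetricOn S V a) (hy : y ∈ V)
    (k i j : Fin d) : christoffel S a y k i j = christoffel S a y k j i := by
  simp only [christoffel]
  congr 1
  refine Finset.sum_congr rfl fun l _ => ?_
  rw [ha.pd_symm hV hy l i j]
  ring

lemma IsMetricOn.cHess_isSymm (hV : IsChartDomain S V) (ha : IsMetricOn S V a) (hy : y ∈ V)
    (hw : ContDiffWithinAt ℝ 2 w S y) : (cHess S a w y)ᵀ = cHess S a w y := by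
  ext i j
  simp only [Matrix.transpose_apply, cHess, Matrix.of_apply]
  rw [hV.pd_comm hy hw]
  simp only [ha.christoffel_symm hV hy _ i j]

namespace IsSpecialOn

lemma grad_vecMul_cHess (hV : IsChartDomain S V) (h : IsSpecialOn S V a u) (hy : y ∈ V) :
    cGrad S a u y ᵥ* cHess S a u y = 0 := by
  rw [← h.cHess_isSymm hV hy (h.contDiff_fun y hy), Matrix.vecMul_transpose,
    h.cHess_mulVec_grad hV hy]

lemma sum_grad_mul_mulVec (h : IsSpecialOn S V a u) (hy : y ∈ V) :
    ∑ i, cGrad S a u y i * (a y *ᵥ cGrad S a u y) i = 1 := by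
  rw [h.mulVec_cGrad hy, h.sum_grad_mul_pd hy]

/-- The trace over the level sets of `u` of `ℒ_N h` is twice the Laplacian of `u`. -/
lemma trPerp_lie_cH (hV : IsChartDomain S V) (h : IsSpecialOn S V a u) (hy : y ∈ V) :
    trPerp (a y) (cGrad S a u y) (lie S (cGrad S a u) (cH S a u) y)
      = 2 * cLaplacian S a u y := by
  rw [trPerp, h.lie_cH_eq_hess hV hy, tr_smul, sum_mul_mul_apply, Matrix.smul_mulVec,
    h.cHess_mulVec_grad hV hy]
  simp [cLaplacian]

end IsSpecialOn

end Hessian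

section Kappa

variable {n : ℕ} {S V : Set (EuclideanSpace ℝ (Fin (n + 1)))}
  {a : EuclideanSpace ℝ (Fin (n + 1)) → Matrix (Fin (n + 1)) (Fin (n + 1)) ℝ}
  {u : EuclideanSpace ℝ (Fin (n + 1)) → ℝ} {y : EuclideanSpace ℝ (Fin (n + 1))}

namespace IsSpecialOn

lemma cH_submatrix_succ (hu : ∀ i : Fin n, pd S i.succ u y = 0) :
    (cH S a u y).submatrix Fin.succ Fin.succ = (a y).submatrix Fin.succ Fin.succ := by
  ext i j
  simp [cH, hu]

lemma mulVec_grad_succ (h : IsSpecialOn S V a u) (hy : y ∈ V)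
    (hu : ∀ i : Fin n, pd S i.succ u y = 0) (i : Fin n) :
    (a y *ᵥ cGrad S a u y) i.succ = 0 := by
  rw [h.mulVec_cGrad hy]
  exact hu i

/-- `(1/2) tr^{h₀} h₁ = Δu` at the boundary. -/
lemma half_tr_lie_cH (hV : IsChartDomain S V) (h : IsSpecialOn S V a u) (hy : y ∈ V)
    (hu : ∀ i : Fin n, pd S i.succ u y = 0) :
    1 / 2 * tr ((cH S a u y).submatrix Fin.succ Fin.succ)
      ((lie S (cGrad S a u) (cH S a u) y).submatrix Fin.succ Fin.succ) = cLaplacian S a u y := by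
  rw [cH_submatrix_succ hu, tr_submatrix_succ (h.isUnit_det hy) (h.isSymm hy)
    (h.mulVec_grad_succ hy hu) (h.sum_grad_mul_mulVec hy), h.trPerp_lie_cH hV hy]
  ring

/-- `tr^{h₀} h₂ - (1/2) ‖h₁‖² = N(Δu)` at the boundary. As `ℒ_N h` and `ℒ_N a` are both `2 Hess u`,
the derivative of the trace of `ℒ_N h` along `N` is the trace of `ℒ_N ℒ_N h` minus `‖ℒ_N h‖²`. The
Hessian annihilates `N`, so that traces and norms may be taken in the ambient space. -/
lemma tr_lie_lie_cH (hV : IsChartDomain S V) (h : IsSpecialOn S V a u) (hy : y ∈ V)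
    (hu : ∀ i : Fin n, pd S i.succ u y = 0)
    (hd : ∀ i j, DifferentiableWithinAt ℝ (fun z => cHess S a u z i j) S y) :
    tr ((cH S a u y).submatrix Fin.succ Fin.succ)
        (((1 / 2 : ℝ) • lie S (cGrad S a u) (lie S (cGrad S a u) (cH S a u)) y).submatrix
          Fin.succ Fin.succ)
      - 1 / 2 * normSq ((cH S a u y).submatrix Fin.succ Fin.succ)
        ((lie S (cGrad S a u) (cH S a u) y).submatrix Fin.succ Fin.succ)
      = ∑ k, cGrad S a u y k * pd S k (cLaplacian S a u) y := by
  set T : EuclideanSpace ℝ (Fin (n + 1)) → Matrix (Fin (n + 1)) (Fin (n + 1)) ℝ :=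
    fun z => (2 : ℝ) • cHess S a u z with hTdef
  have hT : ∀ i j, DifferentiableWithinAt ℝ (fun z => T z i j) S y := fun i j =>
    (hd i j).const_smul (2 : ℝ)
  have hT0 : ∀ z ∈ V, T z *ᵥ cGrad S a u z = 0 := fun z hz => by
    rw [hTdef, Matrix.smul_mulVec, h.cHess_mulVec_grad hV hz, smul_zero]
  have hT0' : ∀ z ∈ V, cGrad S a u z ᵥ* T z = 0 := fun z hz => by
    rw [hTdef, Matrix.vecMul_smul, h.grad_vecMul_cHess hV hz, smul_zero]
  have e1 : lie S (cGrad S a u) (lie S (cGrad S a u) (cH S a u)) y = lie S (cGrad S a u) T y :=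
    lie_congr hV hy (fun _ _ => rfl) fun z hz => h.lie_cH_eq_hess hV hz
  have e2 : lie S (cGrad S a u) (cH S a u) y = T y := h.lie_cH_eq_hess hV hy
  have e3 : lie S (cGrad S a u) a y = T y := by
    rw [h.lie_cGrad hV hy (h.contDiff_fun y hy)]
  have hp : ∀ k, pd S k (fun z => tr (a z) (T z)) y = 2 * pd S k (cLaplacian S a u) y := by
    intro k
    have : (fun z => tr (a z) (T z)) = fun z => 2 * cLaplacian S a u z := by
      funext z; rw [hTdef, tr_smul]; rfl
    rw [this]
    have hL : DifferentiableWithinAt ℝ (cLaplacian S a u) S y := by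
      change DifferentiableWithinAt ℝ (fun z => tr (a z) (cHess S a u z)) S y
      simp only [tr, Matrix.trace, Matrix.diag, Matrix.mul_apply]
      exact DifferentiableWithinAt.fun_sum fun i _ => DifferentiableWithinAt.fun_sum fun k _ =>
        (h.diff_inv hy i k).mul (hd k i)
    rw [pd_mul (hV.unique hy) (differentiableWithinAt_const _) hL, pd_const]
    ring
  rw [e1, e2, cH_submatrix_succ hu,
    tr_submatrix_succ (h.isUnit_det hy) (h.isSymm hy) (h.mulVec_grad_succ hy hu)
      (h.sum_grad_mul_mulVec hy),
    normSq_submatrix_succ (h.isUnit_det hy) (h.isSymm hy) (h.mulVec_grad_succ hy hu)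
      (h.sum_grad_mul_mulVec hy) (hT0' y hy), trPerp, tr_smul, h.tr_lie hV hy hT, e3]
  have e4 := sum_mul_lie_eq_zero hV hy (h.diff_grad hV hy) hT hT0 hT0'
  have e5 : ∑ i, ∑ j, cGrad S a u y i * cGrad S a u y j
      * ((1 / 2 : ℝ) • lie S (cGrad S a u) T y) i j = 0 := by
    rw [← mul_zero (1 / 2 : ℝ), ← e4]
    simp only [Finset.mul_sum, Matrix.smul_apply, smul_eq_mul]
    exact Finset.sum_congr rfl fun i _ => Finset.sum_congr rfl fun j _ => by ring
  rw [e5]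
  simp only [hp, normSq, mul_left_comm _ (2 : ℝ), ← Finset.mul_sum]
  ring

end IsSpecialOn

end Kappa

/-! ### Conformal change -/

section Conformal

variable {d : ℕ} {S V : Set (EuclideanSpace ℝ (Fin d))}
  {a a' : EuclideanSpace ℝ (Fin d) → Matrix (Fin d) (Fin d) ℝ}
  {u u' w φ : EuclideanSpace ℝ (Fin d) → ℝ} {y : EuclideanSpace ℝ (Fin d)}

/-- The Laplacian in coordinates, with the Christoffel symbols written out. -/
lemma IsMetricOn.cLaplacian_eq (ha : IsMetricOn S V a) (hy : y ∈ V) :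
    cLaplacian S a w y = ∑ i, ∑ j, (a y)⁻¹ i j * pd S i (pd S j w) y
      - ∑ l, cGrad S a w y l * ∑ i, ∑ j, (a y)⁻¹ i j
        * (pd S i (fun z => a z j l) y - 1 / 2 * pd S l (fun z => a z i j) y) := by
  rw [cLaplacian, tr_eq_sum (ha.isSymm hy)]
  simp only [cHess, Matrix.of_apply, ha.sum_christoffel_mul hy, mul_sub, Finset.sum_sub_distrib]
  congr 1
  simp only [Finset.mul_sum, ← Finset.sum_sub_distrib, mul_add, Finset.sum_add_distrib]
  have h1 : ∑ i, ∑ j, ∑ l, (a y)⁻¹ i j * (1 / 2 * (cGrad S a w y l * pd S j (fun z => a z i l) y))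
      = ∑ i, ∑ j, ∑ l, (a y)⁻¹ i j * (1 / 2 * (cGrad S a w y l * pd S i (fun z => a z j l) y)) := by
    rw [Finset.sum_comm]
    refine Finset.sum_congr rfl fun i _ => Finset.sum_congr rfl fun j _ => ?_
    rw [ha.inv_symm hy]
  have h2 : ∀ F : Fin d → Fin d → Fin d → ℝ,
      ∑ l, ∑ i, ∑ j, F i j l = ∑ i, ∑ j, ∑ l, F i j l := fun F => by
    rw [Finset.sum_comm]
    exact Finset.sum_congr rfl fun i _ => Finset.sum_comm
  simp only [Finset.sum_sub_distrib]
  rw [h1, h2 fun i j l => cGrad S a w y l * ((a y)⁻¹ i j * pd S i (fun z => a z j l) y),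
    h2 fun i j l => cGrad S a w y l * ((a y)⁻¹ i j * (1 / 2 * pd S l (fun z => a z i j) y))]
  simp only [← Finset.sum_add_distrib, ← Finset.sum_sub_distrib]
  exact Finset.sum_congr rfl fun i _ => Finset.sum_congr rfl fun j _ =>
    Finset.sum_congr rfl fun l _ => by ring

lemma inv_exp_smul (ha : IsMetricOn S V a) (hy : y ∈ V) (c : ℝ) :
    (Real.exp c • a y)⁻¹ = Real.exp (-c) • (a y)⁻¹ := by
  refine Matrix.inv_eq_right_inv ?_
  rw [Matrix.smul_mul, Matrix.mul_smul, Matrix.mul_nonsing_inv _ (ha.isUnit_det hy), smul_smul,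
    ← Real.exp_add]
  simp

lemma cGrad_conformal (ha : IsMetricOn S V a) (h' : ∀ z ∈ V, a' z = Real.exp (2 * φ z) • a z)
    (hy : y ∈ V) (i : Fin d) :
    cGrad S a' w y i = Real.exp (-(2 * φ y)) * cGrad S a w y i := by
  simp only [cGrad, h' y hy, inv_exp_smul ha hy, Matrix.smul_apply, smul_eq_mul, Finset.mul_sum,
    mul_assoc]

lemma IsMetricOn.sum_cGrad_mul_comm (ha : IsMetricOn S V a) (hy : y ∈ V) :
    ∑ k, cGrad S a u y k * pd S k w y = ∑ k, cGrad S a w y k * pd S k u y := by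
  simp only [cGrad, Finset.sum_mul]
  rw [Finset.sum_comm]
  exact Finset.sum_congr rfl fun i _ => Finset.sum_congr rfl fun j _ => by
    rw [ha.inv_symm hy]; ring

/-- The Laplacian of a conformal metric `e^{2φ} a`. -/
lemma cLaplacian_conformal (hV : IsChartDomain S V) (ha : IsMetricOn S V a)
    (ha' : IsMetricOn S V a') (h' : ∀ z ∈ V, a' z = Real.exp (2 * φ z) • a z)
    (hφ : ∀ z ∈ V, ContDiffWithinAt ℝ 2 φ S z) (hy : y ∈ V) :
    cLaplacian S a' w y = Real.exp (-(2 * φ y)) * (cLaplacian S a w y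
      + ((d : ℝ) - 2) * ∑ k, cGrad S a w y k * pd S k φ y) := by
  have hφd := (hφ y hy).differentiableWithinAt (by norm_num)
  have h1 : ∀ k i j, pd S k (fun z => a' z i j) y
      = Real.exp (2 * φ y) * (2 * pd S k φ y * a y i j + pd S k (fun z => a z i j) y) := by
    intro k i j
    rw [hV.pd_congr hy (f' := fun z => Real.exp (2 * φ z) * a z i j)
      (fun z hz => by rw [h' z hz]; rfl), pd_mul (hV.unique hy) (hφd.const_mul 2).exp (ha.diff hy i j),
      pd_exp (hV.unique hy) (hφd.const_mul 2), pd_mul (hV.unique hy) (differentiableWithinAt_const _)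
        hφd, pd_const]
    ring
  have hδ : ∀ i l, ∑ j, (a y)⁻¹ i j * a y j l = if i = l then 1 else 0 := fun i l => by
    have := congr_fun₂ (Matrix.nonsing_inv_mul _ (ha.isUnit_det hy)) i l
    rwa [Matrix.mul_apply, Matrix.one_apply] at this
  have hone : Real.exp (-(2 * φ y)) * Real.exp (2 * φ y) = 1 := by
    rw [← Real.exp_add]; simp
  have h2 : ∀ l, ∑ i, ∑ j, (a' y)⁻¹ i j
        * (pd S i (fun z => a' z j l) y - 1 / 2 * pd S l (fun z => a' z i j) y)
      = ∑ i, ∑ j, (a y)⁻¹ i j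
        * (pd S i (fun z => a z j l) y - 1 / 2 * pd S l (fun z => a z i j) y)
        + (2 - (d : ℝ)) * pd S l φ y := by
    intro l
    have e1 : ∑ i, 2 * pd S i φ y * ∑ j, (a y)⁻¹ i j * a y j l = 2 * pd S l φ y := by
      simp [hδ]
    have e2 : ∑ i, ∑ j, (a y)⁻¹ i j * a y i j = d := by
      rw [← tr_eq_sum (ha.isSymm hy), tr_self (ha.isUnit_det hy)]
    calc _ = ∑ i, ∑ j, ((a y)⁻¹ i j
          * (pd S i (fun z => a z j l) y - 1 / 2 * pd S l (fun z => a z i j) y)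
          + 2 * pd S i φ y * ((a y)⁻¹ i j * a y j l)
          - pd S l φ y * ((a y)⁻¹ i j * a y i j)) := by
          refine Finset.sum_congr rfl fun i _ => Finset.sum_congr rfl fun j _ => ?_
          rw [h1, h1, h' y hy, inv_exp_smul ha hy, Matrix.smul_apply, smul_eq_mul]
          linear_combination ((a y)⁻¹ i j * (2 * pd S i φ y * a y j l + pd S i (fun z => a z j l) y
            - 1 / 2 * (2 * pd S l φ y * a y i j + pd S l (fun z => a z i j) y))) * hone
      _ = _ := by
          simp only [Finset.sum_sub_distrib, Finset.sum_add_distrib, ← Finset.mul_sum]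
          rw [e1, e2]; ring
  rw [ha'.cLaplacian_eq hy, ha.cLaplacian_eq hy]
  simp only [h2, cGrad_conformal ha h' hy]
  simp only [h' y hy, inv_exp_smul ha hy, Matrix.smul_apply, smul_eq_mul, mul_assoc,
    ← Finset.mul_sum, mul_add, Finset.sum_add_distrib]
  simp only [mul_left_comm _ (2 - (d : ℝ)), ← Finset.mul_sum]
  ring

lemma pd_exp_mul (hs : UniqueDiffWithinAt ℝ S y) (hφ : DifferentiableWithinAt ℝ φ S y)
    (hu : DifferentiableWithinAt ℝ u S y) (i : Fin d) :
    pd S i (fun z => Real.exp (φ z) * u z) y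
      = Real.exp (φ y) * (pd S i φ y * u y + pd S i u y) := by
  rw [pd_mul hs hφ.exp hu, pd_exp hs hφ]; ring

lemma cHess_exp_mul (hV : IsChartDomain S V)
    (hφ : ∀ z ∈ V, ContDiffWithinAt ℝ 2 φ S z) (hu : ∀ z ∈ V, ContDiffWithinAt ℝ 2 u S z)
    (h' : ∀ z ∈ V, u' z = Real.exp (φ z) * u z) (hy : y ∈ V) :
    cHess S a u' y = Real.exp (φ y) • (cHess S a u y + u y • cHess S a φ y
      + vecMulVec (fun i => pd S i φ y) (fun i => pd S i u y)
      + vecMulVec (fun i => pd S i u y) (fun i => pd S i φ y)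
      + u y • vecMulVec (fun i => pd S i φ y) (fun i => pd S i φ y)) := by
  have hφd : ∀ z ∈ V, DifferentiableWithinAt ℝ φ S z := fun z hz =>
    (hφ z hz).differentiableWithinAt (by norm_num)
  have hud : ∀ z ∈ V, DifferentiableWithinAt ℝ u S z := fun z hz =>
    (hu z hz).differentiableWithinAt (by norm_num)
  have h1 : ∀ i, ∀ z ∈ V, pd S i u' z = Real.exp (φ z) * (pd S i φ z * u z + pd S i u z) := by
    intro i z hz
    rw [hV.pd_congr hz h', pd_exp_mul (hV.unique hz) (hφd z hz) (hud z hz)]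
  have hφ2 : ∀ i, DifferentiableWithinAt ℝ (pd S i φ) S y := fun i =>
    (hV.contDiff_pd hy (hφ y hy) i).differentiableWithinAt (by norm_num)
  have hu2 : ∀ i, DifferentiableWithinAt ℝ (pd S i u) S y := fun i =>
    (hV.contDiff_pd hy (hu y hy) i).differentiableWithinAt (by norm_num)
  ext i j
  simp only [cHess, Matrix.of_apply, Matrix.smul_apply, Matrix.add_apply, smul_eq_mul,
    vecMulVec_apply, h1 _ y hy]
  rw [hV.pd_congr hy (h1 j) i, pd_exp_mul (hV.unique hy) (hφd y hy)
    (((hφ2 j).fun_mul (hud y hy)).fun_add (hu2 j)),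
    pd_add (hV.unique hy) ((hφ2 j).fun_mul (hud y hy)) (hu2 j),
    pd_mul (hV.unique hy) (hφ2 j) (hud y hy)]
  have h2 : ∑ k, christoffel S a y k i j * (Real.exp (φ y) * (pd S k φ y * u y + pd S k u y))
      = Real.exp (φ y) * (u y * ∑ k, christoffel S a y k i j * pd S k φ y
        + ∑ k, christoffel S a y k i j * pd S k u y) := by
    simp only [Finset.mul_sum, ← Finset.sum_add_distrib]
    exact Finset.sum_congr rfl fun k _ => by ring
  rw [h2]; ring

lemma IsMetricOn.tr_vecMulVec_pd (ha : IsMetricOn S V a) (hy : y ∈ V) :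
    tr (a y) (vecMulVec (fun i => pd S i u y) (fun i => pd S i w y))
      = ∑ k, cGrad S a u y k * pd S k w y := by
  rw [tr_vecMulVec (ha.isSymm hy)]
  simp only [cGrad, Finset.sum_mul]
  rw [Finset.sum_comm]
  exact Finset.sum_congr rfl fun i _ => Finset.sum_congr rfl fun j _ => by
    rw [ha.inv_symm hy]

/-- Two special functions `u` and `u' = e^φ u`, for the metrics `a` and `a' = e^{2φ} a`. The zeros of
`u`, which are the boundary points in the application, may not fill a neighbourhood. -/
structure IsSpecialPair {d : ℕ} (S V : Set (EuclideanSpace ℝ (Fin d)))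
    (a a' : EuclideanSpace ℝ (Fin d) → Matrix (Fin d) (Fin d) ℝ)
    (u u' φ : EuclideanSpace ℝ (Fin d) → ℝ) : Prop where
  special : IsSpecialOn S V a u
  special' : IsSpecialOn S V a' u'
  contDiff : ∀ z ∈ V, ContDiffWithinAt ℝ 2 φ S z
  metric_eq : ∀ z ∈ V, a' z = Real.exp (2 * φ z) • a z
  fun_eq : ∀ z ∈ V, u' z = Real.exp (φ z) * u z
  frequently_ne : ∀ z ∈ V, ∃ᶠ t in 𝓝[S] z, u t ≠ 0

namespace IsSpecialPair

lemma diff (h : IsSpecialPair S V a a' u u' φ) (hy : y ∈ V) : DifferentiableWithinAt ℝ φ S y :=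
  (h.contDiff y hy).differentiableWithinAt (by norm_num)

lemma diff_fun (h : IsSpecialPair S V a a' u u' φ) (hy : y ∈ V) :
    DifferentiableWithinAt ℝ u S y :=
  (h.special.contDiff_fun y hy).differentiableWithinAt (by norm_num)

lemma pd_fun (hV : IsChartDomain S V) (h : IsSpecialPair S V a a' u u' φ) (hy : y ∈ V)
    (i : Fin d) : pd S i u' y = Real.exp (φ y) * (pd S i φ y * u y + pd S i u y) := by
  rw [hV.pd_congr hy h.fun_eq, pd_exp_mul (hV.unique hy) (h.diff hy) (h.diff_fun hy)]

lemma cGrad_fun (hV : IsChartDomain S V) (h : IsSpecialPair S V a a' u u' φ) (hy : y ∈ V)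
    (i : Fin d) :
    cGrad S a' u' y i = Real.exp (-φ y) * (u y * cGrad S a φ y i + cGrad S a u y i) := by
  have he : Real.exp (-(2 * φ y)) * Real.exp (φ y) = Real.exp (-φ y) := by
    rw [← Real.exp_add]; ring_nf
  rw [cGrad_conformal h.special.toIsMetricOn h.metric_eq hy, ← he]
  simp only [cGrad, h.pd_fun hV hy, Finset.mul_sum, ← Finset.sum_add_distrib]
  exact Finset.sum_congr rfl fun j _ => by ring

lemma continuousWithinAt_gradSq (hV : IsChartDomain S V) (h : IsSpecialPair S V a a' u u' φ)
    (hy : y ∈ V) : ContinuousWithinAt (cGradSq S a φ) S y := by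
  refine tendsto_finsetSum _ fun i _ => tendsto_finsetSum _ fun j _ => ?_
  exact (((h.special.contDiff_inv hy i j).continuousWithinAt.mul
    (hV.contDiff_pd hy (h.contDiff y hy) i).continuousWithinAt).mul
    (hV.contDiff_pd hy (h.contDiff y hy) j).continuousWithinAt)

/-- Comparing the two eikonal equations: `2 ⟨∇u, ∇φ⟩ + u |∇φ|² = 0`, first where `u ≠ 0`, then
everywhere by continuity. -/
lemma sum_grad_mul_pd (hV : IsChartDomain S V) (h : IsSpecialPair S V a a' u u' φ) (hy : y ∈ V) :
    ∑ k, cGrad S a u y k * pd S k φ y = -(1 / 2) * (u y * cGradSq S a φ y) := by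
  have key : ∀ z ∈ V, u z ≠ 0 →
      2 * (∑ k, cGrad S a u z k * pd S k φ z) + u z * cGradSq S a φ z = 0 := by
    intro z hz h0
    have e1 := h.special'.sum_grad_mul_pd hz
    have e2 := h.special.sum_grad_mul_pd hz
    have hone : Real.exp (-φ z) * Real.exp (φ z) = 1 := by rw [← Real.exp_add]; simp
    have e3 : ∑ k, cGrad S a' u' z k * pd S k u' z
        = u z * (u z * cGradSq S a φ z) + u z * (∑ k, cGrad S a φ z k * pd S k u z)
          + u z * (∑ k, cGrad S a u z k * pd S k φ z) + ∑ k, cGrad S a u z k * pd S k u z := by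
      rw [cGradSq_eq_sum]
      simp only [Finset.mul_sum, ← Finset.sum_add_distrib, h.cGrad_fun hV hz, h.pd_fun hV hz]
      exact Finset.sum_congr rfl fun k _ => by
        linear_combination ((u z * cGrad S a φ z k + cGrad S a u z k)
          * (pd S k φ z * u z + pd S k u z)) * hone
    rw [e1, e2, h.special.sum_cGrad_mul_comm hz] at e3
    have e4 : u z * (2 * (∑ k, cGrad S a u z k * pd S k φ z) + u z * cGradSq S a φ z) = 0 := by
      linarith
    exact (mul_eq_zero.mp e4).resolve_left h0
  have hc : ContinuousWithinAt
      (fun z => 2 * (∑ k, cGrad S a u z k * pd S k φ z) + u z * cGradSq S a φ z) S y := by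
    refine ContinuousWithinAt.add (continuousWithinAt_const.mul ?_)
      ((h.diff_fun hy).continuousWithinAt.mul (h.continuousWithinAt_gradSq hV hy))
    exact tendsto_finsetSum _ fun i _ => ((h.special.contDiff_grad hV hy i).continuousWithinAt.mul
      (hV.contDiff_pd hy (h.contDiff y hy) i).continuousWithinAt)
  have hfr : ∃ᶠ z in 𝓝[S] y,
      2 * (∑ k, cGrad S a u z k * pd S k φ z) + u z * cGradSq S a φ z ∈ ({0} : Set ℝ) :=
    ((h.frequently_ne y hy).and_eventually (hV.mem_nhdsWithin y hy)).mono
      fun z hz => key z hz.2 hz.1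
  have := isClosed_singleton.mem_of_frequently_of_tendsto hfr hc
  rw [Set.mem_singleton_iff] at this
  linarith

/-- The Laplacians of two special functions, each with respect to its own metric. -/
lemma cLaplacian_fun (hV : IsChartDomain S V) (h : IsSpecialPair S V a a' u u' φ) (hy : y ∈ V) :
    cLaplacian S a' u' y = Real.exp (-φ y) * (cLaplacian S a u y
      + u y * (cLaplacian S a φ y + ((d : ℝ) - 2) / 2 * cGradSq S a φ y)) := by
  have ha := h.special.toIsMetricOn
  have he : Real.exp (-(2 * φ y)) * Real.exp (φ y) = Real.exp (-φ y) := by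
    rw [← Real.exp_add]; ring_nf
  have hB := h.sum_grad_mul_pd hV hy
  have h1 : cLaplacian S a u' y = Real.exp (φ y) * (cLaplacian S a u y + u y * cLaplacian S a φ y
      + 2 * (∑ k, cGrad S a u y k * pd S k φ y) + u y * cGradSq S a φ y) := by
    rw [cLaplacian, cHess_exp_mul hV h.contDiff h.special.contDiff_fun h.fun_eq hy]
    simp only [tr_smul, tr_add, ha.tr_vecMulVec_pd hy]
    rw [ha.sum_cGrad_mul_comm hy (u := φ) (w := u), cGradSq_eq_sum]
    simp only [cLaplacian]
    ring
  have h2 : ∑ k, cGrad S a u' y k * pd S k φ y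
      = Real.exp (φ y) * (u y * cGradSq S a φ y + ∑ k, cGrad S a u y k * pd S k φ y) := by
    rw [← ha.sum_cGrad_mul_comm hy, cGradSq_eq_sum, ← ha.sum_cGrad_mul_comm hy (u := φ) (w := u)]
    simp only [h.pd_fun hV hy, Finset.mul_sum, ← Finset.sum_add_distrib]
    exact Finset.sum_congr rfl fun k _ => by ring
  rw [cLaplacian_conformal hV ha h.special'.toIsMetricOn h.metric_eq h.contDiff hy, h1, h2, hB,
    ← he]
  ring

end IsSpecialPair

end Conformal

/-! ### Mean curvature of the level sets -/

section MeanCurvature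

variable {d : ℕ} {S V : Set (EuclideanSpace ℝ (Fin d))}
  {a g : EuclideanSpace ℝ (Fin d) → Matrix (Fin d) (Fin d) ℝ}
  {u : EuclideanSpace ℝ (Fin d) → ℝ} {y : EuclideanSpace ℝ (Fin d)}

/-- The mean curvature of the level sets of a special function `u`, with respect to the singular
metric `g = u⁻² a`. The `g`-unit normal is `u N` with `N = ∇ᵃ u`, and `ℒ_{uN}(u⁻² a)` consists of
`2 u⁻¹ Hess u`, of the term `-2 u⁻² a` from the derivative of `u⁻²`, and of a multiple of `du ⊗ du`,
which vanishes on the level sets. -/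
lemma IsSpecialOn.cMeanCurvature_eq (hV : IsChartDomain S V) (h : IsSpecialOn S V a u)
    (hpos : ∀ z ∈ V, 0 < u z) (hg : ∀ z ∈ V, a z = (u z) ^ 2 • g z) (hy : y ∈ V) :
    cMeanCurvature S g u y = (d : ℝ) - 1 - u y * cLaplacian S a u y := by
  have hu0 : u y ≠ 0 := (hpos y hy).ne'
  have hg' : ∀ z ∈ V, g z = ((u z)⁻¹ ^ 2) • a z := fun z hz => by
    have h0 := (hpos z hz).ne'
    rw [hg z hz, smul_smul, ← mul_pow, inv_mul_cancel₀ h0, one_pow, one_smul]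
  have hinv : ∀ z ∈ V, (g z)⁻¹ = (u z) ^ 2 • (a z)⁻¹ := fun z hz => by
    refine Matrix.inv_eq_right_inv ?_
    have h0 := (hpos z hz).ne'
    rw [hg' z hz, Matrix.smul_mul, Matrix.mul_smul, Matrix.mul_nonsing_inv _ (h.isUnit_det hz),
      smul_smul, ← mul_pow, inv_mul_cancel₀ h0, one_pow, one_smul]
  have hgrad : ∀ z ∈ V, ∀ i, cGrad S g u z i = (u z) ^ 2 * cGrad S a u z i := fun z hz i => by
    simp only [cGrad, hinv z hz, Matrix.smul_apply, smul_eq_mul, Finset.mul_sum, mul_assoc]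
  have hnormal : ∀ z ∈ V, cUnitNormal S g u z = fun i => u z * cGrad S a u z i := fun z hz => by
    funext i
    have h1 : cGradSq S g u z = (u z) ^ 2 := by
      rw [cGradSq_eq_sum]
      simp only [hgrad z hz, mul_assoc, ← Finset.mul_sum, h.sum_grad_mul_pd hz, mul_one]
    rw [cUnitNormal, h1, Real.sqrt_sq (hpos z hz).le, hgrad z hz]
    field_simp [(hpos z hz).ne']
  have hud : DifferentiableWithinAt ℝ u S y :=
    (h.contDiff_fun y hy).differentiableWithinAt (by norm_num)
  have hlie : lie S (cUnitNormal S g u) g y = (2 * (u y)⁻¹) • cHess S a u y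
      + (-2 * (u y)⁻¹ ^ 2) • a y
      + (2 * (u y)⁻¹ ^ 2) • vecMulVec (fun i => pd S i u y) (fun i => pd S i u y) := by
    rw [lie_congr hV hy hnormal hg']
    have h1 : lie S (cGrad S a u) a y = (2 : ℝ) • cHess S a u y :=
      h.lie_cGrad hV hy (h.contDiff_fun y hy)
    rw [mul_comm (2 : ℝ), mul_smul, ← h1]
    have hp1 : ∀ i k, pd S i (fun z => u z * cGrad S a u z k) y
        = pd S i u y * cGrad S a u y k + u y * pd S i (fun z => cGrad S a u z k) y := fun i k =>
      pd_mul (hV.unique hy) hud (h.diff_grad hV hy k)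
    have hF : HasDerivAt (fun t : ℝ => t⁻¹ ^ 2) (-2 * (u y)⁻¹ ^ 3) (u y) := by
      refine ((hasDerivAt_inv hu0).fun_pow 2).congr_deriv ?_
      push_cast
      field_simp
    have hFd : DifferentiableWithinAt ℝ (fun z => (u z)⁻¹ ^ 2) S y :=
      (hud.inv hu0).pow 2
    have hp2 : ∀ i j k, pd S k (fun z => (u z)⁻¹ ^ 2 * a z i j) y
        = -2 * (u y)⁻¹ ^ 3 * pd S k u y * a y i j
          + (u y)⁻¹ ^ 2 * pd S k (fun z => a z i j) y := fun i j k => by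
      rw [← pd_comp (hV.unique hy) hF hud]
      exact pd_mul (hV.unique hy) hFd (h.diff hy i j)
    ext i j
    simp only [lie, Matrix.of_apply, Matrix.add_apply, Matrix.smul_apply, smul_eq_mul,
      vecMulVec_apply, hp1, hp2]
    have e1 := h.sum_grad_mul_pd hy
    have e2 := h.sum_mul_cGrad (w := u) hy i
    have e3 := h.sum_mul_cGrad (w := u) hy j
    calc _ = (u y)⁻¹ * (∑ k, (cGrad S a u y k * pd S k (fun z => a z i j) y
            + a y k j * pd S i (fun z => cGrad S a u z k) y
            + a y i k * pd S j (fun z => cGrad S a u z k) y))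
          + (-2 * (u y)⁻¹ ^ 2) * a y i j * (∑ k, cGrad S a u y k * pd S k u y)
          + (u y)⁻¹ ^ 2 * pd S i u y * (∑ k, a y j k * cGrad S a u y k)
          + (u y)⁻¹ ^ 2 * pd S j u y * (∑ k, a y i k * cGrad S a u y k) := by
          simp only [Finset.mul_sum, ← Finset.sum_add_distrib]
          refine Finset.sum_congr rfl fun k _ => ?_
          rw [h.symm hy j k]
          field_simp
          ring
      _ = _ := by rw [e1, e2, e3]; ring
  have hqa : cGrad S a u y ⬝ᵥ (a y *ᵥ cGrad S a u y) = 1 := h.sum_grad_mul_mulVec hy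
  have hqd : (fun i => pd S i u y) ⬝ᵥ cGrad S a u y = 1 := by
    rw [dotProduct_comm]; exact h.sum_grad_mul_pd hy
  have htr : ∀ T, tr (g y) T = (u y) ^ 2 * tr (a y) T := fun T => by
    simp [tr, hinv y hy]
  rw [cMeanCurvature, hlie, trPerp, hnormal y hy, sum_mul_mul_apply]
  have hN : (fun i => u y * cGrad S a u y i) = u y • cGrad S a u y := rfl
  simp only [hN, htr, tr_smul, tr_add, h.tr_vecMulVec_pd hy, h.sum_grad_mul_pd hy,
    tr_self (h.isUnit_det hy), Matrix.smul_mulVec, Matrix.add_mulVec, Matrix.mulVec_smul,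
    dotProduct_smul, smul_dotProduct, dotProduct_add, h.cHess_mulVec_grad hV hy, hqa,
    Matrix.vecMulVec_mulVec, hqd, smul_eq_mul, dotProduct_zero, cLaplacian]
  have hqd' : cGrad S a u y ⬝ᵥ (fun i => pd S i u y) = 1 := h.sum_grad_mul_pd hy
  simp [hqd']
  field_simp
  ring

end MeanCurvature

/-! ### The half-space -/

section HalfSpace

variable {n : ℕ}

lemma mem_halfSpace {y : EuclideanSpace ℝ (Fin (n + 1))} : y ∈ halfSpace n ↔ 0 ≤ y 0 := by
  rw [halfSpace, range_modelWithCornersEuclideanHalfSpace]; rfl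

lemma uniqueDiffOn_halfSpace : UniqueDiffOn ℝ (halfSpace n) :=
  ModelWithCorners.uniqueDiffOn _

lemma halfSpace_subset_closure : halfSpace n ⊆ closure (interior (halfSpace n)) :=
  (𝓡∂ (n + 1)).range_subset_closure_interior

lemma convex_halfSpace : Convex ℝ (halfSpace n) :=
  (𝓡∂ (n + 1)).convex_range

lemma add_single_mem_halfSpace {z : EuclideanSpace ℝ (Fin (n + 1))} (hz : z ∈ halfSpace n)
    {t : ℝ} (ht : 0 ≤ t) (i : Fin (n + 1)) :
    z + t • EuclideanSpace.single i (1 : ℝ) ∈ halfSpace n := by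
  rw [mem_halfSpace] at *
  by_cases hi : 0 = i
  · subst hi; simpa using add_nonneg hz ht
  · simpa [hi] using hz

/-- The inclusion of the face, as a linear map. -/
noncomputable def faceL (n : ℕ) :
    EuclideanSpace ℝ (Fin n) →L[ℝ] EuclideanSpace ℝ (Fin (n + 1)) :=
  LinearMap.toContinuousLinearMap
    { toFun := face
      map_add' := fun v w => by
        ext i; refine Fin.cases ?_ (fun j => ?_) i <;> simp [face]
      map_smul' := fun c v => by
        ext i; refine Fin.cases ?_ (fun j => ?_) i <;> simp [face] }

lemma faceL_apply (y : EuclideanSpace ℝ (Fin n)) : faceL n y = face y := rfl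

@[simp] lemma face_zero (y : EuclideanSpace ℝ (Fin n)) : face y 0 = 0 := by simp [face]

@[simp] lemma face_succ (y : EuclideanSpace ℝ (Fin n)) (i : Fin n) : face y i.succ = y i := by
  simp [face]

lemma face_mem_halfSpace (y : EuclideanSpace ℝ (Fin n)) : face y ∈ halfSpace n := by
  rw [mem_halfSpace, face_zero]

lemma face_single (i : Fin n) :
    face (EuclideanSpace.single i (1 : ℝ)) = EuclideanSpace.single i.succ (1 : ℝ) := by
  ext j
  refine Fin.cases ?_ (fun k => ?_) j
  · simp [Ne.symm (Fin.succ_ne_zero i)]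
  · simp

/-- The face consists of the points with `z 0 = 0`. -/
lemma exists_face_eq {z : EuclideanSpace ℝ (Fin (n + 1))} (hz : z 0 = 0) :
    ∃ y : EuclideanSpace ℝ (Fin n), face y = z := by
  refine ⟨WithLp.toLp 2 fun i => z i.succ, ?_⟩
  ext j
  refine Fin.cases ?_ (fun k => ?_) j
  · simp [hz]
  · simp

/-- The derivatives of a function along the face. -/
lemma pd_face {f : EuclideanSpace ℝ (Fin (n + 1)) → ℝ} {y : EuclideanSpace ℝ (Fin n)}
    (hf : DifferentiableWithinAt ℝ f (halfSpace n) (face y)) (i : Fin n) :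
    pd Set.univ i (fun z => f (face z)) y = pd (halfSpace n) i.succ f (face y) := by
  have h : HasFDerivWithinAt (fun z => f (face z))
      ((fderivWithin ℝ f (halfSpace n) (face y)).comp (faceL n)) Set.univ y :=
    hf.hasFDerivWithinAt.comp y (faceL n).hasFDerivWithinAt fun z _ => face_mem_halfSpace z
  rw [pd_eq_of_hasFDerivWithinAt (uniqueDiffWithinAt_univ) h]
  simp [pd, faceL_apply, face_single]

lemma tendsto_face (y : EuclideanSpace ℝ (Fin n)) :
    Tendsto face (𝓝 y) (𝓝[halfSpace n] (face y)) :=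
  tendsto_nhdsWithin_iff.2 ⟨(faceL n).continuous.tendsto y,
    Eventually.of_forall face_mem_halfSpace⟩

/-- The tangential derivatives of a function which vanishes on the face. -/
lemma pd_succ_eq_zero {f : EuclideanSpace ℝ (Fin (n + 1)) → ℝ}
    {p : EuclideanSpace ℝ (Fin (n + 1))} (hp : p 0 = 0)
    (hf : DifferentiableWithinAt ℝ f (halfSpace n) p)
    (h0 : ∀ᶠ z in 𝓝[halfSpace n] p, z 0 = 0 → f z = 0) (i : Fin n) :
    pd (halfSpace n) i.succ f p = 0 := by
  obtain ⟨y, rfl⟩ := exists_face_eq hp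
  rw [← pd_face hf, ← pd_const (S := Set.univ) (y := y) (i := i) 0]
  refine pd_congr ?_ (Set.mem_univ _)
  rw [nhdsWithin_univ]
  filter_upwards [(tendsto_face y).eventually h0] with z hz using hz (face_zero z)

end HalfSpace

/-! ### Regularity of solutions of a transport equation -/

section Transport

variable {n : ℕ}

/-- The truncated cone over a cube of the face: the domain of dependence of a vector field whose
slope is at most `C`. -/
def slopeCone (p : EuclideanSpace ℝ (Fin (n + 1))) (r C : ℝ) :
    Set (EuclideanSpace ℝ (Fin (n + 1))) :=
  {z | 0 ≤ z 0 ∧ z 0 ≤ r ∧ ∀ i : Fin n, |z i.succ - p i.succ| ≤ r - C * z 0}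

lemma isCompact_slopeCone (p : EuclideanSpace ℝ (Fin (n + 1))) (r : ℝ) {C : ℝ} (hC : 0 ≤ C) :
    IsCompact (slopeCone p r C) := by
  have h1 : IsCompact ((EuclideanSpace.equiv (Fin (n + 1)) ℝ) ⁻¹'
      Set.Icc (fun i => min 0 (p i - r)) (fun i => max r (p i + r))) :=
    (EuclideanSpace.equiv (Fin (n + 1)) ℝ).toHomeomorph.isClosedEmbedding.isCompact_preimage
      isCompact_Icc
  refine h1.of_isClosed_subset ?_ ?_
  · simp only [slopeCone, Set.ofPred_and, Set.ofPred_forall]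
    refine (isClosed_le (by fun_prop) (by fun_prop)).inter
      ((isClosed_le (by fun_prop) (by fun_prop)).inter (isClosed_iInter fun i => ?_))
    exact isClosed_le (by fun_prop) (by fun_prop)
  · rintro z ⟨hz0, hz1, hz2⟩
    refine ⟨fun i => ?_, fun i => ?_⟩
    · refine Fin.cases (min_le_of_left_le hz0) (fun j => min_le_of_right_le ?_) i
      have := (abs_le.1 (hz2 j)).1
      have := mul_nonneg hC hz0
      change p j.succ - r ≤ z j.succ
      linarith
    · refine Fin.cases (le_max_of_le_left hz1) (fun j => le_max_of_le_right ?_) i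
      have := (abs_le.1 (hz2 j)).2
      have := mul_nonneg hC hz0
      change z j.succ ≤ p j.succ + r
      linarith

lemma norm_sub_le_of_mem_slopeCone {p z : EuclideanSpace ℝ (Fin (n + 1))} {r C : ℝ} (hC : 0 ≤ C)
    (hp : p 0 = 0) (hz : z ∈ slopeCone p r C) : ‖z - p‖ ≤ (n + 1) * r := by
  obtain ⟨h0, h1, h2⟩ := hz
  have h3 : ∀ i, ‖(z - p) i‖ ≤ r := by
    intro i
    refine Fin.cases ?_ (fun j => ?_) i
    · simpa [hp, abs_of_nonneg h0] using h1
    · refine (h2 j).trans ?_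
      have := mul_nonneg hC h0
      linarith
  calc ‖z - p‖ = ‖∑ i, (z - p) i • EuclideanSpace.single i (1 : ℝ)‖ := by
        conv_lhs => rw [← (EuclideanSpace.basisFun (Fin (n + 1)) ℝ).sum_repr (z - p)]
        simp
    _ ≤ ∑ i, ‖(z - p) i • EuclideanSpace.single i (1 : ℝ)‖ := norm_sum_le _ _
    _ ≤ ∑ _i : Fin (n + 1), r := by
        refine Finset.sum_le_sum fun i _ => ?_
        rw [norm_smul]; simpa using h3 i
    _ = (n + 1) * r := by simp

lemma slopeCone_mem_nhdsWithin {p : EuclideanSpace ℝ (Fin (n + 1))} {r C : ℝ} (hC : 0 ≤ C)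
    (hr : 0 < r) (hp : p 0 = 0) : slopeCone p r C ∈ 𝓝[halfSpace n] p := by
  rw [Metric.mem_nhdsWithin_iff]
  refine ⟨r / (1 + C), by positivity, fun z hz => ?_⟩
  have h1 : ∀ i, |z i - p i| ≤ r / (1 + C) := fun i =>
    (PiLp.norm_apply_le (z - p) i).trans (mem_ball_iff_norm.1 hz.1).le
  have h2 : 0 ≤ z 0 := mem_halfSpace.1 hz.2
  have h3 : z 0 ≤ r / (1 + C) := by simpa [hp, abs_of_nonneg h2] using h1 0
  have h4 : r / (1 + C) * (1 + C) = r := div_mul_cancel₀ _ (by positivity)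
  have h5 : 0 ≤ r / (1 + C) * C := by positivity
  refine ⟨h2, by linarith, fun i => ?_⟩
  have := h1 i.succ
  have := mul_le_mul_of_nonneg_left h3 hC
  linarith

/-- A comparison principle: if `f ≤ 0` on the face and `f` grows along the field `N` more slowly
than `δ z₀`, then `f ≤ δ z₀` in a domain of dependence. At a maximum point of `f - δ z₀` off the
face, one could move backwards along `N` without leaving the domain. -/
lemma le_mul_of_transport_lt {p : EuclideanSpace ℝ (Fin (n + 1))} {r C δ : ℝ} (hC : 0 ≤ C)
    {N : EuclideanSpace ℝ (Fin (n + 1)) → EuclideanSpace ℝ (Fin (n + 1))}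
    {f : EuclideanSpace ℝ (Fin (n + 1)) → ℝ}
    {f' : EuclideanSpace ℝ (Fin (n + 1)) → EuclideanSpace ℝ (Fin (n + 1)) →L[ℝ] ℝ}
    (hN0 : ∀ z ∈ slopeCone p r C, 0 < N z 0)
    (hN : ∀ z ∈ slopeCone p r C, ∀ i : Fin n, |N z i.succ| ≤ C * N z 0)
    (hf : ∀ z ∈ slopeCone p r C, HasFDerivWithinAt f (f' z) (halfSpace n) z)
    (hlt : ∀ z ∈ slopeCone p r C, f' z (N z) < δ * N z 0)
    (hface : ∀ z ∈ slopeCone p r C, z 0 = 0 → f z ≤ 0) :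
    ∀ z ∈ slopeCone p r C, f z ≤ δ * z 0 := by
  intro z₀ hz₀
  have hsub : slopeCone p r C ⊆ halfSpace n := fun z hz => mem_halfSpace.2 hz.1
  have hg : ∀ z ∈ slopeCone p r C, HasFDerivWithinAt (fun z => f z - δ * z 0)
      (f' z - δ • (EuclideanSpace.proj 0 : EuclideanSpace ℝ (Fin (n + 1)) →L[ℝ] ℝ))
      (slopeCone p r C) z := fun z hz =>
    ((hf z hz).mono hsub).fun_sub
      ((EuclideanSpace.proj 0 : EuclideanSpace ℝ (Fin (n + 1)) →L[ℝ] ℝ).hasFDerivWithinAt.const_mul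
        δ)
  obtain ⟨q, hq, hmax⟩ := (isCompact_slopeCone p r hC).exists_isMaxOn ⟨z₀, hz₀⟩
    (fun z hz => (hg z hz).continuousWithinAt)
  have hle : f z₀ - δ * z₀ 0 ≤ f q - δ * q 0 := hmax hz₀
  by_contra! hcon
  have hq0 : 0 < q 0 := by
    rcases hq.1.lt_or_eq with h | h
    · exact h
    · have := hface q hq h.symm
      rw [← h] at hle
      linarith
  have hcone : q + (q 0 / N q 0) • (-N q) - q ∈ posTangentConeAt (slopeCone p r C) q := by
    refine sub_mem_posTangentConeAt_of_segment_subset ?_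
    rw [segment_eq_image']
    rintro _ ⟨t, ⟨ht0, ht1⟩, rfl⟩
    have hNq := hN0 q hq
    have e0 : t * (q 0 / N q 0 * N q 0) = t * q 0 := by rw [div_mul_cancel₀ _ hNq.ne']
    have h0 : (q + t • (q + (q 0 / N q 0) • (-N q) - q)) 0 = (1 - t) * q 0 := by
      simp only [add_sub_cancel_left, PiLp.add_apply, PiLp.smul_apply, PiLp.neg_apply, smul_eq_mul]
      linear_combination -e0
    refine ⟨?_, ?_, fun i => ?_⟩
    · rw [h0]; exact mul_nonneg (by linarith) hq0.le
    · rw [h0]; nlinarith [hq.2.1]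
    · rw [h0]
      have h1 : (q + t • (q + (q 0 / N q 0) • (-N q) - q)) i.succ - p i.succ
          = (q i.succ - p i.succ) + -(t * (q 0 / N q 0) * N q i.succ) := by
        simp only [add_sub_cancel_left, PiLp.add_apply, PiLp.smul_apply, PiLp.neg_apply,
          smul_eq_mul]
        ring
      rw [h1]
      have h2 : |-(t * (q 0 / N q 0) * N q i.succ)| ≤ t * (q 0 / N q 0) * (C * N q 0) := by
        have hnn : 0 ≤ t * (q 0 / N q 0) := mul_nonneg ht0 (div_nonneg hq0.le hNq.le)
        rw [abs_neg, abs_mul, abs_of_nonneg hnn]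
        exact mul_le_mul_of_nonneg_left (hN q hq i) hnn
      calc _ ≤ |q i.succ - p i.succ| + |-(t * (q 0 / N q 0) * N q i.succ)| := abs_add_le _ _
        _ ≤ (r - C * q 0) + t * (q 0 / N q 0) * (C * N q 0) := add_le_add (hq.2.2 i) h2
        _ = r - C * ((1 - t) * q 0) := by linear_combination C * e0
  have hnonpos := hmax.localize.hasFDerivWithinAt_nonpos (hg q hq) hcone
  have hNq := hN0 q hq
  have h3 : (q 0 / N q 0) * (δ * N q 0 - f' q (N q)) ≤ 0 := by
    simp only [add_sub_cancel_left, map_smul, map_neg, _root_.sub_apply,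
      _root_.smul_apply, smul_eq_mul] at hnonpos
    have h4 : (EuclideanSpace.proj 0 : EuclideanSpace ℝ (Fin (n + 1)) →L[ℝ] ℝ) (N q) = N q 0 := rfl
    rw [h4] at hnonpos
    linarith
  have h4 := hlt q hq
  have h5 : 0 < (q 0 / N q 0) * (δ * N q 0 - f' q (N q)) :=
    mul_pos (div_pos hq0 hNq) (by linarith)
  linarith

/-- A `C¹` function is strictly differentiable within a convex set. -/
lemma exists_norm_sub_sub_le {E F : Type*} [NormedAddCommGroup E] [NormedSpace ℝ E]
    [NormedAddCommGroup F] [NormedSpace ℝ F] {S : Set E} {p : E} {f : E → F} (hS : Convex ℝ S)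
    (hS' : UniqueDiffOn ℝ S) (hp : p ∈ S) (hf : ContDiffWithinAt ℝ 1 f S p) {ε : ℝ} (hε : 0 < ε) :
    ∃ ρ > 0, ∀ w ∈ S ∩ Metric.ball p ρ, ∀ z ∈ S ∩ Metric.ball p ρ,
      ‖f w - f z - fderivWithin ℝ f S p (w - z)‖ ≤ ε * ‖w - z‖ := by
  have h1 : ContinuousWithinAt (fderivWithin ℝ f S) S p :=
    (hf.fderivWithin_right (m := 0) hS' (by norm_num) hp).continuousWithinAt
  have h2 : ∀ᶠ z in 𝓝[S] p, ‖fderivWithin ℝ f S z - fderivWithin ℝ f S p‖ ≤ ε := by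
    have := (tendsto_iff_norm_sub_tendsto_zero.1 h1).eventually (gt_mem_nhds hε)
    filter_upwards [this] with z hz using hz.le
  have h3 : ∀ᶠ z in 𝓝[S] p, DifferentiableWithinAt ℝ f S z := by
    have := hf.eventually (by simp)
    rw [Set.insert_eq_of_mem hp] at this
    filter_upwards [this] with z hz using hz.differentiableWithinAt (by norm_num)
  obtain ⟨ρ, hρ, hsub⟩ := Metric.mem_nhdsWithin_iff.1 (h2.and h3)
  refine ⟨ρ, hρ, fun w hw z hz => ?_⟩
  refine (hS.inter (convex_ball p ρ)).norm_image_sub_le_of_norm_hasFDerivWithin_le'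
    (f' := fderivWithin ℝ f S) (fun y hy => ?_) (fun y hy => ?_) hz hw
  · exact (hsub ⟨hy.2, hy.1⟩).2.hasFDerivWithinAt.mono Set.inter_subset_left
  · exact (hsub ⟨hy.2, hy.1⟩).1

/-- Let `v` be a `C¹` function which vanishes on the face and satisfies a transport equation
`N v = F`, where `N` is transversal to the face. If `N` and `F` are `C¹`, then the tangential
derivatives of `v`, which are only continuous, are differentiable at the points of the face.

The increment of `v` in a tangential direction satisfies a transport equation with small right-hand
side; compare it with a multiple of `z₀` and let the increment tend to zero. -/
theorem differentiableWithinAt_pd_of_transport {p : EuclideanSpace ℝ (Fin (n + 1))} (hp : p 0 = 0)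
    {v F : EuclideanSpace ℝ (Fin (n + 1)) → ℝ}
    {N : EuclideanSpace ℝ (Fin (n + 1)) → EuclideanSpace ℝ (Fin (n + 1))}
    (hv : ContDiffWithinAt ℝ 1 v (halfSpace n) p) (hF : ContDiffWithinAt ℝ 1 F (halfSpace n) p)
    (hN : ContDiffWithinAt ℝ 1 N (halfSpace n) p) (hN0 : 0 < N p 0)
    (hface : ∀ᶠ z in 𝓝[halfSpace n] p, z 0 = 0 → v z = 0)
    (hvN : ∀ᶠ z in 𝓝[halfSpace n] p, fderivWithin ℝ v (halfSpace n) z (N z) = F z)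
    (l : Fin n) : DifferentiableWithinAt ℝ (pd (halfSpace n) l.succ v) (halfSpace n) p := by
  set S := halfSpace n with hSdef
  have hpS : p ∈ S := mem_halfSpace.2 hp.ge
  have hS' : UniqueDiffOn ℝ S := uniqueDiffOn_halfSpace
  have hSc : Convex ℝ S := convex_halfSpace
  set e : EuclideanSpace ℝ (Fin (n + 1)) := EuclideanSpace.single l.succ 1 with he
  have hnorm_e : ‖e‖ = 1 := by simp [he]
  have he0 : e 0 = 0 := by simp [he]
  set dv := fderivWithin ℝ v S with hdv
  set dF := fderivWithin ℝ F S p with hdF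
  set dN := fderivWithin ℝ N S p with hdN
  set G : ℝ := dF e - dv p (dN e) with hG
  set m : ℝ := N p 0 with hm
  set c : ℝ := G / m with hc
  -- `c` is the derivative of the tangential derivative of `v` in the direction transversal to the
  -- face, as the transport equation predicts
  have key : ∀ δ > 0, ∀ᶠ z in 𝓝[S] p, |pd S l.succ v z - c * z 0| ≤ δ * z 0 := by
    intro δ hδ
    set ε : ℝ := δ * m / 8 with hε
    have hεpos : 0 < ε := by positivity
    -- a bound for the slope of `N` near `p`
    set C : ℝ := 2 * (∑ i, |N p i| + 1) / m with hCdef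
    have hsum : 0 ≤ ∑ i, |N p i| := Finset.sum_nonneg fun i _ => abs_nonneg _
    have hC : 0 ≤ C := by positivity
    have hdvc : ContinuousWithinAt dv S p :=
      (hv.fderivWithin_right (m := 0) hS' (by norm_num) hpS).continuousWithinAt
    have hNi : ∀ i, ContinuousWithinAt (fun z => N z i) S p := fun i =>
      (EuclideanSpace.proj i : EuclideanSpace ℝ (Fin (n + 1)) →L[ℝ] ℝ).continuous.continuousAt
        |>.comp_continuousWithinAt hN.continuousWithinAt
    -- the accuracy needed of the first-order expansions of `F` and `N`
    set D : ℝ := ‖dv p‖ + 1 with hD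
    have hDpos : 0 < D := by positivity
    obtain ⟨ρ₁, hρ₁, hF1⟩ := exists_norm_sub_sub_le hSc hS' hpS hF (ε := ε / 3) (by positivity)
    obtain ⟨ρ₂, hρ₂, hN1⟩ := exists_norm_sub_sub_le hSc hS' hpS hN (ε := ε / (3 * D))
      (by positivity)
    have ev1 : ∀ᶠ z in 𝓝[S] p, ‖dv z - dv p‖ < min 1 (ε / (3 * (‖dN‖ + 1))) :=
      (tendsto_iff_norm_sub_tendsto_zero.1 hdvc).eventually
        (gt_mem_nhds (lt_min one_pos (by positivity)))
    have ev2 : ∀ᶠ z in 𝓝[S] p, m / 2 < N z 0 :=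
      (hNi 0).eventually (lt_mem_nhds (half_lt_self hN0))
    have ev3 : ∀ᶠ z in 𝓝[S] p, ∀ i, |N z i| < |N p i| + 1 :=
      eventually_all.2 fun i => (hNi i).abs.eventually (gt_mem_nhds (lt_add_one _))
    have ev4 : ∀ᶠ z in 𝓝[S] p, |G - c * N z 0| < ε := by
      have h1 : ContinuousWithinAt (fun z => |G - c * N z 0|) S p :=
        (continuousWithinAt_const.sub (continuousWithinAt_const.mul (hNi 0))).abs
      refine h1.eventually (gt_mem_nhds ?_)
      change |G - c * m| < ε
      rw [hc, div_mul_cancel₀ _ hN0.ne']; simpa using hεpos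
    have ev5 : ∀ᶠ z in 𝓝[S] p, DifferentiableWithinAt ℝ v S z := by
      have := hv.eventually (by simp)
      rw [Set.insert_eq_of_mem hpS] at this
      filter_upwards [this] with z hz using hz.differentiableWithinAt (by norm_num)
    obtain ⟨ρ₃, hρ₃, hsub⟩ := Metric.mem_nhdsWithin_iff.1
      (ev1.and (ev2.and (ev3.and (ev4.and (ev5.and (hface.and hvN))))))
    set ρ : ℝ := min ρ₁ (min ρ₂ ρ₃) with hρdef
    have hρ : 0 < ρ := lt_min hρ₁ (lt_min hρ₂ hρ₃)
    set r : ℝ := ρ / (2 * (n + 2)) with hr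
    have hrpos : 0 < r := by positivity
    have hconeS : ∀ z ∈ slopeCone p r C, z ∈ S := fun z hz => mem_halfSpace.2 hz.1
    have hconeball : ∀ z ∈ slopeCone p r C, ‖z - p‖ < ρ / 2 := by
      intro z hz
      refine (norm_sub_le_of_mem_slopeCone hC hp hz).trans_lt ?_
      rw [hr, mul_div_assoc', div_lt_div_iff₀ (by positivity) two_pos]
      nlinarith
    have hshift : ∀ z ∈ slopeCone p r C, ∀ η, 0 ≤ η → η < ρ / 2 →
        z + η • e ∈ S ∩ Metric.ball p ρ := by
      intro z hz η h0 h1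
      refine ⟨add_single_mem_halfSpace (hconeS z hz) h0 _, ?_⟩
      rw [mem_ball_iff_norm]
      calc ‖z + η • e - p‖ = ‖(z - p) + η • e‖ := by congr 1; abel
        _ ≤ ‖z - p‖ + ‖η • e‖ := norm_add_le _ _
        _ < ρ / 2 + ρ / 2 := by
          refine add_lt_add (hconeball z hz) ?_
          rwa [norm_smul, hnorm_e, mul_one, Real.norm_of_nonneg h0]
        _ = ρ := by ring
    have hshift0 : ∀ z ∈ slopeCone p r C, z ∈ S ∩ Metric.ball p ρ := fun z hz => by
      simpa using hshift z hz 0 le_rfl (by positivity)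
    have hB : ∀ z ∈ S ∩ Metric.ball p ρ, z ∈ S ∩ Metric.ball p ρ₁ ∧ z ∈ S ∩ Metric.ball p ρ₂ ∧
        z ∈ Metric.ball p ρ₃ ∩ S := fun z hz =>
      ⟨⟨hz.1, Metric.ball_subset_ball (min_le_left _ _) hz.2⟩,
        ⟨hz.1, Metric.ball_subset_ball ((min_le_right _ _).trans (min_le_left _ _)) hz.2⟩,
        ⟨Metric.ball_subset_ball ((min_le_right _ _).trans (min_le_right _ _)) hz.2, hz.1⟩⟩
    -- the transport equation of the increment
    have hmain : ∀ z ∈ slopeCone p r C, ∀ η, 0 < η → η < ρ / 2 →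
        |(dv (z + η • e) - dv z) (N z) - η * c * N z 0| < η * δ * N z 0 := by
      intro z hz η h0 h1
      set w := z + η • e with hw
      have hwz : w - z = η • e := by rw [hw]; abel
      have hwz' : ‖w - z‖ = η := by
        rw [hwz, norm_smul, hnorm_e, mul_one, Real.norm_of_nonneg h0.le]
      obtain ⟨hw1, hw2, hw3⟩ := hB w (hshift z hz η h0.le h1)
      obtain ⟨hz1, hz2, hz3⟩ := hB z (hshift0 z hz)
      obtain ⟨w1, -, -, -, -, -, w7⟩ := hsub hw3
      obtain ⟨-, z2, -, z4, -, -, z7⟩ := hsub hz3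
      have a1 := hF1 w hw1 z hz1
      have a2 := hN1 w hw2 z hz2
      rw [hwz'] at a1 a2
      rw [hwz, map_smul] at a1 a2
      have b1 : ‖dv w‖ ≤ D := by
        have h3 : ‖dv w - dv p‖ ≤ 1 := (w1.trans_le (min_le_left _ _)).le
        have h4 : ‖dv w‖ - ‖dv p‖ ≤ ‖dv w - dv p‖ := norm_sub_norm_le _ _
        linarith
      have b2 : ‖dv w - dv p‖ * ‖dN‖ ≤ ε / 3 := by
        have h3 := (w1.trans_le (min_le_right _ _)).le
        calc ‖dv w - dv p‖ * ‖dN‖ ≤ ε / (3 * (‖dN‖ + 1)) * (‖dN‖ + 1) :=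
              mul_le_mul h3 (by linarith) (norm_nonneg _) (by positivity)
          _ = ε / 3 := by field_simp
      have c1 : |dv w (N w - N z - η • dN e)| ≤ ε / 3 * η := by
        calc |dv w (N w - N z - η • dN e)| ≤ ‖dv w‖ * ‖N w - N z - η • dN e‖ :=
              (dv w).le_opNorm _
          _ ≤ D * (ε / (3 * D) * η) := mul_le_mul b1 a2 (norm_nonneg _) hDpos.le
          _ = ε / 3 * η := by field_simp
      have c2 : |(dv w - dv p) (η • dN e)| ≤ ε / 3 * η := by
        have h3 : ‖dN e‖ ≤ ‖dN‖ := by simpa [hnorm_e] using dN.le_opNorm e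
        calc |(dv w - dv p) (η • dN e)| ≤ ‖dv w - dv p‖ * ‖η • dN e‖ := (dv w - dv p).le_opNorm _
          _ ≤ ‖dv w - dv p‖ * (η * ‖dN‖) := by
              refine mul_le_mul_of_nonneg_left ?_ (norm_nonneg _)
              rw [norm_smul, Real.norm_of_nonneg h0.le]
              exact mul_le_mul_of_nonneg_left h3 h0.le
          _ = (‖dv w - dv p‖ * ‖dN‖) * η := by ring
          _ ≤ ε / 3 * η := mul_le_mul_of_nonneg_right b2 h0.le
      have c3 : |F w - F z - η * dF e| ≤ ε / 3 * η := by simpa using a1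
      have c4 : (dv w - dv z) (N z) - η * c * N z 0
          = (F w - F z - η * dF e) - dv w (N w - N z - η • dN e) - (dv w - dv p) (η • dN e)
            + η * (G - c * N z 0) := by
        simp only [hG, _root_.sub_apply, map_sub, map_smul, smul_eq_mul, ← w7, ← z7]
        ring
      have c5 : |η * (G - c * N z 0)| ≤ η * ε := by
        rw [abs_mul, abs_of_pos h0]
        exact mul_le_mul_of_nonneg_left z4.le h0.le
      have c6 : η * (2 * ε) < η * (δ * N z 0) := by
        refine mul_lt_mul_of_pos_left ?_ h0
        have := mul_lt_mul_of_pos_left z2 hδ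
        have := mul_pos hδ hN0
        rw [hε]; linarith
      rw [c4]
      have d1 := abs_add_le ((F w - F z - η * dF e) - dv w (N w - N z - η • dN e)
        - (dv w - dv p) (η • dN e)) (η * (G - c * N z 0))
      have d2 := abs_sub ((F w - F z - η * dF e) - dv w (N w - N z - η • dN e))
        ((dv w - dv p) (η • dN e))
      have d3 := abs_sub (F w - F z - η * dF e) (dv w (N w - N z - η • dN e))
      linarith
    -- the comparison principle, for the increment and for its negative
    have hincr : ∀ z ∈ slopeCone p r C, ∀ η, 0 < η → η < ρ / 2 →
        |v (z + η • e) - v z - η * c * z 0| ≤ η * δ * z 0 := by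
      intro z hz η h0 h1
      have hd : ∀ z ∈ slopeCone p r C, HasFDerivWithinAt
          (fun z => v (z + η • e) - v z - η * c * z 0)
          (dv (z + η • e) - dv z
            - (η * c) • (EuclideanSpace.proj 0 : EuclideanSpace ℝ (Fin (n + 1)) →L[ℝ] ℝ)) S z := by
        intro z hz
        obtain ⟨-, -, hw3⟩ := hB _ (hshift z hz η h0.le h1)
        obtain ⟨-, -, hz3⟩ := hB z (hshift0 z hz)
        have h2 : HasFDerivWithinAt (fun z => v (z + η • e)) (dv (z + η • e)) S z := by
          have := (hsub hw3).2.2.2.2.1.hasFDerivWithinAt.comp z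
            ((hasFDerivWithinAt_id z S).add_const (η • e))
            (fun t ht => add_single_mem_halfSpace ht h0.le _)
          simpa [Function.comp_def] using this
        exact (h2.fun_sub (hsub hz3).2.2.2.2.1.hasFDerivWithinAt).fun_sub
          ((EuclideanSpace.proj 0 :
            EuclideanSpace ℝ (Fin (n + 1)) →L[ℝ] ℝ).hasFDerivWithinAt.const_mul (η * c))
      have hNpos : ∀ z ∈ slopeCone p r C, 0 < N z 0 := fun z hz =>
        (half_pos hN0).trans (hsub (hB z (hshift0 z hz)).2.2).2.1
      have hNslope : ∀ z ∈ slopeCone p r C, ∀ i : Fin n, |N z i.succ| ≤ C * N z 0 := by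
        intro z hz i
        obtain ⟨-, z2, z3, -⟩ := hsub (hB z (hshift0 z hz)).2.2
        have h2 : |N p i.succ| ≤ ∑ i, |N p i| :=
          Finset.single_le_sum (f := fun i => |N p i|) (fun i _ => abs_nonneg _)
            (Finset.mem_univ i.succ)
        have h3 : ∑ i, |N p i| + 1 = C * (m / 2) := by rw [hCdef]; field_simp
        have h4 := mul_le_mul_of_nonneg_left z2.le hC
        linarith [z3 i.succ]
      have hzero : ∀ z ∈ slopeCone p r C, z 0 = 0 → v (z + η • e) - v z - η * c * z 0 = 0 := by
        intro z hz hz0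
        obtain ⟨-, -, hw3⟩ := hB _ (hshift z hz η h0.le h1)
        obtain ⟨-, -, hz3⟩ := hB z (hshift0 z hz)
        rw [(hsub hw3).2.2.2.2.2.1 (by simp [hz0, he0]), (hsub hz3).2.2.2.2.2.1 hz0, hz0]
        ring
      have hproj : ∀ z, (EuclideanSpace.proj 0 : EuclideanSpace ℝ (Fin (n + 1)) →L[ℝ] ℝ) (N z)
          = N z 0 := fun z => rfl
      have up := le_mul_of_transport_lt hC hNpos hNslope hd (δ := η * δ)
        (fun z hz => by
          have := (abs_lt.1 (hmain z hz η h0 h1)).2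
          simpa [hproj] using this)
        (fun z hz hz0 => (hzero z hz hz0).le) z hz
      have dn := le_mul_of_transport_lt hC hNpos hNslope (fun z hz => (hd z hz).fun_neg)
        (δ := η * δ)
        (fun z hz => by
          have := (abs_lt.1 (hmain z hz η h0 h1)).1
          simp only [_root_.neg_apply, _root_.sub_apply,
            _root_.smul_apply, smul_eq_mul, hproj] at this ⊢
          linarith)
        (fun z hz hz0 => by simp [hzero z hz hz0]) z hz
      exact abs_le.2 ⟨by linarith, up⟩
    -- let the increment tend to zero
    have hlim : ∀ z ∈ slopeCone p r C, |pd S l.succ v z - c * z 0| ≤ δ * z 0 := by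
      intro z hz
      have hz3 := (hB z (hshift0 z hz)).2.2
      have h1 : HasDerivWithinAt (fun η : ℝ => v (z + η • e)) (pd S l.succ v z) (Set.Ici 0) 0 := by
        have h2 : HasDerivWithinAt (fun η : ℝ => z + η • e) e (Set.Ici 0) 0 := by
          simpa using ((hasDerivAt_id (0 : ℝ)).smul_const e).const_add z |>.hasDerivWithinAt
        have h3 : HasFDerivWithinAt v (dv z) S (z + (0 : ℝ) • e) := by
          simpa using (hsub hz3).2.2.2.2.1.hasFDerivWithinAt
        exact h3.comp_hasDerivWithinAt (0 : ℝ) h2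
          (fun η hη => add_single_mem_halfSpace (hconeS z hz) hη _)
      have h2 := (hasDerivWithinAt_iff_tendsto_slope' (Set.notMem_Ioi.2 le_rfl)).1
        (h1.mono Set.Ioi_subset_Ici_self)
      have h3 : Tendsto (fun η : ℝ => |slope (fun η : ℝ => v (z + η • e)) 0 η - c * z 0|)
          (𝓝[>] 0) (𝓝 |pd S l.succ v z - c * z 0|) := (h2.sub_const _).abs
      refine le_of_tendsto h3 ?_
      have h4 : ∀ᶠ η : ℝ in 𝓝[>] 0, η < ρ / 2 :=
        nhdsWithin_le_nhds (gt_mem_nhds (by positivity))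
      filter_upwards [h4, self_mem_nhdsWithin] with η h5 (h6 : 0 < η)
      have h7 := hincr z hz η h6 h5
      have h8 : slope (fun η : ℝ => v (z + η • e)) 0 η - c * z 0
          = η⁻¹ * (v (z + η • e) - v z - η * c * z 0) := by
        simp only [slope_def_field, zero_smul, add_zero, sub_zero]
        field_simp
      rw [h8, abs_mul, abs_of_pos (inv_pos.2 h6), inv_mul_le_iff₀ h6]
      linarith
    filter_upwards [slopeCone_mem_nhdsWithin hC hrpos hp] with z hz using hlim z hz
  have hp0 : pd S l.succ v p = 0 :=
    pd_succ_eq_zero hp (hv.differentiableWithinAt (by norm_num)) hface l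
  refine HasFDerivWithinAt.differentiableWithinAt
    (f' := c • (EuclideanSpace.proj 0 : EuclideanSpace ℝ (Fin (n + 1)) →L[ℝ] ℝ)) ?_
  rw [hasFDerivWithinAt_iff_isLittleO, Asymptotics.isLittleO_iff]
  intro δ hδ
  filter_upwards [key δ hδ, self_mem_nhdsWithin] with z hz hzS
  have h2 : 0 ≤ z 0 := mem_halfSpace.1 hzS
  have h3 : z 0 ≤ ‖z - p‖ := by
    have := PiLp.norm_apply_le (z - p) 0
    simpa [hp, abs_of_nonneg h2] using this
  have h4 : (c • (EuclideanSpace.proj 0 : EuclideanSpace ℝ (Fin (n + 1)) →L[ℝ] ℝ)) (z - p)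
      = c * z 0 := by simp [hp]
  rw [hp0, h4, sub_zero, Real.norm_eq_abs]
  exact hz.trans (mul_le_mul_of_nonneg_left h3 hδ.le)

end Transport

/-! ### Special boundary defining functions in a half-space -/

section Boundary

/-- A special boundary defining function in coordinates: `u` vanishes on the face of the
half-space. -/
structure IsSpecialBdfOn (n : ℕ) (V : Set (EuclideanSpace ℝ (Fin (n + 1))))
    (a : EuclideanSpace ℝ (Fin (n + 1)) → Matrix (Fin (n + 1)) (Fin (n + 1)) ℝ)
    (u : EuclideanSpace ℝ (Fin (n + 1)) → ℝ) : Prop extends IsSpecialOn (halfSpace n) V a u where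
  nonneg : ∀ z ∈ V, 0 ≤ u z
  eq_zero : ∀ z ∈ V, z 0 = 0 → u z = 0

variable {n : ℕ} {V : Set (EuclideanSpace ℝ (Fin (n + 1)))}
  {a a' : EuclideanSpace ℝ (Fin (n + 1)) → Matrix (Fin (n + 1)) (Fin (n + 1)) ℝ}
  {u u' φ : EuclideanSpace ℝ (Fin (n + 1)) → ℝ} {p : EuclideanSpace ℝ (Fin (n + 1))}

namespace IsSpecialBdfOn

lemma pd_succ (hV : IsChartDomain (halfSpace n) V) (h : IsSpecialBdfOn n V a u) (hp : p ∈ V)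
    (hp0 : p 0 = 0) (i : Fin n) : pd (halfSpace n) i.succ u p = 0 :=
  pd_succ_eq_zero hp0 ((h.contDiff_fun p hp).differentiableWithinAt (by norm_num))
    (hV.eventually hp h.eq_zero) i

/-- The gradient points into the half-space. -/
lemma grad_zero_pos (hV : IsChartDomain (halfSpace n) V) (h : IsSpecialBdfOn n V a u) (hp : p ∈ V)
    (hp0 : p 0 = 0) : 0 < cGrad (halfSpace n) a u p 0 := by
  have h1 := h.sum_grad_mul_pd hp
  rw [Fin.sum_univ_succ] at h1
  simp only [h.pd_succ hV hp hp0, mul_zero, Finset.sum_const_zero, add_zero] at h1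
  have h2 : 0 ≤ pd (halfSpace n) 0 u p := by
    have hmin : IsLocalMinOn u (halfSpace n) p := by
      refine hV.eventually hp fun z hz => ?_
      rw [h.eq_zero p hp hp0]; exact h.nonneg z hz
    refine hmin.fderivWithin_nonneg (mem_posTangentConeAt_of_segment_subset ?_)
    refine convex_halfSpace.segment_subset (hV.subset hp) ?_
    simpa using add_single_mem_halfSpace (hV.subset hp) zero_le_one 0
  by_contra! hcon
  nlinarith

/-- The second derivatives of a special boundary defining function of class `C²` are differentiable
at the boundary: the tangential ones by the transport equation of the first derivatives, the others
because that equation expresses them by the tangential ones. -/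
theorem differentiableWithinAt_pd_pd (hV : IsChartDomain (halfSpace n) V)
    (h : IsSpecialBdfOn n V a u) (hp : p ∈ V) (hp0 : p 0 = 0) (i j : Fin (n + 1)) :
    DifferentiableWithinAt ℝ (pd (halfSpace n) i (pd (halfSpace n) j u)) (halfSpace n) p := by
  set S := halfSpace n with hS
  set F : Fin (n + 1) → EuclideanSpace ℝ (Fin (n + 1)) → ℝ := fun i z => (1 / 2) * ∑ k, ∑ l,
    pd S i (fun z => a z k l) z * cGrad S a u z k * cGrad S a u z l with hFdef
  have hF : ∀ i, ContDiffWithinAt ℝ 1 (F i) S p := fun i =>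
    contDiffWithinAt_const.mul (ContDiffWithinAt.sum fun k _ => ContDiffWithinAt.sum fun l _ =>
      ((hV.contDiff_pd hp (h.contDiff p hp k l) i).mul (h.contDiff_grad hV hp k)).mul
        (h.contDiff_grad hV hp l))
  have hN0 := h.grad_zero_pos hV hp hp0
  have hFd : ∀ i, DifferentiableWithinAt ℝ (F i) S p := fun i =>
    (hF i).differentiableWithinAt (by norm_num)
  -- the tangential derivatives of `u` vanish on the face, which is what the transport theorem needs
  have htt : ∀ k l : Fin n, DifferentiableWithinAt ℝ (pd S l.succ (pd S k.succ u)) S p := by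
    intro k l
    refine differentiableWithinAt_pd_of_transport (N := fun z => WithLp.toLp 2 (cGrad S a u z))
      (F := F k.succ) hp0 (hV.contDiff_pd hp (h.contDiff_fun p hp) k.succ) (hF _) ?_ hN0 ?_ ?_ l
    · rw [contDiffWithinAt_euclidean]
      exact fun i => h.contDiff_grad hV hp i
    · exact hV.eventually hp fun z hz hz0 => h.pd_succ hV hz hz0 k
    · refine hV.eventually hp fun z hz => ?_
      rw [clm_apply_eq_sum]
      exact h.transport hV hz k.succ
  -- the transport equation, solved for the normal derivative
  have hnormal : ∀ k, (∀ l : Fin n, DifferentiableWithinAt ℝ (pd S l.succ (pd S k u)) S p) →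
      DifferentiableWithinAt ℝ (pd S 0 (pd S k u)) S p := by
    intro k hk
    have h1 : DifferentiableWithinAt ℝ (fun z => (F k z - ∑ l : Fin n,
        cGrad S a u z l.succ * pd S l.succ (pd S k u) z) * (cGrad S a u z 0)⁻¹) S p :=
      ((hFd k).sub (DifferentiableWithinAt.fun_sum fun l _ =>
        (h.diff_grad hV hp l.succ).mul (hk l))).mul ((h.diff_grad hV hp 0).inv hN0.ne')
    have hne : ∀ᶠ z in 𝓝[S] p, 0 < cGrad S a u z 0 :=
      (h.diff_grad hV hp 0).continuousWithinAt.eventually (lt_mem_nhds hN0)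
    have h2 : ∀ z ∈ V, 0 < cGrad S a u z 0 → pd S 0 (pd S k u) z = (F k z - ∑ l : Fin n,
        cGrad S a u z l.succ * pd S l.succ (pd S k u) z) * (cGrad S a u z 0)⁻¹ := by
      intro z hz hz0
      have h3 := h.transport hV hz k
      rw [Fin.sum_univ_succ] at h3
      rw [hFdef]
      simp only
      rw [← h3, add_sub_cancel_right, mul_comm, ← mul_assoc, inv_mul_cancel₀ hz0.ne', one_mul]
    refine h1.congr_of_eventuallyEq ?_ (h2 p hp hN0)
    filter_upwards [hV.mem_nhdsWithin p hp, hne] with z hz hz0 using h2 z hz hz0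
  have hcomm : ∀ i j, DifferentiableWithinAt ℝ (pd S i (pd S j u)) S p →
      DifferentiableWithinAt ℝ (pd S j (pd S i u)) S p := fun i j hij =>
    hij.congr_of_eventuallyEq
      (hV.eventually hp fun z hz => hV.pd_comm hz (h.contDiff_fun z hz) j i)
      (hV.pd_comm hp (h.contDiff_fun p hp) j i)
  have h0s : ∀ k : Fin n, DifferentiableWithinAt ℝ (pd S 0 (pd S k.succ u)) S p := fun k =>
    hnormal _ fun l => htt k l
  have hs0 : ∀ k : Fin n, DifferentiableWithinAt ℝ (pd S k.succ (pd S 0 u)) S p := fun k =>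
    hcomm _ _ (h0s k)
  refine Fin.cases ?_ (fun i => ?_) i
  · exact Fin.cases (hnormal 0 hs0) h0s j
  · exact Fin.cases (hs0 i) (fun j => htt j i) j

lemma differentiableWithinAt_cHess (hV : IsChartDomain (halfSpace n) V)
    (h : IsSpecialBdfOn n V a u) (hp : p ∈ V) (hp0 : p 0 = 0) (i j : Fin (n + 1)) :
    DifferentiableWithinAt ℝ (fun z => cHess (halfSpace n) a u z i j) (halfSpace n) p := by
  refine (h.differentiableWithinAt_pd_pd hV hp hp0 i j).sub
    (DifferentiableWithinAt.fun_sum fun k _ => DifferentiableWithinAt.mul ?_ (h.diff_pd hV hp k))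
  have hd : ∀ k i j, DifferentiableWithinAt ℝ (pd (halfSpace n) k (fun z => a z i j))
      (halfSpace n) p := fun k i j =>
    (hV.contDiff_pd hp (h.contDiff p hp i j) k).differentiableWithinAt (by norm_num)
  exact (DifferentiableWithinAt.fun_sum fun l _ =>
    (h.diff_inv hp k l).mul (((hd _ _ _).add (hd _ _ _)).sub (hd _ _ _))).const_mul _

lemma differentiableWithinAt_cLaplacian (hV : IsChartDomain (halfSpace n) V)
    (h : IsSpecialBdfOn n V a u) (hp : p ∈ V) (hp0 : p 0 = 0) :
    DifferentiableWithinAt ℝ (cLaplacian (halfSpace n) a u) (halfSpace n) p := by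
  change DifferentiableWithinAt ℝ (fun z => tr (a z) (cHess (halfSpace n) a u z)) _ p
  simp only [tr, Matrix.trace, Matrix.diag, Matrix.mul_apply]
  exact DifferentiableWithinAt.fun_sum fun i _ => DifferentiableWithinAt.fun_sum fun k _ =>
    (h.diff_inv hp i k).mul (h.differentiableWithinAt_cHess hV hp hp0 k i)

end IsSpecialBdfOn

lemma IsMetricOn.continuousWithinAt_cLaplacian {d : ℕ} {S V : Set (EuclideanSpace ℝ (Fin d))}
    {a : EuclideanSpace ℝ (Fin d) → Matrix (Fin d) (Fin d) ℝ}
    {w : EuclideanSpace ℝ (Fin d) → ℝ} {p : EuclideanSpace ℝ (Fin d)} (hV : IsChartDomain S V)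
    (ha : IsMetricOn S V a) (hp : p ∈ V) (hw : ContDiffWithinAt ℝ 2 w S p) :
    ContinuousWithinAt (cLaplacian S a w) S p := by
  have hd : ∀ k i j, ContinuousWithinAt (pd S k (fun z => a z i j)) S p := fun k i j =>
    (hV.contDiff_pd hp (ha.contDiff p hp i j) k).continuousWithinAt
  have hi : ∀ i j, ContinuousWithinAt (fun z => (a z)⁻¹ i j) S p := fun i j =>
    (ha.contDiff_inv hp i j).continuousWithinAt
  have hw2 : ∀ i j, ContinuousWithinAt (pd S i (pd S j w)) S p := fun i j =>
    ((hV.contDiff_pd hp hw j).fderivWithin_right_apply (m := 0)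
      (contDiffWithinAt_const (c := EuclideanSpace.single i (1 : ℝ))) hV.uniqueDiffOn
      (by norm_num) (hV.subset hp)).continuousWithinAt
  have hH : ∀ i j, ContinuousWithinAt (fun z => cHess S a w z i j) S p := fun i j =>
    (hw2 i j).sub (tendsto_finsetSum _ fun k _ =>
      (continuousWithinAt_const.mul (tendsto_finsetSum _ fun l _ =>
        (hi k l).mul (((hd _ _ _).add (hd _ _ _)).sub (hd _ _ _)))).mul
        (hV.contDiff_pd hp hw k).continuousWithinAt)
  change ContinuousWithinAt (fun z => tr (a z) (cHess S a w z)) S p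
  simp only [tr, Matrix.trace, Matrix.diag, Matrix.mul_apply]
  exact tendsto_finsetSum _ fun i _ => tendsto_finsetSum _ fun k _ => (hi i k).mul (hH k i)

namespace IsSpecialPair

/-- The normal derivatives at the boundary of the Laplacians of two special boundary defining
functions. In `Δ'u' = e^{-φ}(Δu + u Q)` the factor `Q` is only continuous, but `u` vanishes at the
boundary. -/
lemma sum_grad_mul_pd_cLaplacian (hV : IsChartDomain (halfSpace n) V)
    (h : IsSpecialPair (halfSpace n) V a a' u u' φ) (hu : IsSpecialBdfOn n V a u)
    (hp : p ∈ V) (hp0 : p 0 = 0) :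
    ∑ k, cGrad (halfSpace n) a' u' p k * pd (halfSpace n) k (cLaplacian (halfSpace n) a' u') p
      = Real.exp (-(2 * φ p)) *
        (∑ k, cGrad (halfSpace n) a u p k * pd (halfSpace n) k (cLaplacian (halfSpace n) a u) p
          + cLaplacian (halfSpace n) a φ p
          + ((n : ℝ) - 1) / 2 * cGradSq (halfSpace n) a φ p) := by
  set S := halfSpace n
  set L := cLaplacian S a u
  set Q : EuclideanSpace ℝ (Fin (n + 1)) → ℝ := fun z =>
    cLaplacian S a φ z + (((n + 1 : ℕ) : ℝ) - 2) / 2 * cGradSq S a φ z with hQ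
  have hup : u p = 0 := hu.eq_zero p hp hp0
  have hs := hV.unique hp
  have hQc : ContinuousWithinAt Q S p :=
    (hu.continuousWithinAt_cLaplacian hV hp (h.contDiff p hp)).add
      (continuousWithinAt_const.mul (h.continuousWithinAt_gradSq hV hp))
  have hLd : DifferentiableWithinAt ℝ L S p := hu.differentiableWithinAt_cLaplacian hV hp hp0
  have huQ : HasFDerivWithinAt (fun z => u z * Q z) (Q p • fderivWithin ℝ u S p) S p := by
    have h1 := (h.diff_fun hp).hasFDerivWithinAt
    have h2 : HasFDerivWithinAt (fun z => Q p * u z) (Q p • fderivWithin ℝ u S p) S p :=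
      h1.const_mul (Q p)
    have h3 : HasFDerivWithinAt (fun z => (Q z - Q p) * u z)
        (0 : EuclideanSpace ℝ (Fin (n + 1)) →L[ℝ] ℝ) S p := by
      rw [hasFDerivWithinAt_iff_isLittleO]
      have h4 : (fun z => Q z - Q p) =o[𝓝[S] p] (fun _ => (1 : ℝ)) := by
        rw [Asymptotics.isLittleO_one_iff]
        simpa using hQc.tendsto.sub_const (Q p)
      have h5 : (fun z => u z - u p) =O[𝓝[S] p] (fun z => z - p) := h1.isBigO_sub
      simpa [hup] using h4.mul_isBigO h5.norm_right
    refine ((h2.fun_add h3).congr_fderiv (add_zero _)).congr (fun z _ => by ring) (by ring)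
  have hpd : ∀ k, pd S k (cLaplacian S a' u') p
      = Real.exp (-φ p) * (-pd S k φ p * L p + (pd S k L p + Q p * pd S k u p)) := by
    intro k
    have e1 : pd S k (fun z => u z * Q z) p = Q p * pd S k u p := by
      rw [pd_eq_of_hasFDerivWithinAt hs huQ]; rfl
    have e2 : pd S k (fun z => -φ z) p = -pd S k φ p := by
      rw [pd_eq_of_hasFDerivWithinAt hs (h.diff hp).hasFDerivWithinAt.fun_neg]; rfl
    rw [hV.pd_congr hp (f' := fun z => Real.exp (-φ z) * (L z + u z * Q z))
        (fun z hz => h.cLaplacian_fun hV hz),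
      pd_exp_mul hs (h.diff hp).fun_neg (hLd.fun_add huQ.differentiableWithinAt),
      pd_add hs hLd huQ.differentiableWithinAt, e1, hup, e2]
    ring
  have he : Real.exp (-(2 * φ p)) = Real.exp (-φ p) * Real.exp (-φ p) := by
    rw [← Real.exp_add]; ring_nf
  have hB := h.sum_grad_mul_pd hV hp
  rw [hup, zero_mul, mul_zero] at hB
  have h1 := hu.sum_grad_mul_pd hp
  calc _ = Real.exp (-φ p) * Real.exp (-φ p) * (-L p * (∑ k, cGrad S a u p k * pd S k φ p)
        + ∑ k, cGrad S a u p k * pd S k L p + Q p * ∑ k, cGrad S a u p k * pd S k u p) := by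
        simp only [Finset.mul_sum, ← Finset.sum_add_distrib, h.cGrad_fun hV hp, hpd, hup]
        exact Finset.sum_congr rfl fun k _ => by ring
    _ = _ := by
        rw [hB, h1, he, hQ]
        push_cast
        ring

end IsSpecialPair

/-! ### The Laplacian of the boundary -/

section BoundaryLaplacian

variable {b : EuclideanSpace ℝ (Fin n) → Matrix (Fin n) (Fin n) ℝ}
  {f : EuclideanSpace ℝ (Fin n) → ℝ} {y : EuclideanSpace ℝ (Fin n)}

lemma isChartDomain_face (hV : IsChartDomain (halfSpace n) V) :
    IsChartDomain Set.univ (face ⁻¹' V) where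
  uniqueDiffOn := uniqueDiffOn_univ
  subset_closure := by simp
  subset := Set.subset_univ _
  mem_nhdsWithin y hy := by
    rw [nhdsWithin_univ]
    exact tendsto_face y (hV.mem_nhdsWithin _ hy)

lemma contDiffWithinAt_comp_face {w : EuclideanSpace ℝ (Fin (n + 1)) → ℝ}
    (hw : ContDiffWithinAt ℝ 2 w (halfSpace n) (face y)) :
    ContDiffWithinAt ℝ 2 (fun z => w (face z)) Set.univ y :=
  hw.comp y (faceL n).contDiff.contDiffWithinAt fun z _ => face_mem_halfSpace z

lemma isMetricOn_face (hV : IsChartDomain (halfSpace n) V) (ha : IsMetricOn (halfSpace n) V a)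
    (hb : ∀ z, face z ∈ V → b z = (a (face z)).submatrix Fin.succ Fin.succ) :
    IsMetricOn Set.univ (face ⁻¹' V) b where
  posDef z hz := by
    rw [hb z hz]
    exact (ha.posDef _ hz).submatrix (Fin.succ_injective n)
  contDiff z hz i j := by
    refine (contDiffWithinAt_comp_face (ha.contDiff _ hz i.succ j.succ)).congr_of_eventuallyEq
      ((isChartDomain_face hV).eventually hz fun t ht => ?_) ?_
    · exact congr_fun₂ (hb t ht) i j
    · exact congr_fun₂ (hb z hz) i j

lemma pd_pd_face (hV : IsChartDomain (halfSpace n) V)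
    (hφ : ∀ z ∈ V, ContDiffWithinAt ℝ 2 φ (halfSpace n) z)
    (hf : ∀ z, face z ∈ V → f z = φ (face z)) (hy : face y ∈ V) (i j : Fin n) :
    pd Set.univ i (pd Set.univ j f) y = pd (halfSpace n) i.succ (pd (halfSpace n) j.succ φ)
      (face y) := by
  have hW := isChartDomain_face hV
  have h1 : ∀ z, face z ∈ V → pd Set.univ j f z = pd (halfSpace n) j.succ φ (face z) := by
    intro z hz
    rw [hW.pd_congr hz (f' := fun z => φ (face z)) hf,
      pd_face ((hφ _ hz).differentiableWithinAt (by norm_num))]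
  rw [hW.pd_congr hy (f' := fun z => pd (halfSpace n) j.succ φ (face z)) h1,
    pd_face ((hV.contDiff_pd hy (hφ _ hy) j.succ).differentiableWithinAt (by norm_num))]

/-- The derivative of `Nφ` along `N` is the second covariant derivative of `φ` in the direction of
`N`, since the integral curves of `N` are geodesics. -/
lemma IsSpecialOn.sum_mul_pd_sum {d : ℕ} {S V : Set (EuclideanSpace ℝ (Fin d))}
    {a : EuclideanSpace ℝ (Fin d) → Matrix (Fin d) (Fin d) ℝ}
    {u φ : EuclideanSpace ℝ (Fin d) → ℝ} {p : EuclideanSpace ℝ (Fin d)}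
    (hV : IsChartDomain S V) (h : IsSpecialOn S V a u) (hp : p ∈ V)
    (hφ : ContDiffWithinAt ℝ 2 φ S p) :
    ∑ k, cGrad S a u p k * pd S k (fun z => ∑ i, cGrad S a u z i * pd S i φ z) p
      = ∑ i, ∑ j, cGrad S a u p i * cGrad S a u p j * pd S i (pd S j φ) p
        - ∑ l, cGrad S a φ p l * ∑ i, ∑ j, cGrad S a u p i * cGrad S a u p j
          * (pd S i (fun z => a z j l) p - 1 / 2 * pd S l (fun z => a z i j) p) := by
  set N := cGrad S a u
  have hd : ∀ i, DifferentiableWithinAt ℝ (fun z => N z i) S p := h.diff_grad hV hp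
  have hφd : ∀ i, DifferentiableWithinAt ℝ (pd S i φ) S p := fun i =>
    (hV.contDiff_pd hp hφ i).differentiableWithinAt (by norm_num)
  -- `∇_N N = 0`
  have hgeo : ∀ l, ∑ k, N p k * ∑ i, a p l i * pd S k (fun z => N z i) p
      = - ∑ i, ∑ j, N p i * N p j
        * (pd S i (fun z => a z j l) p - 1 / 2 * pd S l (fun z => a z i j) p) := by
    intro l
    have ht := h.transport hV hp l
    simp only [N, h.pd_lower hV hp (h.contDiff_fun p hp), mul_sub, Finset.sum_sub_distrib]
    rw [ht]
    simp only [Finset.mul_sum]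
    rw [neg_sub]
    congr 1
    · exact Finset.sum_congr rfl fun i _ => Finset.sum_congr rfl fun j _ => by ring
    · exact Finset.sum_congr rfl fun i _ => Finset.sum_congr rfl fun j _ => by
        rw [h.pd_symm hV hp i j l]; ring
  have h1 : ∑ k, N p k * ∑ i, pd S k (fun z => N z i) p * pd S i φ p
      = ∑ l, cGrad S a φ p l * ∑ k, N p k * ∑ i, a p l i * pd S k (fun z => N z i) p := by
    have : ∀ i, pd S i φ p = ∑ l, a p i l * cGrad S a φ p l := fun i => (h.sum_mul_cGrad hp i).symm
    simp only [this, Finset.mul_sum]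
    rw [Finset.sum_congr rfl fun k _ => Finset.sum_comm, Finset.sum_comm]
    exact Finset.sum_congr rfl fun l _ => Finset.sum_congr rfl fun k _ =>
      Finset.sum_congr rfl fun i _ => by rw [h.symm hp i l]; ring
  have h2 : ∀ k, pd S k (fun z => ∑ i, N z i * pd S i φ z) p
      = ∑ i, pd S k (fun z => N z i) p * pd S i φ p + ∑ i, N p i * pd S k (pd S i φ) p := fun k => by
    rw [pd_sum_mul (hV.unique hp) hd hφd, Finset.sum_add_distrib]
  simp only [h2, mul_add, Finset.sum_add_distrib, h1, hgeo]
  simp only [Finset.mul_sum, mul_neg, Finset.sum_neg_distrib, mul_assoc]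
  ring

variable (hV : IsChartDomain (halfSpace n) V)
  (h : IsSpecialPair (halfSpace n) V a a' u u' φ) (hu : IsSpecialBdfOn n V a u)
  (hb : ∀ z, face z ∈ V → b z = (a (face z)).submatrix Fin.succ Fin.succ)
  (hf : ∀ z, face z ∈ V → f z = φ (face z)) (hy : face y ∈ V)

include hV h hu hb hf hy

/-- The normal derivative of `φ` vanishes at the boundary, so that only the tangential part of its
differential contributes to the norm. -/
lemma cGradSq_face : cGradSq Set.univ b f y = cGradSq (halfSpace n) a φ (face y) := by
  have hW := isChartDomain_face hV
  have h1 : ∀ i, pd Set.univ i f y = pd (halfSpace n) i.succ φ (face y) := fun i => by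
    rw [hW.pd_congr hy (f' := fun z => φ (face z)) hf, pd_face (h.diff hy)]
  have hB := h.sum_grad_mul_pd hV hy
  rw [hu.eq_zero _ hy (face_zero y), zero_mul, mul_zero] at hB
  have hsum := sum_inv_submatrix_succ (hu.isUnit_det hy) (hu.isSymm hy)
    (hu.mulVec_grad_succ hy (hu.pd_succ hV hy (face_zero y))) (hu.sum_grad_mul_mulVec hy)
    fun i j => pd (halfSpace n) i φ (face y) * pd (halfSpace n) j φ (face y)
  simp only [cGradSq, h1, hb y hy, mul_assoc]
  rw [hsum]
  have h2 : ∑ i, ∑ j, cGrad (halfSpace n) a u (face y) i * cGrad (halfSpace n) a u (face y) j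
      * (pd (halfSpace n) i φ (face y) * pd (halfSpace n) j φ (face y)) = 0 := by
    calc _ = (∑ i, cGrad (halfSpace n) a u (face y) i * pd (halfSpace n) i φ (face y))
          * ∑ j, cGrad (halfSpace n) a u (face y) j * pd (halfSpace n) j φ (face y) := by
          rw [Finset.sum_mul_sum]
          exact Finset.sum_congr rfl fun i _ => Finset.sum_congr rfl fun j _ => by ring
      _ = 0 := by rw [hB, zero_mul]
  simp only [sub_mul, Finset.sum_sub_distrib]
  rw [h2, sub_zero]

/-- The Laplacian of the boundary metric, in terms of that of the ambient metric; the normal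
derivative of `φ` vanishes, and its second normal derivative is given by the eikonal equations. -/
lemma cLaplacian_face : cLaplacian Set.univ b f y
    = cLaplacian (halfSpace n) a φ (face y) + 1 / 2 * cGradSq (halfSpace n) a φ (face y) := by
  set S := halfSpace n with hS
  set p := face y with hpdef
  have hp0 : p 0 = 0 := face_zero y
  have hW := isChartDomain_face hV
  have hbm := isMetricOn_face hV hu.toIsMetricOn hb
  have hup : u p = 0 := hu.eq_zero _ hy hp0
  set N := cGrad S a u p with hN
  have hB := h.sum_grad_mul_pd hV hy
  rw [hup, zero_mul, mul_zero] at hB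
  have h1 : ∀ i, pd Set.univ i f y = pd S i.succ φ p := fun i => by
    rw [hW.pd_congr hy (f' := fun z => φ (face z)) hf, pd_face (h.diff hy)]
  have h2 : ∀ k i j, pd Set.univ k (fun z => b z i j) y
      = pd S k.succ (fun z => a z i.succ j.succ) p := fun k i j => by
    rw [hW.pd_congr hy (f' := fun z => a (face z) i.succ j.succ) (fun z hz => by rw [hb z hz]; rfl)]
    exact pd_face (hu.diff hy _ _) k
  have hsum := sum_inv_submatrix_succ (hu.isUnit_det hy) (hu.isSymm hy)
    (hu.mulVec_grad_succ hy (hu.pd_succ hV hy hp0)) (hu.sum_grad_mul_mulVec hy)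
  set q : Fin (n + 1) → ℝ := fun l => ∑ i, ∑ j, ((a p)⁻¹ i j - N i * N j)
    * (pd S i (fun z => a z j l) p - 1 / 2 * pd S l (fun z => a z i j) p) with hq
  have e1 : cLaplacian Set.univ b f y = ∑ i, ∑ j, ((a p)⁻¹ i j - N i * N j)
        * pd S i (pd S j φ) p
      - ∑ l, ∑ m, ((a p)⁻¹ l m - N l * N m) * (pd S m φ p * q l) := by
    rw [hbm.cLaplacian_eq hy, ← hsum fun i j => pd S i (pd S j φ) p,
      ← hsum fun l m => pd S m φ p * q l, hb y hy]
    congr 1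
    · exact Finset.sum_congr rfl fun i _ => Finset.sum_congr rfl fun j _ => by
        rw [pd_pd_face hV h.contDiff hf hy]
    · refine Finset.sum_congr rfl fun l _ => ?_
      have e2 := hsum fun i j =>
        (pd S i (fun z => a z j l.succ) p - 1 / 2 * pd S l.succ (fun z => a z i j) p)
      simp only [h2, cGrad, h1, hb y hy]
      rw [e2, Finset.sum_mul]
      exact Finset.sum_congr rfl fun m _ => by rw [mul_assoc]
  clear_value q
  have e3 : ∑ l, ∑ m, ((a p)⁻¹ l m - N l * N m) * (pd S m φ p * q l)
      = ∑ l, cGrad S a φ p l * q l := by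
    refine Finset.sum_congr rfl fun l _ => ?_
    calc _ = ((∑ m, (a p)⁻¹ l m * pd S m φ p) - N l * ∑ m, N m * pd S m φ p) * q l := by
          rw [Finset.mul_sum, ← Finset.sum_sub_distrib, Finset.sum_mul]
          exact Finset.sum_congr rfl fun m _ => by ring
      _ = _ := by rw [hB, mul_zero, sub_zero]; rfl
  have e4 := hu.sum_mul_pd_sum hV hy (h.contDiff p hy)
  have hG : DifferentiableWithinAt ℝ (cGradSq S a φ) S p := by
    refine DifferentiableWithinAt.fun_sum fun i _ => DifferentiableWithinAt.fun_sum fun j _ => ?_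
    have hφd : ∀ i, DifferentiableWithinAt ℝ (pd S i φ) S p := fun i =>
      (hV.contDiff_pd hy (h.contDiff p hy) i).differentiableWithinAt (by norm_num)
    exact ((hu.diff_inv hy i j).mul (hφd i)).mul (hφd j)
  have e5 : ∑ k, N k * pd S k (fun z => ∑ i, cGrad S a u z i * pd S i φ z) p
      = -(1 / 2) * cGradSq S a φ p := by
    have e6 : ∀ k, pd S k (fun z => ∑ i, cGrad S a u z i * pd S i φ z) p
        = -(1 / 2) * cGradSq S a φ p * pd S k u p := fun k => by
      rw [hV.pd_congr hy (fun z hz => h.sum_grad_mul_pd hV hz),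
        pd_mul (hV.unique hy) (differentiableWithinAt_const _) ((h.diff_fun hy).fun_mul hG), pd_const,
        pd_mul (hV.unique hy) (h.diff_fun hy) hG, hup]
      ring
    simp only [e6, mul_left_comm (N _), ← Finset.mul_sum]
    rw [hN, hu.sum_grad_mul_pd hy, mul_one]
  rw [← hN, e5] at e4
  rw [e1, e3, hu.cLaplacian_eq hy]
  simp only [hq, sub_mul, mul_sub, Finset.sum_sub_distrib] at e4 ⊢
  linarith

end BoundaryLaplacian

end Boundary

/-! ### Reading a manifold with boundary in a chart -/

section Charts

variable {n : ℕ} {M : Type*} [TopologicalSpace M] [ChartedSpace (EuclideanHalfSpace (n + 1)) M]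
  {U : Set M} {p : M} {y : EuclideanSpace ℝ (Fin (n + 1))}

/-- The part of `U` covered by the chart around `p`, in coordinates. -/
def chartPart (U : Set M) (p : M) : Set (EuclideanSpace ℝ (Fin (n + 1))) :=
  (extChartAt (𝓡∂ (n + 1)) p).target ∩ (extChartAt (𝓡∂ (n + 1)) p).symm ⁻¹' U

lemma isChartDomain_chartPart (hU : IsOpen U) (p : M) :
    IsChartDomain (halfSpace n) (chartPart U p) where
  uniqueDiffOn := uniqueDiffOn_halfSpace
  subset_closure := halfSpace_subset_closure
  subset := Set.inter_subset_left.trans (extChartAt_target_subset_range p)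
  mem_nhdsWithin y hy := by
    have h1 : (extChartAt (𝓡∂ (n + 1)) p).target ∈ 𝓝[halfSpace n] y :=
      extChartAt_target_mem_nhdsWithin_of_mem hy.1
    have h2 : (extChartAt (𝓡∂ (n + 1)) p).symm ⁻¹' U ∈ 𝓝[halfSpace n] y := by
      have h3 := (continuousOn_extChartAt_symm p y hy.1).preimage_mem_nhdsWithin
        (hU.mem_nhds hy.2)
      exact nhdsWithin_le_of_mem h1 h3
    exact inter_mem h1 h2

@[simp] lemma symm_coordPt (p : M) :
    (extChartAt (𝓡∂ (n + 1)) p).symm (coordPt p) = p :=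
  extChartAt_to_inv p

lemma coordPt_mem_chartPart (hp : p ∈ U) : coordPt p ∈ chartPart (n := n) U p :=
  ⟨mem_extChartAt_target p, by rwa [Set.mem_preimage, symm_coordPt]⟩

@[simp] lemma coordFun_coordPt (p : M) (u : M → ℝ) : coordFun (n := n) p u (coordPt p) = u p := by
  rw [coordFun, symm_coordPt]

lemma frequently_pos (hy : y ∈ halfSpace n) : ∃ᶠ z in 𝓝[halfSpace n] y, 0 < z 0 := by
  have h1 : Tendsto (fun t : ℝ => y + t • EuclideanSpace.single 0 (1 : ℝ)) (𝓝[>] 0)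
      (𝓝[halfSpace n] y) := by
    refine tendsto_nhdsWithin_iff.2 ⟨?_, ?_⟩
    · have : Continuous fun t : ℝ => y + t • EuclideanSpace.single (0 : Fin (n + 1)) (1 : ℝ) := by
        fun_prop
      exact (this.tendsto' 0 y (by simp)).mono_left nhdsWithin_le_nhds
    · filter_upwards [self_mem_nhdsWithin] with t (ht : 0 < t)
      exact add_single_mem_halfSpace hy ht.le 0
  refine h1.frequently (Eventually.frequently ?_)
  filter_upwards [self_mem_nhdsWithin] with t (ht : 0 < t)
  simpa using add_pos_of_nonneg_of_pos (mem_halfSpace.1 hy) ht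

lemma isChartDomain_pos {V : Set (EuclideanSpace ℝ (Fin (n + 1)))}
    (hV : IsChartDomain (halfSpace n) V) :
    IsChartDomain (halfSpace n) (V ∩ {z | 0 < z 0}) where
  uniqueDiffOn := hV.uniqueDiffOn
  subset_closure := hV.subset_closure
  subset := Set.inter_subset_left.trans hV.subset
  mem_nhdsWithin z hz := inter_mem (hV.mem_nhdsWithin z hz.1) <| nhdsWithin_le_nhds <|
    (isOpen_lt continuous_const (EuclideanSpace.proj (𝕜 := ℝ) (0 : Fin (n + 1))).continuous).mem_nhds
      hz.2

variable [IsManifold (𝓡∂ (n + 1)) ∞ M]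

/-- The interior of the manifold, in any chart. -/
lemma symm_mem_interior_iff (hy : y ∈ (extChartAt (𝓡∂ (n + 1)) p).target) :
    (extChartAt (𝓡∂ (n + 1)) p).symm y ∈ (𝓡∂ (n + 1)).interior M ↔ 0 < y 0 := by
  have hint : interior (halfSpace n) = {y | 0 < y 0} :=
    interior_range_modelWithCornersEuclideanHalfSpace _
  have hsrc : (extChartAt (𝓡∂ (n + 1)) p).symm y ∈ (chartAt (EuclideanHalfSpace (n + 1)) p).source := by
    rw [← extChartAt_source (I := 𝓡∂ (n + 1))]
    exact (extChartAt (𝓡∂ (n + 1)) p).map_target hy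
  have h1 := (𝓡∂ (n + 1)).isInteriorPoint_iff_of_mem_atlas (n := ∞) (by simp)
    (chart_mem_atlas (EuclideanHalfSpace (n + 1)) p) hsrc
  have h2 : ((chartAt (EuclideanHalfSpace (n + 1)) p).extend (𝓡∂ (n + 1)))
      ((extChartAt (𝓡∂ (n + 1)) p).symm y) = y := (extChartAt (𝓡∂ (n + 1)) p).right_inv hy
  rw [h2] at h1
  refine h1.trans ⟨fun h => ?_, fun h => ?_⟩
  · have : y ∈ interior (halfSpace n) :=
      interior_mono (extChartAt_target_subset_range (I := 𝓡∂ (n + 1)) p) h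
    rw [hint] at this
    exact this
  · rw [mem_interior_iff_mem_nhds]
    have h3 : halfSpace n ∈ 𝓝 y := by
      rw [← mem_interior_iff_mem_nhds, hint]; exact h
    have h4 : (extChartAt (𝓡∂ (n + 1)) p).target ∈ 𝓝[halfSpace n] y :=
      extChartAt_target_mem_nhdsWithin_of_mem hy
    rw [nhdsWithin_eq_nhds.2 h3] at h4
    exact h4

lemma symm_mem_boundary_iff (hy : y ∈ (extChartAt (𝓡∂ (n + 1)) p).target) :
    (extChartAt (𝓡∂ (n + 1)) p).symm y ∈ (𝓡∂ (n + 1)).boundary M ↔ y 0 = 0 := by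
  have h0 : 0 ≤ y 0 := mem_halfSpace.1 (extChartAt_target_subset_range p hy)
  rw [← (𝓡∂ (n + 1)).compl_interior, Set.mem_compl_iff, symm_mem_interior_iff hy, not_lt]
  exact ⟨fun h => le_antisymm h h0, fun h => h.le⟩

lemma contDiffWithinAt_coordFun (hU : IsOpen U) {u : M → ℝ}
    (hu : ContMDiffOn (𝓡∂ (n + 1)) 𝓘(ℝ, ℝ) 2 u U) (hy : y ∈ chartPart U p) :
    ContDiffWithinAt ℝ 2 (coordFun p u) (halfSpace n) y := by
  have h1 : ContMDiffOn 𝓘(ℝ, EuclideanSpace ℝ (Fin (n + 1))) (𝓡∂ (n + 1)) 2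
      (extChartAt (𝓡∂ (n + 1)) p).symm (chartPart U p) :=
    ((contMDiffOn_extChartAt_symm (n := ∞) p).of_le (by norm_cast)).mono
      Set.inter_subset_left
  have h2 := hu.comp h1 fun z hz => hz.2
  exact (h2.contDiffOn y hy).mono_of_mem_nhdsWithin ((isChartDomain_chartPart hU p).mem_nhdsWithin y hy)

/-- The derivative of a map in coordinates. -/
lemma fderivWithin_comp_symm {F : Type*} [NormedAddCommGroup F] [NormedSpace ℝ F] {f : M → F}
    (hy : y ∈ (extChartAt (𝓡∂ (n + 1)) p).target)
    (hf : MDifferentiableAt (𝓡∂ (n + 1)) 𝓘(ℝ, F) f ((extChartAt (𝓡∂ (n + 1)) p).symm y))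
    (i : Fin (n + 1)) :
    fderivWithin ℝ (fun z => f ((extChartAt (𝓡∂ (n + 1)) p).symm z)) (halfSpace n) y
      (EuclideanSpace.single i 1)
      = mfderiv (𝓡∂ (n + 1)) 𝓘(ℝ, F) f ((extChartAt (𝓡∂ (n + 1)) p).symm y) (coordVec p y i) := by
  have hs : UniqueMDiffWithinAt 𝓘(ℝ, EuclideanSpace ℝ (Fin (n + 1))) (halfSpace n) y :=
    (uniqueDiffOn_halfSpace y (extChartAt_target_subset_range p hy)).uniqueMDiffWithinAt
  have h1 := mfderiv_comp_mfderivWithin (I := 𝓘(ℝ, EuclideanSpace ℝ (Fin (n + 1)))) y hf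
    (mdifferentiableWithinAt_extChartAt_symm hy) hs
  rw [← mfderivWithin_eq_fderivWithin]
  exact congr_arg (fun L => L (EuclideanSpace.single i (1 : ℝ) : EuclideanSpace ℝ (Fin (n + 1)))) h1

lemma contMDiffWithinAt_coordVec (hy : y ∈ (extChartAt (𝓡∂ (n + 1)) p).target) (i : Fin (n + 1)) :
    ContMDiffWithinAt 𝓘(ℝ, EuclideanSpace ℝ (Fin (n + 1))) (𝓡∂ (n + 1)).tangent 2
      (fun z => (⟨(extChartAt (𝓡∂ (n + 1)) p).symm z, coordVec p z i⟩ :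
        TangentBundle (𝓡∂ (n + 1)) M)) (extChartAt (𝓡∂ (n + 1)) p).target y := by
  have hmd : UniqueMDiffOn 𝓘(ℝ, EuclideanSpace ℝ (Fin (n + 1)))
      (extChartAt (𝓡∂ (n + 1)) p).target := (uniqueDiffOn_extChartAt_target p).uniqueMDiffOn
  have h1 := (contMDiffOn_extChartAt_symm (I := 𝓡∂ (n + 1)) (n := ∞) p).contMDiffOn_tangentMapWithin
    (m := 2) (by norm_cast) hmd
  have h2 : ContMDiff 𝓘(ℝ, EuclideanSpace ℝ (Fin (n + 1)))
      𝓘(ℝ, EuclideanSpace ℝ (Fin (n + 1))).tangent 2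
      (fun z => (⟨z, EuclideanSpace.single i (1 : ℝ)⟩ :
        TangentBundle 𝓘(ℝ, EuclideanSpace ℝ (Fin (n + 1))) (EuclideanSpace ℝ (Fin (n + 1))))) :=
    contMDiff_vectorSpace_iff_contDiff.2 contDiff_const
  have h3 := h1.comp h2.contMDiffOn (s := (extChartAt (𝓡∂ (n + 1)) p).target) (fun z hz => hz)
  refine (h3 y hy).congr_of_mem (fun z hz => ?_) hy
  have h4 : mfderivWithin 𝓘(ℝ, EuclideanSpace ℝ (Fin (n + 1))) (𝓡∂ (n + 1))
      (extChartAt (𝓡∂ (n + 1)) p).symm (halfSpace n) z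
      = mfderivWithin 𝓘(ℝ, EuclideanSpace ℝ (Fin (n + 1))) (𝓡∂ (n + 1))
      (extChartAt (𝓡∂ (n + 1)) p).symm (extChartAt (𝓡∂ (n + 1)) p).target z := by
    exact ((mdifferentiableWithinAt_extChartAt_symm hz).hasMFDerivWithinAt.mono
      (extChartAt_target_subset_range p)).mfderivWithin (hmd z hz) |>.symm
  simp only [coordVec, h4, Function.comp_def, tangentMapWithin]

lemma contDiffWithinAt_coordTensor (hU : IsOpen U) {k : TensorField n M}
    (hk : ContMDiffOn (𝓡∂ (n + 1))
      ((𝓡∂ (n + 1)).prod 𝓘(ℝ, EuclideanSpace ℝ (Fin (n + 1)) →L[ℝ]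
        EuclideanSpace ℝ (Fin (n + 1)) →L[ℝ] ℝ)) 2
      (fun p => Bundle.TotalSpace.mk' (EuclideanSpace ℝ (Fin (n + 1)) →L[ℝ]
        EuclideanSpace ℝ (Fin (n + 1)) →L[ℝ] ℝ)
        (E := fun p : M => TangentSpace (𝓡∂ (n + 1)) p →L[ℝ] TangentSpace (𝓡∂ (n + 1)) p →L[ℝ] ℝ)
        p (k p)) U)
    (hy : y ∈ chartPart U p) (i j : Fin (n + 1)) :
    ContDiffWithinAt ℝ 2 (fun z => coordTensor p k z i j) (halfSpace n) y := by
  have h1 : ContMDiffOn 𝓘(ℝ, EuclideanSpace ℝ (Fin (n + 1))) (𝓡∂ (n + 1)) 2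
      (extChartAt (𝓡∂ (n + 1)) p).symm (chartPart U p) :=
    ((contMDiffOn_extChartAt_symm (n := ∞) p).of_le (by norm_cast)).mono
      Set.inter_subset_left
  have h2 := hk.comp h1 fun z hz => hz.2
  have h3 := fun i => (contMDiffWithinAt_coordVec hy.1 i).mono
    (Set.inter_subset_left (t := (extChartAt (𝓡∂ (n + 1)) p).symm ⁻¹' U))
  have h4 : ContMDiffWithinAt 𝓘(ℝ, EuclideanSpace ℝ (Fin (n + 1))) ((𝓡∂ (n + 1)).prod 𝓘(ℝ, ℝ)) 2
      (fun z => Bundle.TotalSpace.mk' ℝ (E := Bundle.Trivial M ℝ)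
        ((extChartAt (𝓡∂ (n + 1)) p).symm z) (coordTensor p k z i j)) (chartPart U p) y := by
    apply ContMDiffWithinAt.clm_bundle_apply₂ (F₁ := EuclideanSpace ℝ (Fin (n + 1)))
      (F₂ := EuclideanSpace ℝ (Fin (n + 1)))
    · exact h2 y hy
    · exact h3 i
    · exact h3 j
  simp only [Bundle.contMDiffWithinAt_totalSpace] at h4
  exact (h4.2.contDiffWithinAt).mono_of_mem_nhdsWithin
    ((isChartDomain_chartPart hU p).mem_nhdsWithin y hy)

end Charts

/-- The squared norm of a covector does not depend on the basis in which it is computed. -/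
lemma sum_inv_mul_mul_eq_of_basis {d : ℕ} {E : Type*} [NormedAddCommGroup E] [NormedSpace ℝ E]
    (B : E →L[ℝ] E →L[ℝ] ℝ) (θ : E →L[ℝ] ℝ) (L L' : EuclideanSpace ℝ (Fin d) ≃L[ℝ] E) :
    ∑ i, ∑ j, (Matrix.of fun i j => B (L (EuclideanSpace.single i 1))
        (L (EuclideanSpace.single j 1)))⁻¹ i j
        * θ (L (EuclideanSpace.single i 1)) * θ (L (EuclideanSpace.single j 1))
      = ∑ i, ∑ j, (Matrix.of fun i j => B (L' (EuclideanSpace.single i 1))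
        (L' (EuclideanSpace.single j 1)))⁻¹ i j
        * θ (L' (EuclideanSpace.single i 1)) * θ (L' (EuclideanSpace.single j 1)) := by
  set A : Matrix (Fin d) (Fin d) ℝ := Matrix.of fun i j => B (L (EuclideanSpace.single i 1))
    (L (EuclideanSpace.single j 1)) with hA
  set A' : Matrix (Fin d) (Fin d) ℝ := Matrix.of fun i j => B (L' (EuclideanSpace.single i 1))
    (L' (EuclideanSpace.single j 1)) with hA'
  set v : Fin d → ℝ := fun i => θ (L (EuclideanSpace.single i 1)) with hv
  set v' : Fin d → ℝ := fun i => θ (L' (EuclideanSpace.single i 1)) with hv'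
  -- the matrix of the change of basis, and its inverse
  set C : Matrix (Fin d) (Fin d) ℝ :=
    Matrix.of fun i j => (L.symm (L' (EuclideanSpace.single i 1))) j with hC
  set C' : Matrix (Fin d) (Fin d) ℝ :=
    Matrix.of fun i j => (L'.symm (L (EuclideanSpace.single i 1))) j with hC'
  have hexp : ∀ (ℓ : E →L[ℝ] ℝ) i, ℓ (L' (EuclideanSpace.single i 1))
      = ∑ j, C i j * ℓ (L (EuclideanSpace.single j 1)) := by
    intro ℓ i
    have h := clm_apply_eq_sum (ℓ.comp (L : EuclideanSpace ℝ (Fin d) →L[ℝ] E))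
      (L.symm (L' (EuclideanSpace.single i 1)))
    simpa [hC] using h
  have hCC' : C * C' = 1 := by
    ext i k
    have h := clm_apply_eq_sum ((EuclideanSpace.proj k :
      EuclideanSpace ℝ (Fin d) →L[ℝ] ℝ).comp ((L'.symm : E →L[ℝ] EuclideanSpace ℝ (Fin d)).comp
        (L : EuclideanSpace ℝ (Fin d) →L[ℝ] E))) (L.symm (L' (EuclideanSpace.single i 1)))
    simp only [ContinuousLinearMap.comp_apply, ContinuousLinearEquiv.coe_coe,
      ContinuousLinearEquiv.apply_symm_apply, ContinuousLinearEquiv.symm_apply_apply] at h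
    rw [Matrix.mul_apply, Matrix.one_apply]
    simp only [hC, hC', Matrix.of_apply]
    refine h.symm.trans ?_
    simp [eq_comm]
  have hC'C : C' * C = 1 := mul_eq_one_comm.1 hCC'
  have hAA' : A' = C * A * Cᵀ := by
    ext i j
    have h1 : A' i j = ∑ k, C i k * ∑ l, C j l * A k l := by
      have h2 := hexp (B.flip (L' (EuclideanSpace.single j 1))) i
      simp only [ContinuousLinearMap.flip_apply] at h2
      simp only [hA', hA, Matrix.of_apply, h2]
      exact Finset.sum_congr rfl fun k _ => by rw [hexp (B (L (EuclideanSpace.single k 1))) j]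
    rw [h1, Matrix.mul_apply]
    simp only [Matrix.mul_apply, Matrix.transpose_apply, Finset.mul_sum, Finset.sum_mul]
    rw [Finset.sum_comm]
    exact Finset.sum_congr rfl fun k _ => Finset.sum_congr rfl fun l _ => by ring
  have hvv' : v' = C *ᵥ v := funext fun i => hexp θ i
  have hCinv : C⁻¹ = C' := Matrix.inv_eq_right_inv hCC'
  have hinv : A'⁻¹ = C'ᵀ * A⁻¹ * C' := by
    rw [hAA', Matrix.mul_inv_rev, Matrix.mul_inv_rev, ← Matrix.transpose_nonsing_inv, hCinv,
      Matrix.mul_assoc]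
  have hquad : ∀ (P : Matrix (Fin d) (Fin d) ℝ) (x : Fin d → ℝ),
      ∑ i, ∑ j, P i j * x i * x j = x ⬝ᵥ (P *ᵥ x) := by
    intro P x
    simp only [dotProduct, mulVec, Finset.mul_sum]
    exact Finset.sum_congr rfl fun i _ => Finset.sum_congr rfl fun j _ => by ring
  rw [hquad _ v, hquad _ v', hinv, hvv', ← Matrix.mulVec_mulVec, ← Matrix.mulVec_mulVec,
    Matrix.mulVec_mulVec _ C' C, hC'C, Matrix.one_mulVec, Matrix.dotProduct_mulVec _ C'ᵀ,
    Matrix.vecMul_transpose, Matrix.mulVec_mulVec, hC'C, Matrix.one_mulVec]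

section Bridge

variable {n : ℕ} {M : Type*} [TopologicalSpace M] [ChartedSpace (EuclideanHalfSpace (n + 1)) M]
  [IsManifold (𝓡∂ (n + 1)) ∞ M]
  {U : Set M} {p p' : M} {y y' : EuclideanSpace ℝ (Fin (n + 1))}

/-- The coordinate vectors are the images of the standard basis under a linear isomorphism. -/
lemma exists_equiv_coordVec (hy : y ∈ (extChartAt (𝓡∂ (n + 1)) p).target) :
    ∃ L : EuclideanSpace ℝ (Fin (n + 1)) ≃L[ℝ]
        TangentSpace (𝓡∂ (n + 1)) ((extChartAt (𝓡∂ (n + 1)) p).symm y),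
      ∀ i, coordVec p y i = L (EuclideanSpace.single i 1) := by
  obtain ⟨L, hL⟩ := isInvertible_mfderivWithin_extChartAt_symm (I := 𝓡∂ (n + 1)) hy
  refine ⟨L, fun i => ?_⟩
  exact (congr_arg (fun T => T (EuclideanSpace.single i (1 : ℝ) :
    EuclideanSpace ℝ (Fin (n + 1)))) hL).symm

/-- The norm of the differential of a function can be computed in any chart. -/
lemma cGradSq_coord_eq (k : TensorField n M) {u : M → ℝ}
    (hy : y ∈ (extChartAt (𝓡∂ (n + 1)) p).target)
    (hy' : y' ∈ (extChartAt (𝓡∂ (n + 1)) p').target)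
    (h : (extChartAt (𝓡∂ (n + 1)) p).symm y = (extChartAt (𝓡∂ (n + 1)) p').symm y')
    (hu : MDifferentiableAt (𝓡∂ (n + 1)) 𝓘(ℝ, ℝ) u ((extChartAt (𝓡∂ (n + 1)) p).symm y)) :
    cGradSq (halfSpace n) (coordTensor p k) (coordFun p u) y
      = cGradSq (halfSpace n) (coordTensor p' k) (coordFun p' u) y' := by
  -- all tangent spaces are the model space, which makes it possible to move along `h`
  let k' : M → EuclideanSpace ℝ (Fin (n + 1)) →L[ℝ] EuclideanSpace ℝ (Fin (n + 1)) →L[ℝ] ℝ := k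
  let du : M → EuclideanSpace ℝ (Fin (n + 1)) →L[ℝ] ℝ :=
    fun q => mfderiv (𝓡∂ (n + 1)) 𝓘(ℝ, ℝ) u q
  have key : ∀ (p : M) (y : EuclideanSpace ℝ (Fin (n + 1))),
      y ∈ (extChartAt (𝓡∂ (n + 1)) p).target →
      MDifferentiableAt (𝓡∂ (n + 1)) 𝓘(ℝ, ℝ) u ((extChartAt (𝓡∂ (n + 1)) p).symm y) →
      ∃ L : EuclideanSpace ℝ (Fin (n + 1)) ≃L[ℝ] EuclideanSpace ℝ (Fin (n + 1)),
        cGradSq (halfSpace n) (coordTensor p k) (coordFun p u) y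
        = ∑ i, ∑ j, (Matrix.of fun i j => k' ((extChartAt (𝓡∂ (n + 1)) p).symm y)
            (L (EuclideanSpace.single i 1)) (L (EuclideanSpace.single j 1)))⁻¹ i j
          * du ((extChartAt (𝓡∂ (n + 1)) p).symm y) (L (EuclideanSpace.single i 1))
          * du ((extChartAt (𝓡∂ (n + 1)) p).symm y) (L (EuclideanSpace.single j 1)) := by
    intro p y hy hu
    obtain ⟨L, hL⟩ := exists_equiv_coordVec hy
    refine ⟨L, ?_⟩
    have h1 : ∀ i, pd (halfSpace n) i (coordFun p u) y
        = du ((extChartAt (𝓡∂ (n + 1)) p).symm y) (L (EuclideanSpace.single i 1)) := fun i =>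
      (fderivWithin_comp_symm hy hu i).trans (by rw [hL]; rfl)
    have h2 : coordTensor p k y = Matrix.of fun i j => k' ((extChartAt (𝓡∂ (n + 1)) p).symm y)
        (L (EuclideanSpace.single i 1)) (L (EuclideanSpace.single j 1)) := by
      ext i j
      simp only [coordTensor, Matrix.of_apply, hL]
      rfl
    simp only [cGradSq, h1, h2]
    rfl
  obtain ⟨L, hL⟩ := key p y hy hu
  obtain ⟨L', hL'⟩ := key p' y' hy' (h ▸ hu)
  rw [hL, hL', ← h]
  exact sum_inv_mul_mul_eq_of_basis _ _ _ _

lemma gradSq_symm (k : TensorField n M) {u : M → ℝ}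
    (hy : y ∈ (extChartAt (𝓡∂ (n + 1)) p).target)
    (hu : MDifferentiableAt (𝓡∂ (n + 1)) 𝓘(ℝ, ℝ) u ((extChartAt (𝓡∂ (n + 1)) p).symm y)) :
    gradSq k u ((extChartAt (𝓡∂ (n + 1)) p).symm y)
      = cGradSq (halfSpace n) (coordTensor p k) (coordFun p u) y :=
  (cGradSq_coord_eq k hy (mem_extChartAt_target _) (symm_coordPt _).symm hu).symm

lemma posDef_coordTensor {k : TensorField n M}
    (hy : y ∈ (extChartAt (𝓡∂ (n + 1)) p).target)
    (hs : ∀ v w, k ((extChartAt (𝓡∂ (n + 1)) p).symm y) v w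
      = k ((extChartAt (𝓡∂ (n + 1)) p).symm y) w v)
    (hpos : ∀ v, v ≠ 0 → 0 < k ((extChartAt (𝓡∂ (n + 1)) p).symm y) v v) :
    (coordTensor p k y).PosDef := by
  obtain ⟨L, hL⟩ := exists_equiv_coordVec hy
  refine Matrix.PosDef.of_dotProduct_mulVec_pos ?_ fun c hc => ?_
  · ext i j
    exact hs _ _
  · have h1 : L (WithLp.toLp 2 c) = ∑ i, c i • coordVec p y i := by
      have h2 : WithLp.toLp 2 c = ∑ i, c i • EuclideanSpace.single i (1 : ℝ) := by
        conv_lhs => rw [← (EuclideanSpace.basisFun (Fin (n + 1)) ℝ).sum_repr (WithLp.toLp 2 c)]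
        simp
      rw [h2, map_sum]
      exact Finset.sum_congr rfl fun i _ => by rw [map_smul, hL]
    have h3 : L (WithLp.toLp 2 c) ≠ 0 := by
      rw [Ne, EmbeddingLike.map_eq_zero_iff]
      intro h; exact hc (by simpa using congr_arg WithLp.ofLp h)
    have h4 := hpos _ h3
    rw [h1] at h4
    have h5 : ∀ (B : EuclideanSpace ℝ (Fin (n + 1)) →L[ℝ] EuclideanSpace ℝ (Fin (n + 1)) →L[ℝ] ℝ)
        (v : Fin (n + 1) → EuclideanSpace ℝ (Fin (n + 1))),
        star c ⬝ᵥ ((Matrix.of fun i j => B (v i) (v j)) *ᵥ c)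
          = B (∑ i, c i • v i) (∑ i, c i • v i) := by
      intro B v
      simp only [dotProduct, mulVec, Matrix.of_apply, map_sum, map_smul, _root_.sum_apply,
        _root_.smul_apply, smul_eq_mul, Pi.star_apply, star_trivial, Finset.mul_sum]
      rw [Finset.sum_comm]
      exact Finset.sum_congr rfl fun i _ => Finset.sum_congr rfl fun j _ => by ring
    exact h4.trans_eq (h5 _ _).symm

/-- The coordinate vectors other than `∂₀` are tangent to the boundary. -/
lemma isTangentToBoundary_coordVec (hy : y ∈ (extChartAt (𝓡∂ (n + 1)) p).target) (hy0 : y 0 = 0)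
    (i : Fin n) : IsTangentToBoundary ((extChartAt (𝓡∂ (n + 1)) p).symm y)
      (coordVec p y i.succ) := by
  set q := (extChartAt (𝓡∂ (n + 1)) p).symm y with hq
  have hmd : MDifferentiableAt (𝓡∂ (n + 1)) 𝓘(ℝ, EuclideanSpace ℝ (Fin (n + 1)))
      (extChartAt (𝓡∂ (n + 1)) q) q := mdifferentiableAt_extChartAt (mem_chart_source _ q)
  have h1 := fderivWithin_comp_symm hy hmd i.succ
  have hV : (extChartAt (𝓡∂ (n + 1)) p).target ∩ (extChartAt (𝓡∂ (n + 1)) p).symm ⁻¹'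
      (extChartAt (𝓡∂ (n + 1)) q).source ∈ 𝓝[halfSpace n] y :=
    (isChartDomain_chartPart (isOpen_extChartAt_source q) p).mem_nhdsWithin y
      ⟨hy, mem_extChartAt_source q⟩
  have hdiff : DifferentiableWithinAt ℝ (fun z => extChartAt (𝓡∂ (n + 1)) q
      ((extChartAt (𝓡∂ (n + 1)) p).symm z)) (halfSpace n) y := by
    rw [← mdifferentiableWithinAt_iff_differentiableWithinAt]
    exact MDifferentiableAt.comp_mdifferentiableWithinAt (I' := 𝓡∂ (n + 1)) y hmd
      (mdifferentiableWithinAt_extChartAt_symm hy)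
  have h2 : HasFDerivWithinAt (fun z => (extChartAt (𝓡∂ (n + 1)) q
      ((extChartAt (𝓡∂ (n + 1)) p).symm z)) 0) _ (halfSpace n) y :=
    (EuclideanSpace.proj (0 : Fin (n + 1)) :
      EuclideanSpace ℝ (Fin (n + 1)) →L[ℝ] ℝ).hasFDerivAt.comp_hasFDerivWithinAt y
      hdiff.hasFDerivWithinAt
  have h3 : pd (halfSpace n) i.succ (fun z => (extChartAt (𝓡∂ (n + 1)) q
      ((extChartAt (𝓡∂ (n + 1)) p).symm z)) 0) y = 0 := by
    refine pd_succ_eq_zero hy0 h2.differentiableWithinAt ?_ i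
    filter_upwards [hV] with z hz hz0
    have h4 := (symm_mem_boundary_iff hz.1).2 hz0
    have h5 := symm_mem_boundary_iff ((extChartAt (𝓡∂ (n + 1)) q).map_source hz.2)
    rw [(extChartAt (𝓡∂ (n + 1)) q).left_inv hz.2] at h5
    exact h5.1 h4
  rw [pd_eq_of_hasFDerivWithinAt
    (uniqueDiffOn_halfSpace y (extChartAt_target_subset_range p hy)) h2] at h3
  have h6 : (fderivWithin ℝ (fun z => extChartAt (𝓡∂ (n + 1)) q
      ((extChartAt (𝓡∂ (n + 1)) p).symm z)) (halfSpace n) y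
      (EuclideanSpace.single i.succ 1)) 0 = 0 := h3
  rw [h1] at h6
  exact h6

variable {g h₀ gbar : TensorField n M} {x : M → ℝ}

namespace IsSpecialBdf

lemma contDiffWithinAt (hU : IsOpen U) (hx : IsSpecialBdf g h₀ U x gbar)
    (hy : y ∈ chartPart U p) : ContDiffWithinAt ℝ 2 (coordFun p x) (halfSpace n) y := by
  obtain ⟨ρ, ψ, hρ, hψ, hxe⟩ := hx.defining
  have h1 := contDiffWithinAt_coordFun hU hψ hy
  have h2 : ContDiffWithinAt ℝ 2 (coordFun p ρ) (halfSpace n) y :=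
    contDiffWithinAt_coordFun hU ((hρ.smooth.of_le (by norm_cast)).contMDiffOn) hy
  refine (h1.exp.mul h2).congr_of_eventuallyEq
    ((isChartDomain_chartPart (n := n) hU p).eventually hy fun z hz => ?_) ?_
  · exact hxe _ hz.2
  · exact hxe _ hy.2

lemma pos_of_interior (hx : IsSpecialBdf g h₀ U x gbar) {q : M} (hq : q ∈ U)
    (hq' : q ∈ (𝓡∂ (n + 1)).interior M) : 0 < x q := by
  obtain ⟨ρ, ψ, hρ, -, hxe⟩ := hx.defining
  rw [hxe q hq]
  refine mul_pos (Real.exp_pos _) (lt_of_le_of_ne (hρ.nonneg q) fun h => ?_)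
  have := (hρ.eq_zero_iff q).1 h.symm
  rw [← (𝓡∂ (n + 1)).compl_interior] at this
  exact this hq'

lemma eq_zero_of_boundary (hx : IsSpecialBdf g h₀ U x gbar) {q : M} (hq : q ∈ U)
    (hq' : q ∈ (𝓡∂ (n + 1)).boundary M) : x q = 0 := by
  obtain ⟨ρ, ψ, hρ, -, hxe⟩ := hx.defining
  rw [hxe q hq, (hρ.eq_zero_iff q).2 hq', mul_zero]

lemma coordFun_pos (hx : IsSpecialBdf g h₀ U x gbar) (hy : y ∈ chartPart U p) (hy0 : 0 < y 0) :
    0 < coordFun p x y :=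
  hx.pos_of_interior hy.2 ((symm_mem_interior_iff (n := n) hy.1).2 hy0)

lemma isMetricOn (hU : IsOpen U) (hx : IsSpecialBdf g h₀ U x gbar) (p : M) :
    IsMetricOn (halfSpace n) (chartPart U p) (coordTensor p gbar) where
  posDef _ hy := posDef_coordTensor hy.1 (hx.symm _ hy.2) (hx.pos _ hy.2)
  contDiff _ hy i j := contDiffWithinAt_coordTensor hU hx.contMDiffOn hy i j

lemma coordTensor_eq (hx : IsSpecialBdf g h₀ U x gbar) (hy : y ∈ chartPart U p) (hy0 : 0 < y 0) :
    coordTensor p gbar y = coordFun p x y ^ 2 • coordTensor p g y := by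
  have h := hx.eq_sq_smul _ hy.2 ((symm_mem_interior_iff (n := n) hy.1).2 hy0)
  ext i j
  simp only [coordTensor, Matrix.of_apply, h, Matrix.smul_apply]
  rfl

/-- The eikonal equation `|dx| = 1` for the compactified metric, at the interior points. -/
lemma cGradSq_eq_one (hU : IsOpen U) (hx : IsSpecialBdf g h₀ U x gbar) (hy : y ∈ chartPart U p)
    (hy0 : 0 < y 0) : cGradSq (halfSpace n) (coordTensor p gbar) (coordFun p x) y = 1 := by
  have hV := isChartDomain_chartPart (n := n) hU p
  have hxpos := hx.coordFun_pos hy hy0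
  have hint := (symm_mem_interior_iff (n := n) hy.1).2 hy0
  have hmd : MDifferentiableAt (𝓡∂ (n + 1)) 𝓘(ℝ, ℝ) (fun q => Real.log (x q))
      ((extChartAt (𝓡∂ (n + 1)) p).symm y) := by
    obtain ⟨ρ, ψ, hρ, hψ, hxe⟩ := hx.defining
    set q := (extChartAt (𝓡∂ (n + 1)) p).symm y with hq
    have h1 : MDifferentiableAt (𝓡∂ (n + 1)) 𝓘(ℝ, ℝ) ρ q :=
      hρ.smooth.mdifferentiableAt (by simp)
    have h2 : MDifferentiableAt (𝓡∂ (n + 1)) 𝓘(ℝ, ℝ) ψ q :=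
      (hψ.contMDiffAt (hU.mem_nhds hy.2)).mdifferentiableAt (by norm_num)
    have hρ0 : ρ q ≠ 0 := by
      intro h0
      have h3 : x q = 0 := by rw [hxe q hy.2, h0, mul_zero]
      exact hxpos.ne' h3
    have h4 : MDifferentiableAt (𝓡∂ (n + 1)) 𝓘(ℝ, ℝ) (fun q => ψ q + Real.log (ρ q)) q := by
      have h5 : MDifferentiableAt 𝓘(ℝ, ℝ) 𝓘(ℝ, ℝ) Real.log (ρ q) :=
        (Real.differentiableAt_log hρ0).mdifferentiableAt
      exact h2.add (h5.comp q h1)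
    refine h4.congr_of_eventuallyEq ?_
    have h6 : ∀ᶠ t in 𝓝 q, ρ t ≠ 0 := h1.continuousAt.eventually_ne hρ0
    filter_upwards [h6, hU.mem_nhds hy.2] with t ht htU
    rw [hxe t htU, Real.log_mul (Real.exp_pos _).ne' ht, Real.log_exp]
  have h1 := hx.eikonal _ hy.2 hint
  rw [gradSq_symm g hy.1 hmd] at h1
  have hd := (hx.contDiffWithinAt hU hy).differentiableWithinAt (by norm_num)
  have h2 : ∀ i, pd (halfSpace n) i (coordFun p fun q => Real.log (x q)) y
      = (coordFun p x y)⁻¹ * pd (halfSpace n) i (coordFun p x) y := fun i =>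
    pd_comp (hV.unique hy) (Real.hasDerivAt_log hxpos.ne') hd
  have h3 : (coordTensor p gbar y)⁻¹ = ((coordFun p x y)⁻¹ ^ 2) • (coordTensor p g y)⁻¹ := by
    rw [hx.coordTensor_eq hy hy0]
    have := (hx.isMetricOn hU p).isUnit_det hy
    rw [hx.coordTensor_eq hy hy0, Matrix.det_smul] at this
    have hu : IsUnit (coordTensor p g y).det := isUnit_of_mul_isUnit_right this
    refine Matrix.inv_eq_right_inv ?_
    rw [Matrix.smul_mul, Matrix.mul_smul, Matrix.mul_nonsing_inv _ hu, smul_smul, ← mul_pow,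
      mul_inv_cancel₀ hxpos.ne', one_pow, one_smul]
  rw [← h1]
  simp only [cGradSq, h2, h3, Matrix.smul_apply, smul_eq_mul]
  exact Finset.sum_congr rfl fun i _ => Finset.sum_congr rfl fun j _ => by ring

/-- A special boundary defining function, read in a chart. At the boundary, the eikonal equation
holds by continuity. -/
theorem isSpecialBdfOn (hU : IsOpen U) (hx : IsSpecialBdf g h₀ U x gbar) (p : M) :
    IsSpecialBdfOn n (chartPart U p) (coordTensor p gbar) (coordFun p x) where
  toIsMetricOn := hx.isMetricOn hU p
  contDiff_fun _ hy := hx.contDiffWithinAt hU hy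
  eikonal y hy := by
    have hV := isChartDomain_chartPart (n := n) hU p
    have ha := hx.isMetricOn hU p
    have hc : ContinuousWithinAt (cGradSq (halfSpace n) (coordTensor p gbar) (coordFun p x))
        (halfSpace n) y := by
      refine tendsto_finsetSum _ fun i _ => tendsto_finsetSum _ fun j _ => ?_
      exact ((ha.contDiff_inv hy i j).continuousWithinAt.mul
        (hV.contDiff_pd hy (hx.contDiffWithinAt hU hy) i).continuousWithinAt).mul
        (hV.contDiff_pd hy (hx.contDiffWithinAt hU hy) j).continuousWithinAt
    have hfr : ∃ᶠ z in 𝓝[halfSpace n] y,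
        cGradSq (halfSpace n) (coordTensor p gbar) (coordFun p x) z ∈ ({1} : Set ℝ) :=
      ((frequently_pos (hV.subset hy)).and_eventually (hV.mem_nhdsWithin y hy)).mono
        fun z hz => hx.cGradSq_eq_one hU hz.2 hz.1
    exact isClosed_singleton.mem_of_frequently_of_tendsto hfr hc
  nonneg y hy := by
    rcases (mem_halfSpace.1 ((isChartDomain_chartPart (n := n) hU p).subset hy)).lt_or_eq with h | h
    · exact (hx.coordFun_pos hy h).le
    · exact (hx.eq_zero_of_boundary hy.2 ((symm_mem_boundary_iff (n := n) hy.1).2 h.symm)).ge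
  eq_zero _ hy hy0 := hx.eq_zero_of_boundary hy.2 ((symm_mem_boundary_iff (n := n) hy.1).2 hy0)

lemma bdryTensor_eq (hx : IsSpecialBdf g h₀ U x gbar) {z : EuclideanSpace ℝ (Fin n)}
    (hz : face z ∈ chartPart U p) :
    bdryTensor p h₀ z = (coordTensor p gbar (face z)).submatrix Fin.succ Fin.succ := by
  ext i j
  exact (hx.boundary_metric _ ((symm_mem_boundary_iff hz.1).2 (face_zero z)) _ _
    (isTangentToBoundary_coordVec hz.1 (face_zero z) i)
    (isTangentToBoundary_coordVec hz.1 (face_zero z) j)).symm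

end IsSpecialBdf

lemma face_bdryPt (hp : p ∈ (𝓡∂ (n + 1)).boundary M) : face (bdryPt (n := n) p) = coordPt p := by
  have h0 : coordPt (n := n) p 0 = 0 := by
    refine (symm_mem_boundary_iff (mem_extChartAt_target p)).1 ?_
    rwa [extChartAt_to_inv]
  ext i
  refine Fin.cases ?_ (fun j => ?_) i
  · rw [h0, face_zero]
  · rw [face_succ]; rfl

end Bridge

end ConfCompact

open ConfCompact in
theorem proposition4p1 {n : ℕ} {M : Type*} [TopologicalSpace M]
    [ChartedSpace (EuclideanHalfSpace (n + 1)) M] [IsManifold (𝓡∂ (n + 1)) ∞ M]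
    (g h₀ gbar : ConfCompact.TensorField n M) (φ₀ φ x xhat : M → ℝ)
    (U : Set M) (hU : IsOpen U) (hbU : (𝓡∂ (n + 1)).boundary M ⊆ U)
    (hx : ConfCompact.IsSpecialBdf g h₀ U x gbar)
    (hφ : ContMDiffOn (𝓡∂ (n + 1)) 𝓘(ℝ, ℝ) 2 φ U)
    (hφ₀ : ∀ p ∈ (𝓡∂ (n + 1)).boundary M, φ p = φ₀ p)
    (hxhat_eq : ∀ p ∈ U, xhat p = Real.exp (φ p) * x p)
    (hxhat : ConfCompact.IsSpecialBdf g (fun p => Real.exp (2 * φ₀ p) • h₀ p) U xhat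
      (fun p => Real.exp (2 * φ p) • gbar p)) :
    (∀ ε : ℝ, ∀ p ∈ U, p ∈ (𝓡∂ (n + 1)).interior M → xhat p = ε →
      ConfCompact.meanCurvature g xhat p =
        n - ε ^ 2 * (Real.exp (-2 * φ p) *
          (1 / 2 * (x p)⁻¹ * ConfCompact.trDxH gbar x p + ConfCompact.laplacian gbar φ p
            + ((n : ℝ) - 1) / 2 * ConfCompact.gradSq gbar φ p))) ∧
    (∀ p ∈ (𝓡∂ (n + 1)).boundary M,
      ConfCompact.kappa₁ (fun q => Real.exp (2 * φ q) • gbar q) xhat p =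
        Real.exp (-φ₀ p) * ConfCompact.kappa₁ gbar x p ∧
      ConfCompact.kappa₂ (fun q => Real.exp (2 * φ q) • gbar q) xhat p =
        Real.exp (-2 * φ₀ p) *
          (ConfCompact.kappa₂ gbar x p + ConfCompact.bdryLaplacian h₀ φ₀ p
            + ((n : ℝ) - 2) / 2 * ConfCompact.bdryGradSq h₀ φ₀ p)) := by
  have hpair : ∀ p : M, IsSpecialPair (halfSpace n) (chartPart U p) (coordTensor p gbar)
      (coordTensor p fun q => Real.exp (2 * φ q) • gbar q) (coordFun p x) (coordFun p xhat)
      (coordFun p φ) := fun p =>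
    { special := (hx.isSpecialBdfOn hU p).toIsSpecialOn
      special' := (hxhat.isSpecialBdfOn hU p).toIsSpecialOn
      contDiff := fun z hz => contDiffWithinAt_coordFun hU hφ hz
      metric_eq := fun z hz => rfl
      fun_eq := fun z hz => hxhat_eq _ hz.2
      frequently_ne := fun z hz =>
        ((frequently_pos ((isChartDomain_chartPart (n := n) hU p).subset hz)).and_eventually
          ((isChartDomain_chartPart (n := n) hU p).mem_nhdsWithin z hz)).mono
          fun t ht => (hx.coordFun_pos ht.2 ht.1).ne' }
  refine ⟨fun ε p hp hpi hε => ?_, fun p hpb => ?_⟩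
  · have hV := isChartDomain_chartPart (n := n) hU p
    have hpV := coordPt_mem_chartPart (n := n) hp
    have hp0 : 0 < coordPt (n := n) p 0 := by
      refine (symm_mem_interior_iff (n := n) (mem_extChartAt_target p)).1 ?_
      rwa [extChartAt_to_inv]
    have h' := (hpair p).special'
    have hpos : IsSpecialOn (halfSpace n) (chartPart U p ∩ {z | 0 < z 0})
        (coordTensor p fun q => Real.exp (2 * φ q) • gbar q) (coordFun p xhat) :=
      { posDef := fun z hz => h'.posDef z hz.1
        contDiff := fun z hz => h'.contDiff z hz.1
        contDiff_fun := fun z hz => h'.contDiff_fun z hz.1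
        eikonal := fun z hz => h'.eikonal z hz.1 }
    have hH : meanCurvature g xhat p = ((n + 1 : ℕ) : ℝ) - 1 - coordFun p xhat (coordPt p)
        * cLaplacian (halfSpace n) (coordTensor p fun q => Real.exp (2 * φ q) • gbar q)
          (coordFun p xhat) (coordPt p) :=
      hpos.cMeanCurvature_eq (isChartDomain_pos hV) (fun z hz => hxhat.coordFun_pos hz.1 hz.2)
        (fun z hz => hxhat.coordTensor_eq hz.1 hz.2) ⟨hpV, hp0⟩
    have htr : trDxH gbar x p
        = 2 * cLaplacian (halfSpace n) (coordTensor p gbar) (coordFun p x) (coordPt p) :=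
      (hpair p).special.trPerp_lie_cH hV hpV
    have hx0 : x p ≠ 0 := (hx.pos_of_interior hp hpi).ne'
    rw [hH, (hpair p).cLaplacian_fun hV hpV, htr, ← hε]
    simp only [coordFun_coordPt, hxhat_eq p hp]
    have he : Real.exp (-2 * φ p) = Real.exp (-φ p) ^ 2 := by
      rw [← Real.exp_nat_mul]; ring_nf
    have hone : Real.exp (-φ p) * Real.exp (φ p) = 1 := by rw [← Real.exp_add]; simp
    have hinv : x p * (x p)⁻¹ = 1 := mul_inv_cancel₀ hx0
    change _ = (n : ℝ) - (Real.exp (φ p) * x p) ^ 2 * (Real.exp (-2 * φ p) *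
      (1 / 2 * (x p)⁻¹ * (2 * cLaplacian (halfSpace n) (coordTensor p gbar) (coordFun p x)
          (coordPt p))
        + cLaplacian (halfSpace n) (coordTensor p gbar) (coordFun p φ) (coordPt p)
        + ((n : ℝ) - 1) / 2
          * cGradSq (halfSpace n) (coordTensor p gbar) (coordFun p φ) (coordPt p)))
    generalize cLaplacian (halfSpace n) (coordTensor p gbar) (coordFun p x) (coordPt p) = L
    generalize cLaplacian (halfSpace n) (coordTensor p gbar) (coordFun p φ) (coordPt p) = D
    generalize cGradSq (halfSpace n) (coordTensor p gbar) (coordFun p φ) (coordPt p) = G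
    have e1 : (Real.exp (φ p) * x p) ^ 2 * (Real.exp (-2 * φ p) *
        (1 / 2 * (x p)⁻¹ * (2 * L) + D + ((n : ℝ) - 1) / 2 * G))
        = (Real.exp (-φ p) * Real.exp (φ p)) ^ 2 * (x p * (x p * (x p)⁻¹) * L
          + x p ^ 2 * (D + ((n : ℝ) - 1) / 2 * G)) := by
      rw [he]; ring
    have e2 : Real.exp (φ p) * x p * (Real.exp (-φ p) * (L + x p * (D
        + (((n + 1 : ℕ) : ℝ) - 2) / 2 * G)))
        = (Real.exp (-φ p) * Real.exp (φ p)) * (x p * L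
          + x p ^ 2 * (D + (((n + 1 : ℕ) : ℝ) - 2) / 2 * G)) := by
      ring
    rw [e1, e2, hone, hinv]
    push_cast
    ring
  · have hV := isChartDomain_chartPart (n := n) hU p
    have hpV := coordPt_mem_chartPart (n := n) (hbU hpb)
    have hface := face_bdryPt (n := n) hpb
    have hp0 : coordPt (n := n) p 0 = 0 := by rw [← hface, face_zero]
    have hu := hx.isSpecialBdfOn hU p
    have hu' := hxhat.isSpecialBdfOn hU p
    have hk1 : ∀ {k : TensorField n M} {u : M → ℝ},
        IsSpecialBdfOn n (chartPart U p) (coordTensor p k) (coordFun p u) →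
        kappa₁ k u p = cLaplacian (halfSpace n) (coordTensor p k) (coordFun p u) (coordPt p) := by
      intro k u h
      rw [← h.half_tr_lie_cH hV hpV (h.pd_succ hV hpV hp0)]
      simp [kappa₁, hCoeff, cDx]
    have hk2 : ∀ {k : TensorField n M} {u : M → ℝ},
        IsSpecialBdfOn n (chartPart U p) (coordTensor p k) (coordFun p u) →
        kappa₂ k u p = ∑ i, cGrad (halfSpace n) (coordTensor p k) (coordFun p u) (coordPt p) i
          * pd (halfSpace n) i (cLaplacian (halfSpace n) (coordTensor p k) (coordFun p u))
            (coordPt p) := by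
      intro k u h
      rw [← h.tr_lie_lie_cH hV hpV (h.pd_succ hV hpV hp0)
        (h.differentiableWithinAt_cHess hV hpV hp0)]
      simp [kappa₂, hCoeff, cDx]
    have hy : face (bdryPt (n := n) p) ∈ chartPart U p := by rwa [hface]
    have hf : ∀ z : EuclideanSpace ℝ (Fin n), face z ∈ chartPart U p →
        bdryFun p φ₀ z = coordFun p φ (face z) := fun z hz =>
      (hφ₀ _ ((symm_mem_boundary_iff hz.1).2 (face_zero z))).symm
    have hL := cLaplacian_face hV (hpair p) hu (fun z hz => hx.bdryTensor_eq hz) hf hy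
    have hG := cGradSq_face hV (hpair p) hu (fun z hz => hx.bdryTensor_eq hz) hf hy
    rw [hface] at hL hG
    have hL' : bdryLaplacian h₀ φ₀ p = _ := hL
    have hG' : bdryGradSq h₀ φ₀ p = _ := hG
    refine ⟨?_, ?_⟩
    · rw [hk1 hu', hk1 hu, (hpair p).cLaplacian_fun hV hpV, hu.eq_zero _ hpV hp0, zero_mul,
        add_zero, coordFun_coordPt, hφ₀ p hpb]
    · rw [hk2 hu', hk2 hu, (hpair p).sum_grad_mul_pd_cLaplacian hV hu hpV hp0, hL', hG',
        coordFun_coordPt, hφ₀ p hpb, ← neg_mul]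
      ring
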